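/- \textbf{Setting.} Let $\Omega=(0,1)^2$, let $k\ge 1$ be an integer, and consider $$-\varepsilon_1\Delta u+\varepsilon_2 b(x)u_x+c(x)u=f\ \text{ in }\Omega,\qquad u|_{\partial\Omega}=0,$$ where $b\in C^1[0,1]$, $c\in C[0,1]$, $f\in C(\bar\Omega)$, $b\ge\lambda>0$, $c\ge\beta>0$, $c-\tfrac12\varepsilon_2 b'\ge\gamma>0$ on $[0,1]$, $f$ vanishes at the four corners of $\Omega$, and $0<\varepsilon_1,\varepsilon_2\le\varepsilon_0$ for a fixed $\varepsilon_0\in(0,1)$. Put $b_*=\max_{[0,1]}b$, $$\mu_0=\frac{-\varepsilon_2b_*+\sqrt{\varepsilon_2^2b_*^2+4\varepsilon_1\beta}}{2\varepsilon_1},\qquad \mu_1=\frac{\varepsilon_2\lambda+\sqrt{\varepsilon_2^2\lambda^2+4\varepsilon_1\beta}}{2\varepsilon_1}.$$ Let $p\in(0,1)$, $k_0\in(0,\tfrac12)$, $\delta>0$ with $2\|b'\|_\infty\varepsilon_2\le k_0(1-p)\beta$ and $\delta^2\le(1-p)\beta/2$. \textbf{Assumption on the solution.} The classical solution $u$ is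 decomposed on $\bar\Omega$ as $u=S+E_{10}+E_{11}+E_{20}+E_{21}+E_{31}+E_{32}+E_{33}+E_{34}$ with components in $C^{k+1}(\bar\Omega)$ such that, for a constant $C_0$ and for all $0\le i+j\le k+1$ and $(x,y)\in\bar\Omega$, the derivative $\partial_x^i\partial_y^j$ of the component is bounded in absolute value by $C_0$ for $S$; by $C_0\mu_0^ie^{-p\mu_0x}$ for $E_{10}$; $C_0\mu_1^ie^{-p\mu_1(1-x)}$ for $E_{11}$; $C_0\varepsilon_1^{-j/2}e^{-\delta y/\sqrt{\varepsilon_1}}$ for $E_{20}$; $C_0\varepsilon_1^{-j/2}e^{-\delta(1-y)/\sqrt{\varepsilon_1}}$ for $E_{21}$; $C_0\varepsilon_1^{-j/2}\mu_0^ie^{-p\mu_0x}e^{-\delta y/\sqrt{\varepsilon_1}}$ for $E_{31}$; $C_0\varepsilon_1^{-j/2}\mu_1^ie^{-p\mu_1(1-x)}e^{-\delta y/\sqrt{\varepsilon_1}}$ for $E_{32}$; $C_0\varepsilon_1^{-j/2}\mu_1^ie^{-p\mu_1(1-x)}e^{-\delta(1-y)/\sqrt{\varepsilon_1}}$ for $E_{33}$;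 $C_0\varepsilon_1^{-j/2}\mu_0^ie^{-p\mu_0x}e^{-\delta(1-y)/\sqrt{\varepsilon_1}}$ for $E_{34}$. \textbf{Mesh.} Let $N\ge 8$ be divisible by $4$, $\tau\ge k+1$ real, $t_i=i/N$, $\sigma_{x,i}=\frac{\tau}{p\mu_i}\ln\mu_i$ ($i=0,1$), $\sigma_y=\frac{\tau}{\delta}\sqrt{\varepsilon_1}\ln\frac1{\sqrt{\varepsilon_1}}$, and assume $\mu_1^{-1}\le\mu_0^{-1}\le N^{-1}$ and $\sigma_{x,0},\sigma_{x,1},\sigma_y\le\frac14$. With $\varphi_r(t)=-\ln(1-4(1-r)t)$, the Bakhvalov-type mesh is the tensor product of the points $$x_i=\begin{cases}\frac{\tau}{p\mu_0}\varphi_{1/\mu_0}(t_i),&0\le i\le \frac N4,\\ \sigma_{x,0}+2(t_i-\frac14)(1-\sigma_{x,0}-\sigma_{x,1}),&\frac N4\le i\le\frac{3N}4,\\ 1-\frac{\tau}{p\mu_1}\varphi_{1/\mu_1}(1-t_i),&\frac{3N}4\le i\le N,\end{cases}$$ $$y_j=\begin{cases}\frac{\tau}{\delta}\sqrt{\varepsilon_1}\,\varphi_{\sqrt{\varepsilon_1}}(t_j),&0\le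 j\le \frac N4,\\ \sigma_y+2(t_j-\frac14)(1-2\sigma_y),&\frac N4\le j\le\frac{3N}4,\\ 1-\frac{\tau}{\delta}\sqrt{\varepsilon_1}\,\varphi_{\sqrt{\varepsilon_1}}(1-t_j),&\frac{3N}4\le j\le N.\end{cases}$$ \textbf{Interpolants.} Let $x_i^s=x_i+\frac sk(x_{i+1}-x_i)$, $y_j^t=y_j+\frac tk(y_{j+1}-y_j)$ (with $x_N^0=x_N$, $y_N^0=y_N$), and let $\theta_{i,j}^{s,t}$ be the continuous, piecewise $\mathcal Q_k$ Lagrange basis function that is $1$ at the node $(x_i^s,y_j^t)$ and $0$ at all other nodes. Let $v^I$ be the nodal Lagrange interpolant of $v$, and let $$Pv=\sum_{s=1}^k\Big(\sum_{j=0}^{N-1}\sum_{t=0}^{k-1}v(x_{3N/4}^s,y_j^t)\theta_{3N/4,j}^{s,t}+v(x_{3N/4}^s,y_N^0)\theta_{3N/4,N}^{s,0}\Big),$$ $$\Theta v=\sum_{s=1}^k v(x_{3N/4}^s,y_0^0)\theta_{3N/4,0}^{s,0}+\sum_{s=1}^k v(x_{3N/4}^s,y_N^0)\theta_{3N/4,N}^{s,0}.$$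 Put $\pi_aE_a=E_a^I-PE_a+\Theta E_a$ for $a=11,32,33$, and $$\Pi u=S^I+E_{10}^I+\pi_{11}E_{11}+E_{20}^I+E_{21}^I+E_{31}^I+\pi_{32}E_{32}+\pi_{33}E_{33}+E_{34}^I.$$ Let $\|\cdot\|$ be the norm of $L^2(\Omega)$ and $\|v\|_E^2=\varepsilon_1|v|_{H^1(\Omega)}^2+\|v\|^2$ for $v\in H^1(\Omega)$, where $|v|_{H^1(\Omega)}=\|\nabla v\|$. \textbf{Theorem.} There is a constant $C>0$, depending only on $k,b,c,\lambda,\beta,\gamma,p,k_0,\delta,\tau,\varepsilon_0,C_0$ (so independent of $\varepsilon_1$, $\varepsilon_2$, $N$, $f$, $u$ and the decomposition), such that in the setting above $$\sum_{a\in\{11,32,33\}}\|\pi_aE_a-E_a\|\le CN^{-(k+1)},$$ and $u-u^I$, $u-\Pi u$ belong to $H^1(\Omega)$ with $$\|u-u^I\|_E+\|u-\Pi u\|_E\le C\Big((\varepsilon_1^{1/2}+\varepsilon_2)^{1/2}N^{-k}+N^{-(k+1)}\Big).$$ -/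

import Mathlib

open Set MeasureTheory
open scoped ContDiff

namespace TwoParam

noncomputable section

/-! ## The unit square and partial derivatives -/

/-- `Ω = (0,1) × (0,1)`. -/
def Omega : Set (ℝ × ℝ) := Ioo (0 : ℝ) 1 ×ˢ Ioo (0 : ℝ) 1

/-- The closed unit square. -/
def OmegaBar : Set (ℝ × ℝ) := Icc (0 : ℝ) 1 ×ˢ Icc (0 : ℝ) 1

/-- The classical partial derivative `∂^{i+j} v / ∂x^i ∂y^j` on the closed unit square
(one-sided at the boundary, the usual two-sided one in the interior). -/
def partialD (i j : ℕ) (v : ℝ × ℝ → ℝ) (z : ℝ × ℝ) : ℝ :=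
  iteratedDerivWithin i
    (fun x => iteratedDerivWithin j (fun y => v (x, y)) (Icc 0 1) z.2) (Icc 0 1) z.1

/-! ## Weak derivatives, `H¹(Ω)`, and norms -/

/-- `g` is the weak derivative on `Ω` of `v` in the direction `e`. -/
def IsWeakPartial (e : ℝ × ℝ) (v g : ℝ × ℝ → ℝ) : Prop :=
  ∀ φ : ℝ × ℝ → ℝ, ContDiff ℝ ∞ φ → HasCompactSupport φ → tsupport φ ⊆ Omega →
    ∫ z in Omega, v z * fderiv ℝ φ z e = - ∫ z in Omega, g z * φ z

/-- `v ∈ L²(Ω)`. -/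
def MemL2 (v : ℝ × ℝ → ℝ) : Prop := MemLp v 2 (volume.restrict Omega)

/-- `v` has a weak derivative in the direction `e` that belongs to `L²(Ω)`. -/
def HasL2WeakPartial (e : ℝ × ℝ) (v : ℝ × ℝ → ℝ) : Prop :=
  ∃ g : ℝ × ℝ → ℝ, MemL2 g ∧ IsWeakPartial e v g

/-- `v ∈ H¹(Ω)`. -/
def MemH1 (v : ℝ × ℝ → ℝ) : Prop :=
  MemL2 v ∧ HasL2WeakPartial (1, 0) v ∧ HasL2WeakPartial (0, 1) v

open Classical in
/-- The weak derivative of `v` in the direction `e` (and `0` if there is none in `L²(Ω)`). -/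
def weakPartial (e : ℝ × ℝ) (v : ℝ × ℝ → ℝ) : ℝ × ℝ → ℝ :=
  if h : HasL2WeakPartial e v then h.choose else 0

/-- `∫_Ω v²`, the square of the `L²(Ω)` norm. -/
def l2NormSq (v : ℝ × ℝ → ℝ) : ℝ := ∫ z in Omega, v z ^ 2

/-- The `L²(Ω)` norm. -/
def l2Norm (v : ℝ × ℝ → ℝ) : ℝ := Real.sqrt (l2NormSq v)

/-- The energy norm, `‖v‖_E² = ε₁ |v|₁² + ‖v‖²`. -/
def energyNorm (ε₁ : ℝ) (v : ℝ × ℝ → ℝ) : ℝ :=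
  Real.sqrt (ε₁ * (l2NormSq (weakPartial (1, 0) v) + l2NormSq (weakPartial (0, 1) v))
    + l2NormSq v)

/-- The chosen weak derivative agrees almost everywhere on `Ω` with every other one, so that the
energy norm does not depend on the choice. -/
theorem weakPartial_ae_eq {e : ℝ × ℝ} {v g : ℝ × ℝ → ℝ} (hg : MemL2 g)
    (h : IsWeakPartial e v g) : weakPartial e v =ᵐ[volume.restrict Omega] g := by
  have hex : HasL2WeakPartial e v := ⟨g, hg, h⟩
  have hO : IsOpen Omega := isOpen_Ioo.prod isOpen_Ioo
  have hOf : volume Omega ≠ ⊤ := by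
    refine ((measure_mono ?_).trans_lt
      ((isCompact_Icc (a := (0 : ℝ)) (b := 1)).prod
        (isCompact_Icc (a := (0 : ℝ)) (b := 1))).measure_lt_top).ne
    exact prod_mono Ioo_subset_Icc_self Ioo_subset_Icc_self
  have : IsFiniteMeasure (volume.restrict Omega) := ⟨by
    rw [Measure.restrict_apply_univ]; exact hOf.lt_top⟩
  have hw : MemL2 (weakPartial e v) ∧ IsWeakPartial e v (weakPartial e v) := by
    unfold weakPartial
    rw [dif_pos hex]
    exact hex.choose_spec
  have i1 : IntegrableOn (weakPartial e v) Omega := hw.1.integrable one_le_two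
  have i2 : IntegrableOn g Omega := hg.integrable one_le_two
  have key := hO.ae_eq_zero_of_integral_contDiff_smul_eq_zero
    (f := fun z => weakPartial e v z - g z) (μ := volume)
    (i1.sub i2).locallyIntegrableOn (by
      intro φ hφ hc hs
      have hb : ∃ C, ∀ z, ‖φ z‖ ≤ C := hφ.continuous.bounded_above_of_compact_support hc
      obtain ⟨C, hC⟩ := hb
      have j1 : IntegrableOn (fun z => weakPartial e v z * φ z) Omega :=
        Integrable.mul_bdd (c := C) i1 hφ.continuous.aestronglyMeasurable (Filter.Eventually.of_forall hC)
      have j2 : IntegrableOn (fun z => g z * φ z) Omega :=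
        Integrable.mul_bdd (c := C) i2 hφ.continuous.aestronglyMeasurable (Filter.Eventually.of_forall hC)
      have e1 := hw.2 φ hφ hc hs
      have e2 := h φ hφ hc hs
      have e3 : ∫ z in Omega, (weakPartial e v z * φ z - g z * φ z) = 0 := by
        rw [integral_sub j1 j2]; linarith
      rw [← e3, ← setIntegral_eq_integral_of_forall_compl_eq_zero (s := Omega)]
      · refine integral_congr_ae (Filter.Eventually.of_forall fun z => ?_)
        simp only [smul_eq_mul]; ring
      · intro z hz
        have : φ z = 0 := image_eq_zero_of_notMem_tsupport fun hz' => hz (hs hz')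
        simp [this])
  rw [Filter.EventuallyEq, ae_restrict_iff' hO.measurableSet]
  filter_upwards [key] with z hz hzO
  exact sub_eq_zero.mp (hz hzO)

/-! ## The boundary value problem -/

/-- Conditions on the coefficients `b`, `c`: regularity, and `b ≥ lam > 0`, `c ≥ β > 0`. -/
structure Coefficients (b c : ℝ → ℝ) (lam β : ℝ) : Prop where
  b_smooth : ContDiffOn ℝ 1 b (Icc 0 1)
  c_cont : ContinuousOn c (Icc 0 1)
  lam_pos : 0 < lam
  β_pos : 0 < β
  b_ge : ∀ x ∈ Icc (0 : ℝ) 1, lam ≤ b x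
  c_ge : ∀ x ∈ Icc (0 : ℝ) 1, β ≤ c x

/-- Continuous right-hand side that vanishes at the four corners. -/
structure RightHandSide (f : ℝ × ℝ → ℝ) : Prop where
  cont : ContinuousOn f OmegaBar
  zero_zero : f (0, 0) = 0
  zero_one : f (0, 1) = 0
  one_one : f (1, 1) = 0
  one_zero : f (1, 0) = 0

/-- `u` is a classical solution of `-ε₁ Δu + ε₂ b(x) u_x + c(x) u = f` in `Ω`, `u = 0` on `∂Ω`. -/
structure IsSolution (ε₁ ε₂ : ℝ) (b c : ℝ → ℝ) (f u : ℝ × ℝ → ℝ) : Prop where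
  cont : ContinuousOn u OmegaBar
  smooth : ContDiffOn ℝ 2 u Omega
  eqn : ∀ z ∈ Omega, -ε₁ * (partialD 2 0 u z + partialD 0 2 u z)
    + ε₂ * b z.1 * partialD 1 0 u z + c z.1 * u z = f z
  bdry : ∀ z ∈ frontier Omega, u z = 0

/-- `b_* = max_{[0,1]} b`. -/
def bStar (b : ℝ → ℝ) : ℝ := sSup (b '' Icc 0 1)

/-- `μ₀`, the decay rate of the layer at `x = 0` (`bs` stands for `b_*`). -/
def mu0 (ε₁ ε₂ bs β : ℝ) : ℝ :=
  (-(ε₂ * bs) + Real.sqrt (ε₂ ^ 2 * bs ^ 2 + 4 * ε₁ * β)) / (2 * ε₁)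

/-- `μ₁`, the decay rate of the layer at `x = 1`. -/
def mu1 (ε₁ ε₂ lam β : ℝ) : ℝ :=
  (ε₂ * lam + Real.sqrt (ε₂ ^ 2 * lam ^ 2 + 4 * ε₁ * β)) / (2 * ε₁)

/-- `v ∈ C^m(Ω̄)`, and `|∂^{i+j} v / ∂x^i ∂y^j| ≤ M i j z` at every `z ∈ Ω̄` for `i + j ≤ m`. -/
def DerivBound (m : ℕ) (v : ℝ × ℝ → ℝ) (M : ℕ → ℕ → ℝ × ℝ → ℝ) : Prop :=
  ContDiffOn ℝ m v OmegaBar ∧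
    ∀ i j : ℕ, i + j ≤ m → ∀ z ∈ OmegaBar, |partialD i j v z| ≤ M i j z

/-- The decomposition of `u` into a regular part, two exponential layers (at `x = 0, 1`), two
parabolic layers (at `y = 0, 1`) and four corner layers, with derivative bounds whose constant
is `C₀`. -/
structure LayerDecomposition (k : ℕ) (ε₁ μ₀ μ₁ p δ C₀ : ℝ) (u : ℝ × ℝ → ℝ) where
  S : ℝ × ℝ → ℝ
  E10 : ℝ × ℝ → ℝ
  E11 : ℝ × ℝ → ℝ
  E20 : ℝ × ℝ → ℝ
  E21 : ℝ × ℝ → ℝ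
  E31 : ℝ × ℝ → ℝ
  E32 : ℝ × ℝ → ℝ
  E33 : ℝ × ℝ → ℝ
  E34 : ℝ × ℝ → ℝ
  sum_eq : ∀ z ∈ OmegaBar, u z = S z + E10 z + E11 z + E20 z + E21 z
    + E31 z + E32 z + E33 z + E34 z
  bound_S : DerivBound (k + 1) S fun _ _ _ => C₀
  bound_E10 : DerivBound (k + 1) E10 fun i _ z => C₀ * μ₀ ^ i * Real.exp (-(p * μ₀ * z.1))
  bound_E11 : DerivBound (k + 1) E11 fun i _ z => C₀ * μ₁ ^ i * Real.exp (-(p * μ₁ * (1 - z.1)))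
  bound_E20 : DerivBound (k + 1) E20 fun _ j z =>
    C₀ * ε₁ ^ (-(j : ℝ) / 2) * Real.exp (-(δ * z.2 / Real.sqrt ε₁))
  bound_E21 : DerivBound (k + 1) E21 fun _ j z =>
    C₀ * ε₁ ^ (-(j : ℝ) / 2) * Real.exp (-(δ * (1 - z.2) / Real.sqrt ε₁))
  bound_E31 : DerivBound (k + 1) E31 fun i j z =>
    C₀ * ε₁ ^ (-(j : ℝ) / 2) * μ₀ ^ i * Real.exp (-(p * μ₀ * z.1))
      * Real.exp (-(δ * z.2 / Real.sqrt ε₁))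
  bound_E32 : DerivBound (k + 1) E32 fun i j z =>
    C₀ * ε₁ ^ (-(j : ℝ) / 2) * μ₁ ^ i * Real.exp (-(p * μ₁ * (1 - z.1)))
      * Real.exp (-(δ * z.2 / Real.sqrt ε₁))
  bound_E33 : DerivBound (k + 1) E33 fun i j z =>
    C₀ * ε₁ ^ (-(j : ℝ) / 2) * μ₁ ^ i * Real.exp (-(p * μ₁ * (1 - z.1)))
      * Real.exp (-(δ * (1 - z.2) / Real.sqrt ε₁))
  bound_E34 : DerivBound (k + 1) E34 fun i j z =>
    C₀ * ε₁ ^ (-(j : ℝ) / 2) * μ₀ ^ i * Real.exp (-(p * μ₀ * z.1))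
      * Real.exp (-(δ * (1 - z.2) / Real.sqrt ε₁))

/-! ## The Bakhvalov-type mesh -/

/-- Transition point `σ_{x,i} = τ / (p μ_i) * ln μ_i` (with `μ = μ_i`). -/
def sigmaX (τ p μ : ℝ) : ℝ := τ / (p * μ) * Real.log μ

/-- Transition point `σ_y = (τ / δ) √ε₁ ln (1 / √ε₁)`. -/
def sigmaY (τ δ ε₁ : ℝ) : ℝ := τ / δ * Real.sqrt ε₁ * Real.log (1 / Real.sqrt ε₁)

/-- Mesh generating function near `0`: `φ(t) = -ln (1 - 4 (1 - r) t)`. The one near `1` is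
`φ(1 - t)`. -/
def meshGen (r t : ℝ) : ℝ := -Real.log (1 - 4 * (1 - r) * t)

/-- The mesh points `x_i`, `0 ≤ i ≤ N`. -/
def meshX (N : ℕ) (τ p μ₀ μ₁ : ℝ) (i : ℕ) : ℝ :=
  if i ≤ N / 4 then τ / (p * μ₀) * meshGen μ₀⁻¹ ((i : ℝ) / N)
  else if i ≤ 3 * N / 4 then
    sigmaX τ p μ₀ + 2 * ((i : ℝ) / N - 1 / 4) * (1 - sigmaX τ p μ₀ - sigmaX τ p μ₁)
  else 1 - τ / (p * μ₁) * meshGen μ₁⁻¹ (1 - (i : ℝ) / N)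

/-- The mesh points `y_j`, `0 ≤ j ≤ N`. -/
def meshY (N : ℕ) (τ δ ε₁ : ℝ) (j : ℕ) : ℝ :=
  if j ≤ N / 4 then τ / δ * Real.sqrt ε₁ * meshGen (Real.sqrt ε₁) ((j : ℝ) / N)
  else if j ≤ 3 * N / 4 then
    sigmaY τ δ ε₁ + 2 * ((j : ℝ) / N - 1 / 4) * (1 - 2 * sigmaY τ δ ε₁)
  else 1 - τ / δ * Real.sqrt ε₁ * meshGen (Real.sqrt ε₁) (1 - (j : ℝ) / N)

/-! ## Lagrange interpolation on a tensor-product mesh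

Below `x y : ℕ → ℝ` are the one-dimensional mesh points (indices `0, …, N` matter). -/

/-- The node `x_i^s = x_i + (s / k) (x_{i+1} - x_i)`. -/
def node (k : ℕ) (x : ℕ → ℝ) (i s : ℕ) : ℝ := x i + (s : ℝ) / k * (x (i + 1) - x i)

/-- The one-dimensional nodes in increasing order: number `i k + s`, `s < k`, is `x_i^s`. -/
def gridNode (k : ℕ) (x : ℕ → ℝ) (n : ℕ) : ℝ := node k x (n / k) (n % k)

/-- The cells `[x_i, x_{i+1})`, `i + 1 < N`, and `[x_{N-1}, x_N]`, which partition `[x_0, x_N]`. -/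
def cell (N : ℕ) (x : ℕ → ℝ) (i : ℕ) : Set ℝ :=
  if i + 1 = N then Icc (x i) (x (i + 1)) else Ico (x i) (x (i + 1))

open Classical in
/-- The one-dimensional continuous piecewise polynomial (degree `k`) Lagrange basis function that is
`1` at node number `m` and `0` at the other nodes: on each cell that has node `m` it is the Lagrange
basis polynomial of the `k + 1` nodes of that cell, on the other cells it is `0`. -/
def hat (k N : ℕ) (x : ℕ → ℝ) (m : ℕ) (t : ℝ) : ℝ :=
  ∑ i ∈ Finset.range N,
    if t ∈ cell N x i ∧ m ∈ Finset.Icc (i * k) (i * k + k) then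
      (Lagrange.basis (Finset.Icc (i * k) (i * k + k)) (gridNode k x) m).eval t
    else 0

/-- The nodal basis function `θ_{i,j}^{s,t}` associated with the node `(x_i^s, y_j^t)`. -/
def theta (k N : ℕ) (x y : ℕ → ℝ) (i j s t : ℕ) (z : ℝ × ℝ) : ℝ :=
  hat k N x (i * k + s) z.1 * hat k N y (j * k + t) z.2

/-- The term `v(x_i^s, y_j^t) θ_{i,j}^{s,t}`. -/
def nodalTerm (k N : ℕ) (x y : ℕ → ℝ) (v : ℝ × ℝ → ℝ) (i j s t : ℕ) (z : ℝ × ℝ) : ℝ :=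
  v (node k x i s, node k y j t) * theta k N x y i j s t z

/-- The Lagrange interpolant `v^I`. -/
def lagrangeInterp (k N : ℕ) (x y : ℕ → ℝ) (v : ℝ × ℝ → ℝ) (z : ℝ × ℝ) : ℝ :=
  (∑ i ∈ Finset.range N, ∑ s ∈ Finset.range k,
    ((∑ j ∈ Finset.range N, ∑ t ∈ Finset.range k, nodalTerm k N x y v i j s t z)
      + nodalTerm k N x y v i N s 0 z))
  + (∑ j ∈ Finset.range N, ∑ t ∈ Finset.range k, nodalTerm k N x y v N j 0 t z)
  + nodalTerm k N x y v N N 0 0 z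

/-- The operator `P`: the part of the Lagrange interpolant carried by the nodes
`(x_{3N/4}^s, y_j^t)`, `s = 1, …, k`. -/
def opP (k N : ℕ) (x y : ℕ → ℝ) (v : ℝ × ℝ → ℝ) (z : ℝ × ℝ) : ℝ :=
  ∑ s ∈ Finset.Icc 1 k,
    ((∑ j ∈ Finset.range N, ∑ t ∈ Finset.range k, nodalTerm k N x y v (3 * N / 4) j s t z)
      + nodalTerm k N x y v (3 * N / 4) N s 0 z)

/-- The operator `Θ`, the boundary correction. -/
def opTheta (k N : ℕ) (x y : ℕ → ℝ) (v : ℝ × ℝ → ℝ) (z : ℝ × ℝ) : ℝ :=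
  (∑ s ∈ Finset.Icc 1 k, nodalTerm k N x y v (3 * N / 4) 0 s 0 z)
    + ∑ s ∈ Finset.Icc 1 k, nodalTerm k N x y v (3 * N / 4) N s 0 z

/-- The modified interpolant `π v = v^I - P v + Θ v`. -/
def modInterp (k N : ℕ) (x y : ℕ → ℝ) (v : ℝ × ℝ → ℝ) (z : ℝ × ℝ) : ℝ :=
  lagrangeInterp k N x y v z - opP k N x y v z + opTheta k N x y v z

/-- The layer-adapted interpolant `Π u`. -/
def layerInterp (k N : ℕ) (x y : ℕ → ℝ) {ε₁ μ₀ μ₁ p δ C₀ : ℝ} {u : ℝ × ℝ → ℝ}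
    (D : LayerDecomposition k ε₁ μ₀ μ₁ p δ C₀ u) (z : ℝ × ℝ) : ℝ :=
  lagrangeInterp k N x y D.S z + lagrangeInterp k N x y D.E10 z + modInterp k N x y D.E11 z
    + lagrangeInterp k N x y D.E20 z + lagrangeInterp k N x y D.E21 z
    + lagrangeInterp k N x y D.E31 z + modInterp k N x y D.E32 z
    + modInterp k N x y D.E33 z + lagrangeInterp k N x y D.E34 z

end

end TwoParam

namespace TwoParam

/-! ## One-dimensional Lagrange interpolation on a cell -/

/-! The mesh is adapted to each layer function $e^{-\kappa\rho x}$: with $Q_i=1-(1-\rho^{-1})i/n$,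
$n=N/4$, the layer points are $x_i=-(a/\rho)\ln Q_i$ with $\kappa a=\tau$, so the layer function at
$x_i$ equals $Q_i^\tau\le Q_i^{k+1}$. Writing $q$ for the bound of the layer on a cell of length $h$
(the layer is at most $q^{k+1}$ there), every cell falls into one of three regimes
(`MeshData.profile_left`). Either the cell resolves the layer, $h\rho q\lesssim N^{-1}$; or it is
the last layer cell, where $q\lesssim N^{-1}$ and $h\rho\gtrsim1$; or it lies beyond the transition
point, where $q=\rho^{-1}\lesssim N^{-1}$.

Every component of the decomposition is bounded by a product of an $x$-profile and a $y$-profile, a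
smooth direction counting as a layer of rate $1$. The anisotropic estimates `tensor_error_cell` and
`tensor_deriv_error_cell` let the order of approximation be chosen separately in each direction:
full order where the layer is resolved, order zero where it is already small. This gives the
pointwise error $O(N^{-(k+1)})$ (`ProductBound.interp_error`). For the $x$-derivative, the squared
error on a column of cells is dominated by a function of $x$ with integral $O(N^{-2k}(\rho/N+h))$
(`ProductBound.interp_deriv_error`). On the last layer cell neither the function nor its interpolant
is expanded: the function is integrated exactly and the interpolant is handled by an inverse
estimate.

Summation over the $N$ columns yields $N^{-2k}(\rho+1)$, and the $y$-derivative follows by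
exchanging the variables. The factor $\varepsilon_1$ of the energy norm turns the rates into
$\varepsilon_1\rho\lesssim\sqrt{\varepsilon_1}+\varepsilon_2$ (`mu0_bounds`, `mu1_bounds`), which is
the weight in the theorem.

For $\Pi u$, the correction $Pv-\Theta v$ is a spline with nodal values $O(N^{-(k+1)})$ that lives
on two columns of cells of width $\gtrsim\mu_1^{-1}$. Inverse estimates (`energyBound_tensorSpline`,
`component_modInterp`) show that it is no larger than the interpolation error. -/

theorem gridNode_cell {k : ℕ} (hk : 1 ≤ k) (x : ℕ → ℝ) (i s : ℕ) (hs : s ≤ k) :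
    gridNode k x (i * k + s) = x i + (s : ℝ) / k * (x (i + 1) - x i) := by
  have hk0 : (k : ℝ) ≠ 0 := by positivity
  unfold gridNode node
  rcases hs.lt_or_eq with h | h
  · rw [mul_comm i k, Nat.mul_add_div (by omega), Nat.mul_add_mod, Nat.div_eq_of_lt h,
      Nat.mod_eq_of_lt h, add_zero]
  · subst h
    have : i * s + s = s * (i + 1) := by ring
    rw [this, Nat.mul_div_cancel_left _ (by omega), Nat.mul_mod_right]
    field_simp
    simp [mul_comm]

theorem gridNode_mul {k : ℕ} (hk : 1 ≤ k) (x : ℕ → ℝ) (i : ℕ) : gridNode k x (i * k) = x i := by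
  simpa using gridNode_cell hk x i 0 (Nat.zero_le _)

theorem exists_offset {k i m : ℕ} (hm : m ∈ Finset.Icc (i * k) (i * k + k)) :
    ∃ s, s ≤ k ∧ m = i * k + s := by
  rw [Finset.mem_Icc] at hm
  exact ⟨m - i * k, by omega, by omega⟩

theorem gridNode_mem_Icc {k : ℕ} (hk : 1 ≤ k) {x : ℕ → ℝ} {i m : ℕ} (hx : x i ≤ x (i + 1))
    (hm : m ∈ Finset.Icc (i * k) (i * k + k)) : gridNode k x m ∈ Icc (x i) (x (i + 1)) := by
  obtain ⟨s, hs, rfl⟩ := exists_offset hm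
  rw [gridNode_cell hk x i s hs]
  have h1 : (s : ℝ) / k ≤ 1 := by
    rw [div_le_one (by positivity)]
    exact_mod_cast hs
  have h0 : 0 ≤ (s : ℝ) / k := by positivity
  constructor <;> nlinarith

theorem gridNode_dist {k : ℕ} (hk : 1 ≤ k) {x : ℕ → ℝ} {i m n : ℕ} (hx : x i < x (i + 1))
    (hm : m ∈ Finset.Icc (i * k) (i * k + k)) (hn : n ∈ Finset.Icc (i * k) (i * k + k))
    (hmn : m ≠ n) : (x (i + 1) - x i) / k ≤ |gridNode k x m - gridNode k x n| := by
  obtain ⟨s, hs, rfl⟩ := exists_offset hm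
  obtain ⟨t, ht, rfl⟩ := exists_offset hn
  rw [gridNode_cell hk x i s hs, gridNode_cell hk x i t ht]
  have hst : (1 : ℝ) ≤ |(s : ℝ) - t| := by
    have : (s : ℤ) - t ≠ 0 := by omega
    have h2 := Int.one_le_abs this
    exact_mod_cast h2
  have hk0 : (0 : ℝ) < k := by positivity
  have e : x i + (s : ℝ) / k * (x (i + 1) - x i) - (x i + (t : ℝ) / k * (x (i + 1) - x i))
      = ((s : ℝ) - t) * ((x (i + 1) - x i) / k) := by
    field_simp; ring
  have h3 : 0 < (x (i + 1) - x i) / k := div_pos (by linarith) hk0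
  rw [e, abs_mul, abs_of_pos h3]
  nlinarith

theorem gridNode_injOn {k : ℕ} (hk : 1 ≤ k) {x : ℕ → ℝ} {i : ℕ} (hx : x i < x (i + 1)) :
    InjOn (gridNode k x) (Finset.Icc (i * k) (i * k + k) : Finset ℕ) := by
  intro m hm n hn h
  by_contra hmn
  have := gridNode_dist hk hx hm hn hmn
  rw [h, sub_self, abs_zero] at this
  have h3 : 0 < (x (i + 1) - x i) / k := div_pos (by linarith) (by positivity)
  linarith

/-- The Lagrange basis polynomials of the cell number `i`. -/
noncomputable def cellBasis (k : ℕ) (x : ℕ → ℝ) (i m : ℕ) : Polynomial ℝ :=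
  Lagrange.basis (Finset.Icc (i * k) (i * k + k)) (gridNode k x) m

/-- The interpolating polynomial of the cell number `i` with nodal values `c`. -/
noncomputable def cellPoly (k : ℕ) (x : ℕ → ℝ) (i : ℕ) (c : ℕ → ℝ) : Polynomial ℝ :=
  Lagrange.interpolate (Finset.Icc (i * k) (i * k + k)) (gridNode k x) c

theorem cellPoly_eq_sum (k : ℕ) (x : ℕ → ℝ) (i : ℕ) (c : ℕ → ℝ) :
    cellPoly k x i c
      = ∑ m ∈ Finset.Icc (i * k) (i * k + k), Polynomial.C (c m) * cellBasis k x i m := by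
  simp [cellPoly, cellBasis, Lagrange.interpolate_apply]

theorem eval_cellPoly (k : ℕ) (x : ℕ → ℝ) (i : ℕ) (c : ℕ → ℝ) (t : ℝ) :
    (cellPoly k x i c).eval t
      = ∑ m ∈ Finset.Icc (i * k) (i * k + k), c m * (cellBasis k x i m).eval t := by
  simp [cellPoly_eq_sum, Polynomial.eval_finsetSum]

theorem eval_derivative_cellPoly (k : ℕ) (x : ℕ → ℝ) (i : ℕ) (c : ℕ → ℝ) (t : ℝ) :
    (cellPoly k x i c).derivative.eval t
      = ∑ m ∈ Finset.Icc (i * k) (i * k + k), c m * (cellBasis k x i m).derivative.eval t := by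
  simp [cellPoly_eq_sum, Polynomial.eval_finsetSum]

theorem cellPoly_sub (k : ℕ) (x : ℕ → ℝ) (i : ℕ) (c d : ℕ → ℝ) :
    cellPoly k x i (fun m => c m - d m) = cellPoly k x i c - cellPoly k x i d := by
  have : (fun m => c m - d m) = c - d := rfl
  rw [this, cellPoly, map_sub, cellPoly, cellPoly]

/-- A bound for the Lebesgue constant of `k + 1` equidistant nodes, which is also a bound for the
corresponding constant of the derivative. -/
noncomputable def lebesgueConst (k : ℕ) : ℝ := (k + 1) * (k : ℝ) ^ (k + 1)

theorem lebesgueConst_pos {k : ℕ} (hk : 1 ≤ k) : 0 < lebesgueConst k := by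
  unfold lebesgueConst; positivity

theorem abs_eval_basisDivisor_le {k : ℕ} (hk : 1 ≤ k) {x : ℕ → ℝ} {i m n : ℕ}
    (hx : x i < x (i + 1)) (hm : m ∈ Finset.Icc (i * k) (i * k + k))
    (hn : n ∈ Finset.Icc (i * k) (i * k + k)) (hmn : m ≠ n) {t : ℝ}
    (ht : t ∈ Icc (x i) (x (i + 1))) :
    |(Lagrange.basisDivisor (gridNode k x m) (gridNode k x n)).eval t| ≤ k ∧
    |(Lagrange.basisDivisor (gridNode k x m) (gridNode k x n)).derivative.eval t|
      ≤ k / (x (i + 1) - x i) := by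
  have hd := gridNode_dist hk hx hm hn hmn
  have hk0 : (0 : ℝ) < k := by positivity
  have hh : 0 < x (i + 1) - x i := by linarith
  have h3 : 0 < (x (i + 1) - x i) / k := div_pos hh hk0
  have hinv : |gridNode k x m - gridNode k x n|⁻¹ ≤ k / (x (i + 1) - x i) := by
    calc _ ≤ ((x (i + 1) - x i) / k)⁻¹ := inv_anti₀ h3 hd
      _ = _ := inv_div _ _
  have hn' := gridNode_mem_Icc hk hx.le hn
  constructor
  · simp only [Lagrange.basisDivisor, Polynomial.eval_mul, Polynomial.eval_C, Polynomial.eval_sub,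
      Polynomial.eval_X, abs_mul, abs_inv]
    have h4 : |t - gridNode k x n| ≤ x (i + 1) - x i := by
      rw [abs_le]; constructor <;> linarith [ht.1, ht.2, hn'.1, hn'.2]
    calc _ ≤ k / (x (i + 1) - x i) * (x (i + 1) - x i) := by gcongr
      _ = k := by field_simp
  · simpa [Lagrange.basisDivisor, abs_inv] using hinv

theorem card_erase_cell {k i m : ℕ} (hm : m ∈ Finset.Icc (i * k) (i * k + k)) :
    ((Finset.Icc (i * k) (i * k + k)).erase m).card = k := by
  rw [Finset.card_erase_of_mem hm, Nat.card_Icc]; omega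

theorem abs_eval_cellBasis_le {k : ℕ} (hk : 1 ≤ k) {x : ℕ → ℝ} {i m : ℕ}
    (hx : x i < x (i + 1)) (hm : m ∈ Finset.Icc (i * k) (i * k + k)) {t : ℝ}
    (ht : t ∈ Icc (x i) (x (i + 1))) : |(cellBasis k x i m).eval t| ≤ (k : ℝ) ^ (k + 1) := by
  have hk1 : (1 : ℝ) ≤ k := by exact_mod_cast hk
  unfold cellBasis Lagrange.basis
  rw [Polynomial.eval_prod, Finset.abs_prod]
  calc _ ≤ ∏ _j ∈ (Finset.Icc (i * k) (i * k + k)).erase m, (k : ℝ) := by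
        refine Finset.prod_le_prod (fun _ _ => abs_nonneg _) fun j hj => ?_
        rw [Finset.mem_erase] at hj
        exact (abs_eval_basisDivisor_le hk hx hm hj.2 hj.1.symm ht).1
    _ = (k : ℝ) ^ k := by rw [Finset.prod_const, card_erase_cell hm]
    -- The spare factor $k$ makes the bound agree with the one for the derivative, a sum of $k$
    -- terms $k^{k-1}\cdot k/h$.
    _ ≤ _ := pow_le_pow_right₀ hk1 (Nat.le_succ k)

theorem abs_eval_derivative_cellBasis_le {k : ℕ} (hk : 1 ≤ k) {x : ℕ → ℝ} {i m : ℕ}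
    (hx : x i < x (i + 1)) (hm : m ∈ Finset.Icc (i * k) (i * k + k)) {t : ℝ}
    (ht : t ∈ Icc (x i) (x (i + 1))) :
    |(cellBasis k x i m).derivative.eval t| ≤ (k : ℝ) ^ (k + 1) / (x (i + 1) - x i) := by
  have hk1 : (1 : ℝ) ≤ k := by exact_mod_cast hk
  have hh : 0 < x (i + 1) - x i := by linarith
  unfold cellBasis Lagrange.basis
  rw [Polynomial.derivative_prod_finset, Polynomial.eval_finsetSum]
  refine (Finset.abs_sum_le_sum_abs _ _).trans ?_
  calc _ ≤ ∑ _j ∈ (Finset.Icc (i * k) (i * k + k)).erase m,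
          (k : ℝ) ^ (k - 1) * (k / (x (i + 1) - x i)) := by
        refine Finset.sum_le_sum fun j hj => ?_
        have hj' := Finset.mem_erase.mp hj
        rw [Polynomial.eval_mul, abs_mul, Polynomial.eval_prod, Finset.abs_prod]
        refine mul_le_mul ?_ (abs_eval_basisDivisor_le hk hx hm hj'.2 hj'.1.symm ht).2
          (abs_nonneg _) (by positivity)
        calc _ ≤ ∏ _l ∈ ((Finset.Icc (i * k) (i * k + k)).erase m).erase j, (k : ℝ) := by
              refine Finset.prod_le_prod (fun _ _ => abs_nonneg _) fun l hl => ?_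
              have hl' := Finset.mem_erase.mp (Finset.mem_erase.mp hl).2
              exact (abs_eval_basisDivisor_le hk hx hm hl'.2 hl'.1.symm ht).1
          _ = _ := by rw [Finset.prod_const, Finset.card_erase_of_mem hj, card_erase_cell hm]
    _ = _ := by
        rw [Finset.sum_const, card_erase_cell hm, nsmul_eq_mul]
        obtain ⟨l, rfl⟩ : ∃ l, k = l + 1 := ⟨k - 1, by omega⟩
        simp only [Nat.add_sub_cancel]
        ring

theorem abs_eval_cellPoly_le {k : ℕ} (hk : 1 ≤ k) {x : ℕ → ℝ} {i : ℕ} (hx : x i < x (i + 1))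
    {c : ℕ → ℝ} {A : ℝ} (hc : ∀ m ∈ Finset.Icc (i * k) (i * k + k), |c m| ≤ A) {t : ℝ}
    (ht : t ∈ Icc (x i) (x (i + 1))) : |(cellPoly k x i c).eval t| ≤ lebesgueConst k * A := by
  rw [eval_cellPoly]
  refine (Finset.abs_sum_le_sum_abs _ _).trans ?_
  calc _ ≤ ∑ _m ∈ Finset.Icc (i * k) (i * k + k), A * (k : ℝ) ^ (k + 1) := by
        refine Finset.sum_le_sum fun m hm => ?_
        rw [abs_mul]
        exact mul_le_mul (hc m hm) (abs_eval_cellBasis_le hk hx hm ht) (abs_nonneg _)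
          ((abs_nonneg _).trans (hc m hm))
    _ = _ := by
        rw [Finset.sum_const, Nat.card_Icc, nsmul_eq_mul, lebesgueConst]
        have : i * k + k + 1 - i * k = k + 1 := by omega
        rw [this]; push_cast; ring

theorem abs_eval_derivative_cellPoly_le {k : ℕ} (hk : 1 ≤ k) {x : ℕ → ℝ} {i : ℕ}
    (hx : x i < x (i + 1)) {c : ℕ → ℝ} {A : ℝ}
    (hc : ∀ m ∈ Finset.Icc (i * k) (i * k + k), |c m| ≤ A) {t : ℝ}
    (ht : t ∈ Icc (x i) (x (i + 1))) :
    |(cellPoly k x i c).derivative.eval t| ≤ lebesgueConst k * A / (x (i + 1) - x i) := by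
  rw [eval_derivative_cellPoly]
  refine (Finset.abs_sum_le_sum_abs _ _).trans ?_
  calc _ ≤ ∑ _m ∈ Finset.Icc (i * k) (i * k + k),
          A * ((k : ℝ) ^ (k + 1) / (x (i + 1) - x i)) := by
        refine Finset.sum_le_sum fun m hm => ?_
        rw [abs_mul]
        exact mul_le_mul (hc m hm) (abs_eval_derivative_cellBasis_le hk hx hm ht) (abs_nonneg _)
          ((abs_nonneg _).trans (hc m hm))
    _ = _ := by
        rw [Finset.sum_const, Nat.card_Icc, nsmul_eq_mul, lebesgueConst]
        have : i * k + k + 1 - i * k = k + 1 := by omega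
        rw [this]; push_cast; ring

theorem exists_antiderivative (n : ℕ) (Q : Polynomial ℝ) (hQ : Q.degree < n) :
    ∃ R : Polynomial ℝ, R.derivative = Q ∧ R.degree < (n + 1 : ℕ) := by
  refine ⟨∑ i ∈ Finset.range n, Polynomial.monomial (i + 1) (Q.coeff i / (i + 1)), ?_, ?_⟩
  · rw [Polynomial.derivative_sum]
    by_cases h0 : Q = 0
    · simp [h0]
    conv_rhs => rw [Q.as_sum_range' n ((Polynomial.natDegree_lt_iff_degree_lt h0).mpr hQ)]
    refine Finset.sum_congr rfl fun i _ => ?_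
    rw [Polynomial.derivative_monomial]
    congr 1
    have : (i : ℝ) + 1 ≠ 0 := by positivity
    push_cast
    field_simp
  · refine (Polynomial.degree_sum_le _ _).trans_lt ?_
    rw [Finset.sup_lt_iff (by exact WithBot.bot_lt_coe _)]
    intro i hi
    refine (Polynomial.degree_monomial_le _ _).trans_lt ?_
    rw [Finset.mem_range] at hi
    exact_mod_cast Nat.succ_lt_succ hi

/-- Polynomial approximation of a function that is `n` times differentiable; `G j` is the
derivative of order `j`. -/
theorem exists_poly_approx (n : ℕ) : ∀ (G : ℕ → ℝ → ℝ) (a b M : ℝ), a ≤ b →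
    (∀ j < n, ∀ t ∈ Icc a b, HasDerivWithinAt (G j) (G (j + 1) t) (Icc a b) t) →
    (∀ t ∈ Icc a b, |G n t| ≤ M) →
    ∃ P : Polynomial ℝ, P.degree < n ∧ ∀ t ∈ Icc a b,
      |G 0 t - P.eval t| ≤ M * (b - a) ^ n ∧
      (1 ≤ n → |G 1 t - P.derivative.eval t| ≤ M * (b - a) ^ (n - 1)) := by
  induction n with
  | zero =>
    intro G a b M _ _ hM
    refine ⟨0, by simp, fun t ht => ⟨by simpa using hM t ht, ?_⟩⟩
    intro h; omega
  | succ n ih =>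
    intro G a b M hab hG hM
    obtain ⟨Q, hQd, hQ⟩ := ih (fun j => G (j + 1)) a b M hab
      (fun j hj t ht => hG (j + 1) (by omega) t ht) hM
    obtain ⟨R, hRQ, hRd⟩ := exists_antiderivative n Q hQd
    -- The polynomial $Q$ approximates the derivative; its antiderivative is normalised to agree
    -- with $G_0$ at $a$, so the mean value inequality gains one factor $b-a$.
    refine ⟨R + Polynomial.C (G 0 a - R.eval a), ?_, ?_⟩
    · refine (Polynomial.degree_add_le _ _).trans_lt (max_lt hRd ?_)
      exact Polynomial.degree_C_le.trans_lt (by exact_mod_cast Nat.succ_pos n)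
    have hder : ∀ t ∈ Icc a b, HasDerivWithinAt
        (fun s => G 0 s - (R + Polynomial.C (G 0 a - R.eval a)).eval s)
        (G 1 t - Q.eval t) (Icc a b) t := by
      intro t ht
      have h1 := (R + Polynomial.C (G 0 a - R.eval a)).hasDerivWithinAt t (Icc a b)
      rw [Polynomial.derivative_add, Polynomial.derivative_C, add_zero, hRQ] at h1
      exact (hG 0 (Nat.succ_pos n) t ht).sub h1
    intro t ht
    refine ⟨?_, fun _ => ?_⟩
    · have h2 := (convex_Icc a b).norm_image_sub_le_of_norm_hasDerivWithin_le hder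
        (fun s hs => (hQ s hs).1) (left_mem_Icc.mpr hab) ht
      simp only [Polynomial.eval_add, Polynomial.eval_C, Real.norm_eq_abs] at h2 ⊢
      have h3 : 0 ≤ M * (b - a) ^ n := (abs_nonneg _).trans (hQ t ht).1
      have h4 : |t - a| ≤ b - a := by rw [abs_of_nonneg (by linarith [ht.1])]; linarith [ht.2]
      calc |G 0 t - (R.eval t + (G 0 a - R.eval a))|
          = |G 0 t - (R.eval t + (G 0 a - R.eval a))
              - (G 0 a - (R.eval a + (G 0 a - R.eval a)))| := by congr 1; ring
        _ ≤ M * (b - a) ^ n * |t - a| := h2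
        _ ≤ M * (b - a) ^ n * (b - a) := by gcongr
        _ = _ := by ring
    · rw [Polynomial.derivative_add, Polynomial.derivative_C, add_zero, hRQ]
      exact (hQ t ht).1

theorem degree_lt_cellPoly_eq {k : ℕ} (hk : 1 ≤ k) {x : ℕ → ℝ} {i : ℕ} (hx : x i < x (i + 1))
    {P : Polynomial ℝ} (hP : P.degree < (k + 1 : ℕ)) :
    cellPoly k x i (fun m => P.eval (gridNode k x m)) = P := by
  refine (Lagrange.eq_interpolate (gridNode_injOn hk hx) ?_).symm
  rw [Nat.card_Icc, show i * k + k + 1 - i * k = k + 1 by omega]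
  exact hP

/-- Interpolation error on a cell, for the function and for its derivative. -/
theorem interp_error_cell {k : ℕ} (hk : 1 ≤ k) {x : ℕ → ℝ} {i : ℕ} (hx : x i < x (i + 1))
    {n : ℕ} (hn : n ≤ k + 1) {G : ℕ → ℝ → ℝ} {M : ℝ}
    (hG : ∀ j < n, ∀ t ∈ Icc (x i) (x (i + 1)),
      HasDerivWithinAt (G j) (G (j + 1) t) (Icc (x i) (x (i + 1))) t)
    (hM : ∀ t ∈ Icc (x i) (x (i + 1)), |G n t| ≤ M) {t : ℝ} (ht : t ∈ Icc (x i) (x (i + 1))) :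
    |G 0 t - (cellPoly k x i (fun m => G 0 (gridNode k x m))).eval t|
        ≤ (1 + lebesgueConst k) * (M * (x (i + 1) - x i) ^ n) ∧
    (1 ≤ n → |G 1 t - (cellPoly k x i (fun m => G 0 (gridNode k x m))).derivative.eval t|
        ≤ (1 + lebesgueConst k) * (M * (x (i + 1) - x i) ^ (n - 1))) := by
  have hh : 0 < x (i + 1) - x i := by linarith
  obtain ⟨P, hPd, hP⟩ := exists_poly_approx n G _ _ M hx.le hG hM
  have hPI := degree_lt_cellPoly_eq hk hx (P := P)
    (hPd.trans_le (by exact_mod_cast hn))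
  -- Interpolation $I$ reproduces $P$, so $G-IG=(G-P)-I(G-P)$ and only the stability of $I$ is
  -- needed.
  have hsplit : cellPoly k x i (fun m => G 0 (gridNode k x m))
      = P + cellPoly k x i (fun m => G 0 (gridNode k x m) - P.eval (gridNode k x m)) := by
    rw [cellPoly_sub, hPI]; ring
  have hc : ∀ m ∈ Finset.Icc (i * k) (i * k + k),
      |G 0 (gridNode k x m) - P.eval (gridNode k x m)| ≤ M * (x (i + 1) - x i) ^ n :=
    fun m hm => (hP _ (gridNode_mem_Icc hk hx.le hm)).1
  constructor
  · rw [hsplit, Polynomial.eval_add]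
    have h1 := abs_eval_cellPoly_le hk hx hc ht
    have h2 := (hP t ht).1
    rw [← sub_sub]
    refine (abs_sub _ _).trans ?_
    linarith
  · intro hn1
    rw [hsplit, Polynomial.derivative_add, Polynomial.eval_add]
    have h1 := abs_eval_derivative_cellPoly_le hk hx hc ht
    have h2 := (hP t ht).2 hn1
    rw [← sub_sub]
    refine (abs_sub _ _).trans ?_
    -- The inverse estimate costs $1/h$, which lowers the exponent of $h$ by one.
    have h3 : lebesgueConst k * (M * (x (i + 1) - x i) ^ n) / (x (i + 1) - x i)
        = lebesgueConst k * (M * (x (i + 1) - x i) ^ (n - 1)) := by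
      obtain ⟨l, rfl⟩ : ∃ l, n = l + 1 := ⟨n - 1, by omega⟩
      simp only [Nat.add_sub_cancel]
      field_simp
      ring
    linarith

/-! ## Tensor-product interpolation on a cell -/

/-- `F i j` is the partial derivative of `F 0 0` of order `(i, j)` on the closed unit square, for
`i + j ≤ n`. -/
structure HasPartials (n : ℕ) (F : ℕ → ℕ → ℝ → ℝ → ℝ) : Prop where
  dx : ∀ i j, i + j < n → ∀ x ∈ Icc (0 : ℝ) 1, ∀ y ∈ Icc (0 : ℝ) 1,
    HasDerivWithinAt (fun t => F i j t y) (F (i + 1) j x y) (Icc 0 1) x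
  dy : ∀ i j, i + j < n → ∀ x ∈ Icc (0 : ℝ) 1, ∀ y ∈ Icc (0 : ℝ) 1,
    HasDerivWithinAt (fun t => F i j x t) (F i (j + 1) x y) (Icc 0 1) y

theorem HasPartials.swap {n : ℕ} {F : ℕ → ℕ → ℝ → ℝ → ℝ} (h : HasPartials n F) :
    HasPartials n (fun i j x y => F j i y x) :=
  ⟨fun i j hij x hx y hy => h.dy j i (by omega) y hy x hx,
    fun i j hij x hx y hy => h.dx j i (by omega) y hy x hx⟩

/-- The tensor-product interpolating polynomial of the cell number `(i, j)` with nodal values `c`,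
as a polynomial in the first variable. -/
noncomputable def cellTensor (k : ℕ) (X Y : ℕ → ℝ) (i j : ℕ) (c : ℕ → ℕ → ℝ) (y : ℝ) :
    Polynomial ℝ :=
  cellPoly k X i (fun m => (cellPoly k Y j (c m)).eval y)

section

variable {k : ℕ} {X Y : ℕ → ℝ} {i j : ℕ} {F : ℕ → ℕ → ℝ → ℝ → ℝ}

theorem abs_eval_cellTensor_le (hk : 1 ≤ k) (hX : X i < X (i + 1)) (hY : Y j < Y (j + 1))
    {c : ℕ → ℕ → ℝ} {A : ℝ}
    (hc : ∀ m ∈ Finset.Icc (i * k) (i * k + k), ∀ n ∈ Finset.Icc (j * k) (j * k + k), |c m n| ≤ A)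
    {x y : ℝ} (hx : x ∈ Icc (X i) (X (i + 1))) (hy : y ∈ Icc (Y j) (Y (j + 1))) :
    |(cellTensor k X Y i j c y).eval x| ≤ lebesgueConst k * (lebesgueConst k * A) ∧
    |(cellTensor k X Y i j c y).derivative.eval x|
      ≤ lebesgueConst k * (lebesgueConst k * A) / (X (i + 1) - X i) := by
  have h : ∀ m ∈ Finset.Icc (i * k) (i * k + k),
      |(cellPoly k Y j (c m)).eval y| ≤ lebesgueConst k * A :=
    fun m hm => abs_eval_cellPoly_le hk hY (hc m hm) hy
  exact ⟨abs_eval_cellPoly_le hk hX h hx, abs_eval_derivative_cellPoly_le hk hX h hx⟩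

/-- Separates the two directions: the error becomes $(v-I_xv)+I_x(v-I_yv)$, in which each bracket is
a one-dimensional interpolation error. -/
theorem cellTensor_nodal_eq (y : ℝ) (v : ℝ → ℝ → ℝ) :
    cellTensor k X Y i j (fun m n => v (gridNode k X m) (gridNode k Y n)) y
      = cellPoly k X i (fun m => v (gridNode k X m) y)
        - cellPoly k X i (fun m => v (gridNode k X m) y
          - (cellPoly k Y j (fun n => v (gridNode k X m) (gridNode k Y n))).eval y) := by
  rw [← cellPoly_sub]
  simp only [sub_sub_cancel]
  rfl

/-- The orders $a$ and $b$ are independent of each other and only pure derivatives occur, so a layer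
may be expanded in one direction and merely bounded in the other. -/
theorem tensor_error_cell (hk : 1 ≤ k) (hF : HasPartials (k + 1) F)
    (hX : X i < X (i + 1)) (hY : Y j < Y (j + 1))
    (hXs : Icc (X i) (X (i + 1)) ⊆ Icc 0 1) (hYs : Icc (Y j) (Y (j + 1)) ⊆ Icc 0 1)
    {a b : ℕ} (ha : a ≤ k + 1) (hb : b ≤ k + 1) {A B : ℝ}
    (hA : ∀ x ∈ Icc (X i) (X (i + 1)), ∀ y ∈ Icc (Y j) (Y (j + 1)), |F a 0 x y| ≤ A)
    (hB : ∀ x ∈ Icc (X i) (X (i + 1)), ∀ y ∈ Icc (Y j) (Y (j + 1)), |F 0 b x y| ≤ B)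
    {x y : ℝ} (hx : x ∈ Icc (X i) (X (i + 1))) (hy : y ∈ Icc (Y j) (Y (j + 1))) :
    |F 0 0 x y - (cellTensor k X Y i j
        (fun m n => F 0 0 (gridNode k X m) (gridNode k Y n)) y).eval x|
      ≤ (1 + lebesgueConst k) * (A * (X (i + 1) - X i) ^ a)
        + lebesgueConst k * ((1 + lebesgueConst k) * (B * (Y (j + 1) - Y j) ^ b)) := by
  rw [cellTensor_nodal_eq, Polynomial.eval_sub]
  have h1 := (interp_error_cell hk hX ha (G := fun l t => F l 0 t y) (M := A)
    (fun l hl t ht => (hF.dx l 0 (by omega) t (hXs ht) y (hYs hy)).mono hXs)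
    (fun t ht => hA t ht y hy) hx).1
  have h2 := abs_eval_cellPoly_le hk hX (c := fun m => F 0 0 (gridNode k X m) y
          - (cellPoly k Y j (fun n => F 0 0 (gridNode k X m) (gridNode k Y n))).eval y)
      (A := (1 + lebesgueConst k) * (B * (Y (j + 1) - Y j) ^ b)) (fun m hm => by
    have hm' := gridNode_mem_Icc hk hX.le hm
    exact (interp_error_cell hk hY hb (G := fun l t => F 0 l (gridNode k X m) t) (M := B)
      (fun l hl t ht => (hF.dy 0 l (by omega) _ (hXs hm') t (hYs ht)).mono hYs)
      (fun t ht => hB _ hm' t ht) hy).1) hx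
  rw [← sub_add]
  exact (abs_add_le _ _).trans (add_le_add h1 h2)

/-- An inverse estimate for $I_x(v-I_yv)$ would produce $h_y^b/h_x$, useless on stretched cells.
Instead $I_x$ is stable in the maximum norm of the first derivative, so the second term is
controlled by $\partial_x(v-I_yv)=v_x-I_yv_x$. -/
theorem tensor_deriv_error_cell (hk : 1 ≤ k) (hF : HasPartials (k + 1) F)
    (hX : X i < X (i + 1)) (hY : Y j < Y (j + 1))
    (hXs : Icc (X i) (X (i + 1)) ⊆ Icc 0 1) (hYs : Icc (Y j) (Y (j + 1)) ⊆ Icc 0 1)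
    {a b : ℕ} (ha1 : 1 ≤ a) (ha : a ≤ k + 1) (hb : b ≤ k) {A B : ℝ}
    (hA : ∀ x ∈ Icc (X i) (X (i + 1)), ∀ y ∈ Icc (Y j) (Y (j + 1)), |F a 0 x y| ≤ A)
    (hB : ∀ x ∈ Icc (X i) (X (i + 1)), ∀ y ∈ Icc (Y j) (Y (j + 1)), |F 1 b x y| ≤ B)
    {x y : ℝ} (hx : x ∈ Icc (X i) (X (i + 1))) (hy : y ∈ Icc (Y j) (Y (j + 1))) :
    |F 1 0 x y - (cellTensor k X Y i j
        (fun m n => F 0 0 (gridNode k X m) (gridNode k Y n)) y).derivative.eval x|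
      ≤ (1 + lebesgueConst k) * (A * (X (i + 1) - X i) ^ (a - 1))
        + (2 + lebesgueConst k) * ((1 + lebesgueConst k) * (B * (Y (j + 1) - Y j) ^ b)) := by
  rw [cellTensor_nodal_eq, Polynomial.derivative_sub, Polynomial.eval_sub]
  have h1 := (interp_error_cell hk hX ha (G := fun l t => F l 0 t y) (M := A)
    (fun l hl t ht => (hF.dx l 0 (by omega) t (hXs ht) y (hYs hy)).mono hXs)
    (fun t ht => hA t ht y hy) hx).2 ha1
  set D : ℕ → ℝ → ℝ := fun l t =>
    F l 0 t y - (cellPoly k Y j (fun n => F l 0 t (gridNode k Y n))).eval y with hD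
  have hD1 : ∀ t ∈ Icc (X i) (X (i + 1)),
      |D 1 t| ≤ (1 + lebesgueConst k) * (B * (Y (j + 1) - Y j) ^ b) := fun t ht =>
    (interp_error_cell hk hY (by omega : b ≤ k + 1) (G := fun l s => F 1 l t s) (M := B)
      (fun l hl s hs => (hF.dy 1 l (by omega) t (hXs ht) s (hYs hs)).mono hYs)
      (fun s hs => hB t ht s hs) hy).1
  -- The order-one error estimate for the $x$-interpolation of $D_0=v-I_yv$; adding $|D_1|$ gives
  -- the stability constant $2+\Lambda$.
  have h2 := (interp_error_cell hk hX (by omega : 1 ≤ k + 1) (G := D)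
    (M := (1 + lebesgueConst k) * (B * (Y (j + 1) - Y j) ^ b)) (by
      intro l hl t ht
      obtain rfl : l = 0 := by omega
      simp only [hD, eval_cellPoly]
      refine ((hF.dx 0 0 (by omega) t (hXs ht) y (hYs hy)).mono hXs).sub ?_
      refine HasDerivWithinAt.fun_sum fun n hn => ?_
      exact ((hF.dx 0 0 (by omega) t (hXs ht) _
        (hYs (gridNode_mem_Icc hk hY.le hn))).mono hXs).mul_const _) hD1 hx).2 le_rfl
  simp only [Nat.sub_self, pow_zero, mul_one] at h2
  have h3 : |(cellPoly k X i (fun m => D 0 (gridNode k X m))).derivative.eval x|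
      ≤ (2 + lebesgueConst k) * ((1 + lebesgueConst k) * (B * (Y (j + 1) - Y j) ^ b)) := by
    have h4 := abs_sub_abs_le_abs_sub
      ((cellPoly k X i (fun m => D 0 (gridNode k X m))).derivative.eval x) (D 1 x)
    have h5 := hD1 x hx
    have h6 := (abs_sub_comm _ _).le.trans h2
    linarith
  rw [← sub_add]
  exact (abs_add_le _ _).trans (add_le_add h1 h3)

end

/-! ## Layer profiles on a mesh -/

/-- `X 0 < X 1 < ⋯ < X N` is a partition of `[0, 1]`. -/
structure UnitMesh (N : ℕ) (X : ℕ → ℝ) : Prop where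
  zero : X 0 = 0
  one : X N = 1
  lt : ∀ i < N, X i < X (i + 1)

theorem UnitMesh.monotone {N : ℕ} {X : ℕ → ℝ} (h : UnitMesh N X) {i j : ℕ} (hij : i ≤ j)
    (hj : j ≤ N) : X i ≤ X j := by
  induction j, hij using Nat.le_induction with
  | base => exact le_rfl
  | succ j _ ih => exact (ih (by omega)).trans (h.lt j (by omega)).le

theorem UnitMesh.cell_subset {N : ℕ} {X : ℕ → ℝ} (h : UnitMesh N X) {i : ℕ} (hi : i < N) :
    Icc (X i) (X (i + 1)) ⊆ Icc 0 1 := by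
  apply Icc_subset_Icc
  · rw [← h.zero]; exact h.monotone (Nat.zero_le _) hi.le
  · rw [← h.one]; exact h.monotone (by omega) le_rfl

theorem UnitMesh.sum_length {N : ℕ} {X : ℕ → ℝ} (h : UnitMesh N X) :
    ∑ i ∈ Finset.range N, (X (i + 1) - X i) = 1 := by
  rw [Finset.sum_range_sub, h.zero, h.one, sub_zero]

/-- The cell with weight bound `q ^ (k + 1)` and length `h` resolves the layer of width `ρ⁻¹`, or
it is a cell where the layer becomes small, or the layer is negligible there. -/
def LayerRegime (k N : ℕ) (a b : ℝ) (ρ : ℝ) (w : ℝ → ℝ) (q K : ℝ) : Prop :=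
  (b - a) * ρ * q ≤ K / N ∨
  (q ≤ K / N ∧ 1 ≤ K * ((b - a) * ρ) ∧ ρ * ∫ x in a..b, w x ^ 2 ≤ K * q ^ (2 * (k + 1))) ∨
  (q ≤ K / N ∧ ρ * q ≤ K)

/-- A layer function `w` with decay rate `ρ`, as it is seen on the mesh `X`. -/
structure Profile (k N : ℕ) (X : ℕ → ℝ) (ρ : ℝ) (w : ℝ → ℝ) (q : ℕ → ℝ) (K : ℝ) : Prop where
  rate_pos : 0 < ρ
  q_nonneg : ∀ i < N, 0 ≤ q i
  q_le_one : ∀ i < N, q i ≤ 1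
  w_nonneg : ∀ t, 0 ≤ w t
  w_cont : Continuous w
  w_le : ∀ i < N, ∀ t ∈ Icc (X i) (X (i + 1)), w t ≤ q i ^ (k + 1)
  regime : ∀ i < N, LayerRegime k N (X i) (X (i + 1)) ρ w (q i) K

/-- The partial derivatives are bounded by a product of layer profiles. -/
def ProductBound (k : ℕ) (F : ℕ → ℕ → ℝ → ℝ → ℝ) (C₀ ρ₁ : ℝ) (w₁ : ℝ → ℝ) (ρ₂ : ℝ)
    (w₂ : ℝ → ℝ) : Prop :=
  ∀ i j, i + j ≤ k + 1 → ∀ x ∈ Icc (0 : ℝ) 1, ∀ y ∈ Icc (0 : ℝ) 1,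
    |F i j x y| ≤ C₀ * ((ρ₁ ^ i * w₁ x) * (ρ₂ ^ j * w₂ y))

theorem ProductBound.swap {k : ℕ} {F : ℕ → ℕ → ℝ → ℝ → ℝ} {C₀ ρ₁ ρ₂ : ℝ} {w₁ w₂ : ℝ → ℝ}
    (h : ProductBound k F C₀ ρ₁ w₁ ρ₂ w₂) :
    ProductBound k (fun i j x y => F j i y x) C₀ ρ₂ w₂ ρ₁ w₁ := by
  intro i j hij x hx y hy
  rw [mul_comm (ρ₂ ^ i * w₂ x)]
  exact h j i (by omega) y hy x hx

section

variable {k N : ℕ} {X Y : ℕ → ℝ} {ρ ρ₁ ρ₂ : ℝ} {w w₁ w₂ : ℝ → ℝ} {q q₁ q₂ : ℕ → ℝ} {K C₀ : ℝ}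
  {F : ℕ → ℕ → ℝ → ℝ → ℝ} {i j : ℕ}

/-- On a resolved cell the full order $a=l$ works, since $\rho^lh^lq^l=(h\rho q)^l$. On the other
cells $q$ itself is $O(N^{-1})$ and $a=0$ suffices. -/
theorem Profile.exists_scale (h : Profile k N X ρ w q K) (hX : UnitMesh N X) (hi : i < N)
    {l : ℕ} (hl : l ≤ k + 1) :
    ∃ a ≤ l, ρ ^ a * q i ^ (k + 1) * (X (i + 1) - X i) ^ a ≤ (K / N) ^ l := by
  have hq0 := h.q_nonneg i hi
  have hq1 := h.q_le_one i hi
  have hh := sub_pos.mpr (hX.lt i hi)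
  have hρ := h.rate_pos
  have hqd : q i ^ (k + 1) ≤ q i ^ l := pow_le_pow_of_le_one hq0 hq1 hl
  have hB : q i ≤ K / N →
      ∃ a ≤ l, ρ ^ a * q i ^ (k + 1) * (X (i + 1) - X i) ^ a ≤ (K / N) ^ l := by
    intro hqK
    refine ⟨0, Nat.zero_le _, ?_⟩
    simp only [pow_zero, one_mul, mul_one]
    exact hqd.trans (pow_le_pow_left₀ hq0 hqK l)
  rcases h.regime i hi with hA | hB1 | hB2
  · refine ⟨l, le_rfl, ?_⟩
    calc ρ ^ l * q i ^ (k + 1) * (X (i + 1) - X i) ^ l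
        ≤ ρ ^ l * q i ^ l * (X (i + 1) - X i) ^ l := by gcongr
      _ = ((X (i + 1) - X i) * ρ * q i) ^ l := by rw [mul_pow, mul_pow]; ring
      _ ≤ _ := pow_le_pow_left₀ (by positivity) hA l
  · exact hB hB1.1
  · exact hB hB2.1

theorem Profile.w_le_one (h : Profile k N X ρ w q K) (hi : i < N) {t : ℝ}
    (ht : t ∈ Icc (X i) (X (i + 1))) : w t ≤ 1 :=
  (h.w_le i hi t ht).trans (pow_le_one₀ (h.q_nonneg i hi) (h.q_le_one i hi))

/-- The partial derivatives on a cell. -/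
theorem ProductBound.cell_le (hF : ProductBound k F C₀ ρ₁ w₁ ρ₂ w₂) (hC₀ : 0 ≤ C₀)
    (h₁ : Profile k N X ρ₁ w₁ q₁ K) (h₂ : Profile k N Y ρ₂ w₂ q₂ K)
    (hX : UnitMesh N X) (hY : UnitMesh N Y) (hi : i < N) (hj : j < N) {a b : ℕ}
    (hab : a + b ≤ k + 1) {x y : ℝ} (hx : x ∈ Icc (X i) (X (i + 1)))
    (hy : y ∈ Icc (Y j) (Y (j + 1))) :
    |F a b x y| ≤ C₀ * ((ρ₁ ^ a * q₁ i ^ (k + 1)) * (ρ₂ ^ b * q₂ j ^ (k + 1))) := by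
  have := h₁.rate_pos
  have := h₂.rate_pos
  have := h₁.w_nonneg x
  have := h₂.w_nonneg y
  have := h₁.w_le i hi x hx
  have := h₂.w_le j hj y hy
  have := h₁.q_nonneg i hi
  refine (hF a b hab x (hX.cell_subset hi hx) y (hY.cell_subset hj hy)).trans ?_
  gcongr

/-- Each direction uses the order supplied by `Profile.exists_scale`; the other factor is only
bounded by $1$. -/
theorem ProductBound.interp_error (hk : 1 ≤ k) (hP : HasPartials (k + 1) F)
    (hF : ProductBound k F C₀ ρ₁ w₁ ρ₂ w₂) (hC₀ : 0 ≤ C₀)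
    (h₁ : Profile k N X ρ₁ w₁ q₁ K) (h₂ : Profile k N Y ρ₂ w₂ q₂ K)
    (hX : UnitMesh N X) (hY : UnitMesh N Y) (hi : i < N) (hj : j < N) {x y : ℝ}
    (hx : x ∈ Icc (X i) (X (i + 1))) (hy : y ∈ Icc (Y j) (Y (j + 1))) :
    |F 0 0 x y - (cellTensor k X Y i j
        (fun m n => F 0 0 (gridNode k X m) (gridNode k Y n)) y).eval x|
      ≤ (1 + lebesgueConst k) ^ 2 * C₀ * (K / N) ^ (k + 1) := by
  have hΛ := lebesgueConst_pos hk
  obtain ⟨a, ha, ha'⟩ := h₁.exists_scale hX hi le_rfl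
  obtain ⟨b, hb, hb'⟩ := h₂.exists_scale hY hj le_rfl
  have hx0 := pow_le_one₀ (n := k + 1) (h₁.q_nonneg i hi) (h₁.q_le_one i hi)
  have hy0 := pow_le_one₀ (n := k + 1) (h₂.q_nonneg j hj) (h₂.q_le_one j hj)
  have hρ₁ := h₁.rate_pos
  have hρ₂ := h₂.rate_pos
  have hq₁ := h₁.q_nonneg i hi
  have hq₂ := h₂.q_nonneg j hj
  have key := tensor_error_cell hk hP (hX.lt i hi) (hY.lt j hj) (hX.cell_subset hi)
    (hY.cell_subset hj) ha hb (A := C₀ * (ρ₁ ^ a * q₁ i ^ (k + 1)))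
    (B := C₀ * (ρ₂ ^ b * q₂ j ^ (k + 1)))
    (fun x hx y hy => by
      refine (hF.cell_le hC₀ h₁ h₂ hX hY hi hj (by omega) hx hy).trans ?_
      rw [pow_zero, one_mul]
      refine mul_le_mul_of_nonneg_left ?_ hC₀
      exact mul_le_of_le_one_right (by positivity) hy0)
    (fun x hx y hy => by
      refine (hF.cell_le hC₀ h₁ h₂ hX hY hi hj (by omega) hx hy).trans ?_
      rw [pow_zero, one_mul]
      refine mul_le_mul_of_nonneg_left ?_ hC₀
      exact mul_le_of_le_one_left (by positivity) hx0) hx hy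
  refine key.trans ?_
  calc _ = (1 + lebesgueConst k) * (C₀ * (ρ₁ ^ a * q₁ i ^ (k + 1) * (X (i + 1) - X i) ^ a))
        + lebesgueConst k * ((1 + lebesgueConst k) *
          (C₀ * (ρ₂ ^ b * q₂ j ^ (k + 1) * (Y (j + 1) - Y j) ^ b))) := by ring
    _ ≤ (1 + lebesgueConst k) * (C₀ * (K / N) ^ (k + 1))
        + lebesgueConst k * ((1 + lebesgueConst k) * (C₀ * (K / N) ^ (k + 1))) := by gcongr
    _ = _ := by ring

/-- Bound for the derivative of the interpolation error with any admissible order `a` in the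
first variable. -/
theorem ProductBound.interp_deriv_error_aux (hk : 1 ≤ k) (hP : HasPartials (k + 1) F)
    (hF : ProductBound k F C₀ ρ₁ w₁ ρ₂ w₂) (hC₀ : 0 ≤ C₀)
    (h₁ : Profile k N X ρ₁ w₁ q₁ K) (h₂ : Profile k N Y ρ₂ w₂ q₂ K)
    (hX : UnitMesh N X) (hY : UnitMesh N Y) (hi : i < N) (hj : j < N) {x y : ℝ}
    (hx : x ∈ Icc (X i) (X (i + 1))) (hy : y ∈ Icc (Y j) (Y (j + 1)))
    {a b : ℕ} (ha : a ≤ k) (hb : b ≤ k) {T₁ T₂ : ℝ}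
    (hT₁ : ρ₁ ^ a * q₁ i ^ (k + 1) * (X (i + 1) - X i) ^ a ≤ T₁)
    (hT₂ : q₁ i ^ (k + 1) * (ρ₂ ^ b * q₂ j ^ (k + 1) * (Y (j + 1) - Y j) ^ b) ≤ T₂) :
    |F 1 0 x y - (cellTensor k X Y i j
        (fun m n => F 0 0 (gridNode k X m) (gridNode k Y n)) y).derivative.eval x|
      ≤ (1 + lebesgueConst k) * (C₀ * ρ₁ * T₁)
        + (2 + lebesgueConst k) * ((1 + lebesgueConst k) * (C₀ * ρ₁ * T₂)) := by
  have hΛ := lebesgueConst_pos hk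
  have hy0 := pow_le_one₀ (n := k + 1) (h₂.q_nonneg j hj) (h₂.q_le_one j hj)
  have hρ₁ := h₁.rate_pos
  have hρ₂ := h₂.rate_pos
  have hq₁ := h₁.q_nonneg i hi
  have key := tensor_deriv_error_cell hk hP (hX.lt i hi) (hY.lt j hj) (hX.cell_subset hi)
    (hY.cell_subset hj) (a := a + 1) (by omega) (by omega) hb
    (A := C₀ * (ρ₁ ^ (a + 1) * q₁ i ^ (k + 1)))
    (B := C₀ * ((ρ₁ * q₁ i ^ (k + 1)) * (ρ₂ ^ b * q₂ j ^ (k + 1))))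
    (fun x hx y hy => by
      refine (hF.cell_le hC₀ h₁ h₂ hX hY hi hj (by omega) hx hy).trans ?_
      rw [pow_zero, one_mul]
      refine mul_le_mul_of_nonneg_left ?_ hC₀
      exact mul_le_of_le_one_right (by positivity) hy0)
    (fun x hx y hy => by
      refine (hF.cell_le hC₀ h₁ h₂ hX hY hi hj (by omega) hx hy).trans ?_
      rw [pow_one]) hx hy
  refine key.trans ?_
  simp only [Nat.add_sub_cancel]
  calc _ = (1 + lebesgueConst k) * (C₀ * ρ₁ *
          (ρ₁ ^ a * q₁ i ^ (k + 1) * (X (i + 1) - X i) ^ a))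
        + (2 + lebesgueConst k) * ((1 + lebesgueConst k) * (C₀ * ρ₁ *
          (q₁ i ^ (k + 1) * (ρ₂ ^ b * q₂ j ^ (k + 1) * (Y (j + 1) - Y j) ^ b)))) := by ring
    _ ≤ _ := by gcongr

/-- The constant in `ProductBound.interp_deriv_error`. -/
noncomputable def derivConst (k : ℕ) (C₀ K : ℝ) : ℝ :=
  ((1 + lebesgueConst k) * (3 + lebesgueConst k) * C₀) ^ 2 * K ^ (2 * k) * (K + K ^ 2)
    + 2 * C₀ ^ 2 * (1 + lebesgueConst k ^ 4) * K ^ (2 * k + 3)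

/-- The dominating function depends on $x$ alone and serves all rows $j$ at once, so integration
over the column reduces to one dimension. The rate of the $y$-layer does not enter the bound. -/
theorem ProductBound.interp_deriv_error (hk : 1 ≤ k) (hP : HasPartials (k + 1) F)
    (hF : ProductBound k F C₀ ρ₁ w₁ ρ₂ w₂) (hC₀ : 0 ≤ C₀) (hK : 0 < K)
    (h₁ : Profile k N X ρ₁ w₁ q₁ K) (h₂ : Profile k N Y ρ₂ w₂ q₂ K)
    (hX : UnitMesh N X) (hY : UnitMesh N Y) (hi : i < N) :
    ∃ B : ℝ → ℝ, Continuous B ∧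
      (∫ x in X i..X (i + 1), B x
        ≤ derivConst k C₀ K / N ^ (2 * k) * (ρ₁ / N + (X (i + 1) - X i))) ∧
      ∀ j < N, ∀ x ∈ Icc (X i) (X (i + 1)), ∀ y ∈ Icc (Y j) (Y (j + 1)),
        (F 1 0 x y - (cellTensor k X Y i j
          (fun m n => F 0 0 (gridNode k X m) (gridNode k Y n)) y).derivative.eval x) ^ 2
        ≤ B x := by
  have hΛ := lebesgueConst_pos hk
  have hρ₁ := h₁.rate_pos
  have hq₁ := h₁.q_nonneg i hi
  have hq₁' := h₁.q_le_one i hi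
  have hh := sub_pos.mpr (hX.lt i hi)
  have hN : (1 : ℝ) ≤ N := by exact_mod_cast (by omega : 1 ≤ N)
  have hN0 : (0 : ℝ) < N := by linarith
  set h := X (i + 1) - X i with hdef
  set Λ := lebesgueConst k with hΛdef
  -- This is $(1+\Lambda)+(2+\Lambda)(1+\Lambda)$ times $C_0$, the total constant of the two error
  -- terms.
  set L := (1 + Λ) * (3 + Λ) * C₀ with hL
  have hL0 : 0 ≤ L := by positivity
  set D := 2 * C₀ ^ 2 * (1 + Λ ^ 4) * K ^ (2 * k + 3) with hD
  have hD0 : 0 ≤ D := by positivity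
  have hdc : derivConst k C₀ K = L ^ 2 * K ^ (2 * k) * (K + K ^ 2) + D := rfl
  have hqk : ∀ l ≤ k + 1, q₁ i ^ (k + 1) ≤ q₁ i ^ l := fun l hl =>
    pow_le_pow_of_le_one hq₁ hq₁' hl
  rcases h₁.regime i hi with hA | hB1 | hB2
  -- Resolved cell. Keeping one extra power of $q$ in the pointwise bound $\rho qN^{-k}$ pays for
  -- the integration: $h(\rho q)^2=(h\rho q)\,\rho q\lesssim\rho/N$.
  · refine ⟨fun _ => (L * ρ₁ * q₁ i * (K / N) ^ k) ^ 2, continuous_const, ?_, ?_⟩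
    · rw [intervalIntegral.integral_const, smul_eq_mul, ← hdef]
      rw [← hdef] at hA
      calc h * (L * ρ₁ * q₁ i * (K / N) ^ k) ^ 2
          = L ^ 2 * (K / N) ^ (2 * k) * ρ₁ * q₁ i * (h * ρ₁ * q₁ i) := by ring
        _ ≤ L ^ 2 * (K / N) ^ (2 * k) * ρ₁ * 1 * (K / N) := by gcongr
        _ = L ^ 2 * K ^ (2 * k) * K / N ^ (2 * k) * (ρ₁ / N) := by
            rw [div_pow]; field_simp
        _ ≤ _ := by
            rw [hdc]
            gcongr
            · nlinarith [show 0 ≤ L ^ 2 * K ^ (2 * k) * K ^ 2 by positivity]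
            · linarith
    · intro j hj x hx y hy
      obtain ⟨b, hb, hb'⟩ := h₂.exists_scale hY hj (Nat.le_succ k)
      have key := hF.interp_deriv_error_aux hk hP hC₀ h₁ h₂ hX hY hi hj hx hy le_rfl hb
        (T₁ := q₁ i * (K / N) ^ k) (T₂ := q₁ i * (K / N) ^ k) (by
          calc ρ₁ ^ k * q₁ i ^ (k + 1) * (X (i + 1) - X i) ^ k
              = q₁ i * ((X (i + 1) - X i) * ρ₁ * q₁ i) ^ k := by rw [mul_pow, mul_pow]; ring
            _ ≤ _ := by gcongr) (by
          have := h₂.rate_pos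
          have := h₂.q_nonneg j hj
          have := sub_pos.mpr (hY.lt j hj)
          refine mul_le_mul ?_ hb' (by positivity) hq₁
          simpa using hqk 1 (by omega))
      rw [sq_le_sq]
      refine key.trans ((le_of_eq ?_).trans (le_abs_self _))
      rw [hL, hΛdef]; ring
  -- Last layer cell. Function and interpolant are bounded separately: $\rho^2\int w^2$ by the
  -- hypothesis on the integral, the interpolant by an inverse estimate with $h^{-1}\le K\rho$.
  · obtain ⟨hqK, hhρ, hint⟩ := hB1
    refine ⟨fun x => 2 * C₀ ^ 2 * ρ₁ ^ 2 * w₁ x ^ 2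
      + 2 * (Λ * (Λ * (C₀ * (K / N) ^ (k + 1))) / h) ^ 2,
      ((h₁.w_cont.pow 2).const_mul _).add continuous_const, ?_, ?_⟩
    · have hqs : q₁ i ^ (2 * (k + 1)) ≤ (K / N) ^ (2 * (k + 1)) :=
        pow_le_pow_left₀ hq₁ hqK _
      have hwc : Continuous fun x => 2 * C₀ ^ 2 * ρ₁ ^ 2 * w₁ x ^ 2 := by
        have := h₁.w_cont
        fun_prop
      rw [intervalIntegral.integral_add (hwc.intervalIntegrable _ _)
        (continuous_const.intervalIntegrable _ _), intervalIntegral.integral_const_mul,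
        intervalIntegral.integral_const, smul_eq_mul, ← hdef]
      have e1 : h * (2 * (Λ * (Λ * (C₀ * (K / N) ^ (k + 1))) / h) ^ 2)
          = 2 * Λ ^ 4 * C₀ ^ 2 * (K / N) ^ (2 * (k + 1)) * h⁻¹ := by
        field_simp
        ring
      have e2 : h⁻¹ ≤ K * ρ₁ := by
        rw [inv_le_iff_one_le_mul₀ hh]
        linarith
      -- Only one of the two spare factors $N^{-1}$ is needed.
      have e3 : (K / N) ^ (2 * (k + 1)) ≤ K ^ (2 * (k + 1)) / N ^ (2 * k) * (1 / N) := by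
        rw [div_pow, show 2 * (k + 1) = 2 * k + 1 + 1 by ring, pow_succ (N : ℝ) (2 * k + 1),
          pow_succ (N : ℝ) (2 * k), div_mul_div_comm, mul_one]
        refine div_le_div_of_nonneg_left (by positivity) (by positivity) ?_
        nlinarith [show (0 : ℝ) ≤ N ^ (2 * k) * N by positivity]
      rw [e1]
      calc 2 * C₀ ^ 2 * ρ₁ ^ 2 * (∫ x in X i..X (i + 1), w₁ x ^ 2)
            + 2 * Λ ^ 4 * C₀ ^ 2 * (K / N) ^ (2 * (k + 1)) * h⁻¹
          = 2 * C₀ ^ 2 * ρ₁ * (ρ₁ * ∫ x in X i..X (i + 1), w₁ x ^ 2)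
            + 2 * Λ ^ 4 * C₀ ^ 2 * (K / N) ^ (2 * (k + 1)) * h⁻¹ := by ring
        _ ≤ 2 * C₀ ^ 2 * ρ₁ * (K * (K / N) ^ (2 * (k + 1)))
            + 2 * Λ ^ 4 * C₀ ^ 2 * (K / N) ^ (2 * (k + 1)) * (K * ρ₁) := by
            exact add_le_add (mul_le_mul_of_nonneg_left (hint.trans (by gcongr)) (by positivity))
              (mul_le_mul_of_nonneg_left e2 (by positivity))
        _ = 2 * C₀ ^ 2 * (1 + Λ ^ 4) * K * ρ₁ * (K / N) ^ (2 * (k + 1)) := by ring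
        _ ≤ 2 * C₀ ^ 2 * (1 + Λ ^ 4) * K * ρ₁ * (K ^ (2 * (k + 1)) / N ^ (2 * k) * (1 / N)) := by
            gcongr
        _ = D / N ^ (2 * k) * (ρ₁ / N) := by rw [hD]; ring
        _ ≤ _ := by
            rw [hdc]
            gcongr
            · nlinarith [show 0 ≤ L ^ 2 * K ^ (2 * k) * (K + K ^ 2) by positivity]
            · linarith
    · intro j hj x hx y hy
      have hy1 := h₂.w_le_one hj hy
      have hw1 := h₁.w_nonneg x
      have hqp : q₁ i ^ (k + 1) ≤ (K / N) ^ (k + 1) := pow_le_pow_left₀ hq₁ hqK _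
      have i1 : |F 1 0 x y| ≤ C₀ * ρ₁ * w₁ x := by
        refine (hF 1 0 (by omega) x (hX.cell_subset hi hx) y (hY.cell_subset hj hy)).trans ?_
        rw [pow_zero, one_mul, pow_one, mul_assoc C₀]
        refine mul_le_mul_of_nonneg_left ?_ hC₀
        exact mul_le_of_le_one_right (by positivity) hy1
      have i2 := (abs_eval_cellTensor_le hk (hX.lt i hi) (hY.lt j hj)
        (c := fun m n => F 0 0 (gridNode k X m) (gridNode k Y n)) (A := C₀ * (K / N) ^ (k + 1))
        (fun m hm n hn => by
          have hm' := gridNode_mem_Icc hk (hX.lt i hi).le hm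
          have hn' := gridNode_mem_Icc hk (hY.lt j hj).le hn
          refine (hF.cell_le hC₀ h₁ h₂ hX hY hi hj (by omega) hm' hn').trans ?_
          rw [pow_zero, pow_zero, one_mul, one_mul]
          gcongr
          exact (mul_le_of_le_one_right (by positivity)
            (pow_le_one₀ (h₂.q_nonneg j hj) (h₂.q_le_one j hj))).trans hqp) hx hy).2
      have i3 := (abs_sub _ _).trans (add_le_add i1 i2)
      refine (sq_le_sq' (neg_le_of_abs_le i3) (le_of_abs_le i3)).trans ?_
      refine (add_sq_le).trans (le_of_eq ?_)
      rw [mul_add, mul_pow, mul_pow]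
      ring
  -- Negligible layer. Stability alone (orders $a=b=0$) gives an error of size $\rho q^{k+1}\lesssim
  -- N^{-k}$, which accounts for the summand $h$ of the bound.
  · obtain ⟨hqK, hρq⟩ := hB2
    refine ⟨fun _ => (L * K * (K / N) ^ k) ^ 2, continuous_const, ?_, ?_⟩
    · rw [intervalIntegral.integral_const, smul_eq_mul, ← hdef]
      calc h * (L * K * (K / N) ^ k) ^ 2
          = L ^ 2 * K ^ (2 * k) * K ^ 2 / N ^ (2 * k) * h := by rw [div_pow]; ring
        _ ≤ _ := by
            rw [hdc]
            gcongr
            · nlinarith [show 0 ≤ L ^ 2 * K ^ (2 * k) * K by positivity]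
            · linarith [show 0 ≤ ρ₁ / N by positivity]
    · intro j hj x hx y hy
      have hy0 := pow_le_one₀ (n := k + 1) (h₂.q_nonneg j hj) (h₂.q_le_one j hj)
      have hqp : q₁ i ^ (k + 1) ≤ q₁ i * (K / N) ^ k := by
        rw [pow_succ']
        gcongr
      have key := hF.interp_deriv_error_aux hk hP hC₀ h₁ h₂ hX hY hi hj hx hy (Nat.zero_le k)
        (Nat.zero_le k) (T₁ := q₁ i * (K / N) ^ k) (T₂ := q₁ i * (K / N) ^ k)
        (by simpa using hqp) (by
          simp only [pow_zero, one_mul, mul_one]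
          exact (mul_le_of_le_one_right (by positivity) hy0).trans hqp)
      rw [sq_le_sq]
      refine key.trans (le_trans ?_ (le_abs_self _))
      calc _ = L * (ρ₁ * q₁ i) * (K / N) ^ k := by rw [hL, hΛdef]; ring
        _ ≤ _ := by gcongr

end

/-! ## Continuous piecewise polynomials -/

section

variable {k N : ℕ} {X Y : ℕ → ℝ}

theorem notMem_cell (hX : UnitMesh N X) {i j : ℕ} (hi : i < N) (hj : j < N) {t : ℝ}
    (ht : t ∈ cell N X i) (hij : i ≠ j) : t ∉ cell N X j := by
  have key : ∀ {i j : ℕ}, i < j → j < N → t ∈ cell N X i → t ∈ cell N X j → False := by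
    intro i j hij hj h1 h2
    have e : ¬ (i + 1 = N) := by omega
    simp only [cell, e, if_false] at h1
    have h3 : X j ≤ t := by
      unfold cell at h2
      split_ifs at h2 <;> exact h2.1
    have := hX.monotone (show i + 1 ≤ j by omega) hj.le
    linarith [h1.2]
  intro h
  rcases lt_or_gt_of_ne hij with h1 | h1
  · exact key h1 hj ht h
  · exact key h1 hi h ht

theorem hat_of_mem_cell (hX : UnitMesh N X) {i : ℕ} (hi : i < N) {t : ℝ}
    (ht : t ∈ cell N X i) (m : ℕ) :
    hat k N X m t
      = if m ∈ Finset.Icc (i * k) (i * k + k) then (cellBasis k X i m).eval t else 0 := by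
  unfold hat
  rw [Finset.sum_eq_single i]
  · simp only [ht, true_and]; rfl
  · intro j hj hji
    rw [if_neg]
    rintro ⟨h, -⟩
    exact notMem_cell hX hi (Finset.mem_range.mp hj) ht hji.symm h
  · intro h
    exact absurd (Finset.mem_range.mpr hi) h

/-- The cells are half open, so only the right end of a cell needs an argument. There the
polynomials of both neighbouring cells take the Kronecker value of the shared node; this is what
makes the pieces fit together continuously. -/
theorem hat_of_mem_Icc (hk : 1 ≤ k) (hX : UnitMesh N X) {i : ℕ} (hi : i < N) {t : ℝ}
    (ht : t ∈ Icc (X i) (X (i + 1))) (m : ℕ) :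
    hat k N X m t
      = if m ∈ Finset.Icc (i * k) (i * k + k) then (cellBasis k X i m).eval t else 0 := by
  by_cases hc : t ∈ cell N X i
  · exact hat_of_mem_cell hX hi hc m
  have hiN : i + 1 ≠ N := by
    intro h
    exact hc (by simpa [cell, h] using ht)
  have ht1 : t = X (i + 1) := by
    by_contra h
    exact hc (by simpa [cell, hiN] using ⟨ht.1, lt_of_le_of_ne ht.2 h⟩)
  have hi1 : i + 1 < N := by omega
  have hc1 : t ∈ cell N X (i + 1) := by
    have := hX.lt (i + 1) hi1
    rw [ht1]
    unfold cell
    split_ifs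
    · exact ⟨le_rfl, this.le⟩
    · exact ⟨le_rfl, this⟩
  have key : ∀ j, X j < X (j + 1) → (i + 1) * k ∈ Finset.Icc (j * k) (j * k + k) →
      (if m ∈ Finset.Icc (j * k) (j * k + k) then (cellBasis k X j m).eval t else 0)
        = if m = (i + 1) * k then 1 else 0 := by
    intro j hj hmem
    rw [ht1, ← gridNode_mul hk X (i + 1)]
    split_ifs with h1 h2 h2
    · subst h2
      exact Lagrange.eval_basis_self (gridNode_injOn hk hj) h1
    · exact Lagrange.eval_basis_of_ne h2 hmem
    · exact absurd (h2 ▸ hmem) h1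
    · rfl
  rw [hat_of_mem_cell hX hi1 hc1 m, key i (hX.lt i hi) (by rw [Finset.mem_Icc, add_mul]; omega),
    key (i + 1) (hX.lt _ hi1) (by rw [Finset.mem_Icc]; omega)]

theorem continuousOn_hat (hk : 1 ≤ k) (hX : UnitMesh N X) (m : ℕ) :
    ContinuousOn (hat k N X m) (Icc 0 1) := by
  have key : ∀ i ≤ N, ContinuousOn (hat k N X m) (Icc 0 (X i)) := by
    intro i
    induction i with
    | zero => intro _; rw [hX.zero, Icc_self]; exact continuousOn_singleton _ _
    | succ i ih =>
      intro hi
      have h0 : 0 ≤ X i := by rw [← hX.zero]; exact hX.monotone (Nat.zero_le _) (by omega)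
      rw [← Icc_union_Icc_eq_Icc h0 (hX.lt i (by omega)).le]
      refine (ih (by omega)).union_of_isClosed ?_ isClosed_Icc isClosed_Icc
      refine ContinuousOn.congr (f := fun t => if m ∈ Finset.Icc (i * k) (i * k + k) then
        (cellBasis k X i m).eval t else 0) ?_ fun t ht => hat_of_mem_Icc hk hX (by omega) ht m
      split_ifs
      · exact (Polynomial.continuous _).continuousOn
      · exact continuousOn_const
  rw [← hX.one]
  exact key N le_rfl

theorem sum_hat_of_mem_Icc (hk : 1 ≤ k) (hX : UnitMesh N X) {i : ℕ} (hi : i < N) {t : ℝ}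
    (ht : t ∈ Icc (X i) (X (i + 1))) (c : ℕ → ℝ) :
    ∑ m ∈ Finset.range (N * k + 1), c m * hat k N X m t = (cellPoly k X i c).eval t := by
  rw [eval_cellPoly]
  have hsub : Finset.Icc (i * k) (i * k + k) ⊆ Finset.range (N * k + 1) := by
    intro m hm
    have := Nat.mul_le_mul_right k (show i + 1 ≤ N from hi)
    rw [add_mul] at this
    rw [Finset.mem_Icc] at hm
    rw [Finset.mem_range]
    omega
  refine (Finset.sum_subset_zero_on_sdiff hsub (fun m hm => ?_) fun m hm => ?_).symm
  · rw [hat_of_mem_Icc hk hX hi ht, if_neg (Finset.mem_sdiff.mp hm).2, mul_zero]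
  · rw [hat_of_mem_Icc hk hX hi ht, if_pos hm]

/-- The continuous piecewise polynomial with nodal values `c`. -/
noncomputable def tensorSpline (k N : ℕ) (X Y : ℕ → ℝ) (c : ℕ → ℕ → ℝ) (z : ℝ × ℝ) : ℝ :=
  ∑ m ∈ Finset.range (N * k + 1), ∑ n ∈ Finset.range (N * k + 1),
    c m n * (hat k N X m z.1 * hat k N Y n z.2)

theorem tensorSpline_swap (c : ℕ → ℕ → ℝ) (z : ℝ × ℝ) :
    tensorSpline k N X Y c z.swap = tensorSpline k N Y X (fun m n => c n m) z := by
  unfold tensorSpline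
  rw [Finset.sum_comm]
  simp only [Prod.fst_swap, Prod.snd_swap]
  exact Finset.sum_congr rfl fun m _ => Finset.sum_congr rfl fun n _ => by ring

theorem tensorSpline_of_mem_Icc (hk : 1 ≤ k) (hX : UnitMesh N X) (hY : UnitMesh N Y) {i j : ℕ}
    (hi : i < N) (hj : j < N) {x y : ℝ} (hx : x ∈ Icc (X i) (X (i + 1)))
    (hy : y ∈ Icc (Y j) (Y (j + 1))) (c : ℕ → ℕ → ℝ) :
    tensorSpline k N X Y c (x, y) = (cellTensor k X Y i j c y).eval x := by
  unfold tensorSpline cellTensor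
  rw [← sum_hat_of_mem_Icc hk hX hi hx]
  refine Finset.sum_congr rfl fun m _ => ?_
  rw [← sum_hat_of_mem_Icc hk hY hj hy, Finset.sum_mul]
  exact Finset.sum_congr rfl fun n _ => by ring

theorem continuousOn_tensorSpline (hk : 1 ≤ k) (hX : UnitMesh N X) (hY : UnitMesh N Y)
    (c : ℕ → ℕ → ℝ) : ContinuousOn (tensorSpline k N X Y c) OmegaBar := by
  unfold tensorSpline
  refine continuousOn_finsetSum _ fun m _ => continuousOn_finsetSum _ fun n _ =>
    continuousOn_const.mul (ContinuousOn.mul ?_ ?_)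
  · exact (continuousOn_hat hk hX m).comp continuous_fst.continuousOn fun z hz => hz.1
  · exact (continuousOn_hat hk hY n).comp continuous_snd.continuousOn fun z hz => hz.2

theorem sum_range_mul_eq (M k : ℕ) (f : ℕ → ℝ) :
    ∑ i ∈ Finset.range M, ∑ s ∈ Finset.range k, f (i * k + s)
      = ∑ m ∈ Finset.range (M * k), f m := by
  induction M with
  | zero => simp
  | succ M ih => rw [Finset.sum_range_succ, ih, add_mul, one_mul, Finset.sum_range_add]

theorem nodalTerm_eq (hk : 1 ≤ k) (v : ℝ × ℝ → ℝ) (i j : ℕ) {s t : ℕ} (hs : s ≤ k) (ht : t ≤ k)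
    (z : ℝ × ℝ) : nodalTerm k N X Y v i j s t z
      = v (gridNode k X (i * k + s), gridNode k Y (j * k + t))
        * (hat k N X (i * k + s) z.1 * hat k N Y (j * k + t) z.2) := by
  rw [gridNode_cell hk X i s hs, gridNode_cell hk Y j t ht]
  rfl

theorem sum_nodalTerm (hk : 1 ≤ k) (v : ℝ × ℝ → ℝ) (i : ℕ) {s : ℕ} (hs : s ≤ k) (z : ℝ × ℝ) :
    (∑ j ∈ Finset.range N, ∑ t ∈ Finset.range k, nodalTerm k N X Y v i j s t z)
      + nodalTerm k N X Y v i N s 0 z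
    = ∑ n ∈ Finset.range (N * k + 1), v (gridNode k X (i * k + s), gridNode k Y n)
        * (hat k N X (i * k + s) z.1 * hat k N Y n z.2) := by
  rw [Finset.sum_range_succ, ← sum_range_mul_eq, nodalTerm_eq hk v i N hs (Nat.zero_le k)]
  congr 1
  refine Finset.sum_congr rfl fun j _ => Finset.sum_congr rfl fun t ht => ?_
  rw [nodalTerm_eq hk v i j hs (Finset.mem_range.mp ht).le]

theorem lagrangeInterp_eq (hk : 1 ≤ k) (v : ℝ × ℝ → ℝ) (z : ℝ × ℝ) :
    lagrangeInterp k N X Y v z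
      = tensorSpline k N X Y (fun m n => v (gridNode k X m, gridNode k Y n)) z := by
  set G : ℕ → ℝ := fun m => ∑ n ∈ Finset.range (N * k + 1),
    v (gridNode k X m, gridNode k Y n) * (hat k N X m z.1 * hat k N Y n z.2) with hG
  have h1 : tensorSpline k N X Y (fun m n => v (gridNode k X m, gridNode k Y n)) z
      = ∑ i ∈ Finset.range N, ∑ s ∈ Finset.range k, G (i * k + s) + G (N * k + 0) := by
    rw [sum_range_mul_eq, add_zero, ← Finset.sum_range_succ]
    rfl
  rw [h1, lagrangeInterp, add_assoc, sum_nodalTerm hk v N (Nat.zero_le k)]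
  refine congrArg₂ (fun a b : ℝ => a + b) ?_ rfl
  refine Finset.sum_congr rfl fun i _ => Finset.sum_congr rfl fun s hs => ?_
  rw [sum_nodalTerm hk v i (Finset.mem_range.mp hs).le]

/-- The nodal values of `P v - Θ v`. -/
noncomputable def stripCoeff (k N : ℕ) (X Y : ℕ → ℝ) (v : ℝ × ℝ → ℝ) (m n : ℕ) : ℝ :=
  if m ∈ Finset.Icc (3 * N / 4 * k + 1) (3 * N / 4 * k + k) ∧ n ∈ Finset.Ico 1 (N * k) then
    v (gridNode k X m, gridNode k Y n) else 0

/-- $\Theta$ removes from $P$ exactly the terms with $y$-index $0$ and $Nk$, hence the interval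
$1\le n<Nk$ in `stripCoeff`. -/
theorem opP_sub_opTheta_eq (hk : 1 ≤ k) (hN : 0 < N) (v : ℝ × ℝ → ℝ) (z : ℝ × ℝ) :
    opP k N X Y v z - opTheta k N X Y v z
      = tensorSpline k N X Y (stripCoeff k N X Y v) z := by
  have hNk : 0 < N * k := Nat.mul_pos hN hk
  set g : ℕ → ℕ → ℝ := fun m n => v (gridNode k X m, gridNode k Y n)
        * (hat k N X m z.1 * hat k N Y n z.2) with hg
  have hsub : Finset.Icc (3 * N / 4 * k + 1) (3 * N / 4 * k + k) ⊆ Finset.range (N * k + 1) := by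
    intro m hm
    have : 3 * N / 4 + 1 ≤ N := by omega
    have := Nat.mul_le_mul_right k this
    rw [add_mul] at this
    rw [Finset.mem_Icc] at hm
    rw [Finset.mem_range]
    omega
  have h1 : opP k N X Y v z - opTheta k N X Y v z
      = ∑ s ∈ Finset.Icc 1 k, ∑ n ∈ Finset.Ico 1 (N * k), g (3 * N / 4 * k + s) n := by
    unfold opP opTheta
    rw [← Finset.sum_add_distrib, ← Finset.sum_sub_distrib]
    refine Finset.sum_congr rfl fun s hs => ?_
    have hs' := (Finset.mem_Icc.mp hs).2
    rw [sum_nodalTerm hk v _ hs', nodalTerm_eq hk v _ 0 hs' (Nat.zero_le k),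
      nodalTerm_eq hk v _ N hs' (Nat.zero_le k), Finset.sum_range_succ, Finset.range_eq_Ico,
      Finset.sum_eq_sum_Ico_succ_bot hNk]
    simp only [hg, zero_mul, add_zero, zero_add]
    ring
  have h2 : ∑ s ∈ Finset.Icc 1 k, ∑ n ∈ Finset.Ico 1 (N * k), g (3 * N / 4 * k + s) n
      = ∑ m ∈ Finset.Icc (3 * N / 4 * k + 1) (3 * N / 4 * k + k),
          ∑ n ∈ Finset.Ico 1 (N * k), g m n := by
    have := Finset.sum_map (Finset.Icc 1 k) (addLeftEmbedding (3 * N / 4 * k))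
      (fun m => ∑ n ∈ Finset.Ico 1 (N * k), g m n)
    rw [Finset.map_add_left_Icc] at this
    exact this.symm
  rw [h1, h2]
  unfold tensorSpline
  refine Finset.sum_subset_zero_on_sdiff hsub (fun m hm => ?_) fun m hm => ?_
  · refine Finset.sum_eq_zero fun n _ => ?_
    rw [stripCoeff, if_neg fun h => (Finset.mem_sdiff.mp hm).2 h.1, zero_mul]
  · refine Finset.sum_subset_zero_on_sdiff ?_ (fun n hn => ?_) fun n hn => ?_
    · intro n hn
      rw [Finset.mem_Ico] at hn
      rw [Finset.mem_range]
      omega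
    · rw [stripCoeff, if_neg fun h => (Finset.mem_sdiff.mp hn).2 h.2, zero_mul]
    · rw [stripCoeff, if_pos ⟨hm, hn⟩]

theorem modInterp_eq (hk : 1 ≤ k) (hN : 0 < N) (v : ℝ × ℝ → ℝ) (z : ℝ × ℝ) :
    modInterp k N X Y v z = lagrangeInterp k N X Y v z
      - tensorSpline k N X Y (stripCoeff k N X Y v) z := by
  rw [← opP_sub_opTheta_eq hk hN, modInterp]
  ring

end

/-! ## Sobolev functions that are piecewise smooth -/

theorem isOpen_Omega : IsOpen Omega := isOpen_Ioo.prod isOpen_Ioo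

theorem Omega_subset : Omega ⊆ OmegaBar := prod_mono Ioo_subset_Icc_self Ioo_subset_Icc_self

theorem isCompact_OmegaBar : IsCompact OmegaBar := isCompact_Icc.prod isCompact_Icc

theorem volume_restrict_Omega : (volume : Measure (ℝ × ℝ)).restrict Omega
    = ((volume : Measure ℝ).restrict (Ioo 0 1)).prod ((volume : Measure ℝ).restrict (Ioo 0 1)) := by
  rw [Measure.prod_restrict]; rfl

instance isProbabilityMeasure_Ioo :
    IsProbabilityMeasure ((volume : Measure ℝ).restrict (Ioo 0 1)) :=
  ⟨by simp⟩

instance isProbabilityMeasure_Omega :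
    IsProbabilityMeasure ((volume : Measure (ℝ × ℝ)).restrict Omega) := by
  rw [volume_restrict_Omega]; infer_instance

theorem memL2_of_continuousOn {v : ℝ × ℝ → ℝ} (hv : ContinuousOn v OmegaBar) : MemL2 v := by
  obtain ⟨C, hC⟩ := isCompact_OmegaBar.exists_bound_of_continuousOn hv
  refine MemLp.of_bound ((hv.mono Omega_subset).aestronglyMeasurable
    isOpen_Omega.measurableSet) C ?_
  filter_upwards [ae_restrict_mem isOpen_Omega.measurableSet] with z hz using hC z (Omega_subset hz)

theorem MemL2.integrable_mul {g φ : ℝ × ℝ → ℝ} (hg : MemL2 g) (hφ : Continuous φ)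
    (hc : HasCompactSupport φ) : IntegrableOn (fun z => g z * φ z) Omega := by
  obtain ⟨C, hC⟩ := hφ.bounded_above_of_compact_support hc
  exact Integrable.mul_bdd (c := C) (hg.integrable one_le_two) hφ.aestronglyMeasurable
    (Filter.Eventually.of_forall hC)

theorem continuous_fderiv_test {φ : ℝ × ℝ → ℝ} (hφ : ContDiff ℝ ∞ φ) (e : ℝ × ℝ) :
    Continuous fun z => fderiv ℝ φ z e :=
  (hφ.continuous_fderiv (by simp)).clm_apply continuous_const

theorem hasCompactSupport_fderiv_test {φ : ℝ × ℝ → ℝ} (hc : HasCompactSupport φ) (e : ℝ × ℝ) :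
    HasCompactSupport fun z => fderiv ℝ φ z e :=
  hc.fderiv_apply (𝕜 := ℝ) e

/-- On almost every horizontal line, $v\varphi$ is continuous, differentiable off a countable set
and zero at both ends, so its derivative integrates to zero; Fubini finishes. Continuity of $v$
rules out jump terms at the exceptional abscissae. -/
theorem isWeakPartial_of_hasDerivAt {v g : ℝ × ℝ → ℝ} (hv : ContinuousOn v OmegaBar)
    (hg : MemL2 g) {s : Set ℝ} (hs : s.Countable)
    (hd : ∀ x ∈ Ioo (0 : ℝ) 1 \ s, ∀ y ∈ Ioo (0 : ℝ) 1,
      HasDerivAt (fun t => v (t, y)) (g (x, y)) x) : IsWeakPartial (1, 0) v g := by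
  intro φ hφ hc hsupp
  have i1 : IntegrableOn (fun z => v z * fderiv ℝ φ z (1, 0)) Omega :=
    (memL2_of_continuousOn hv).integrable_mul (continuous_fderiv_test hφ _)
      (hasCompactSupport_fderiv_test hc _)
  have i2 : IntegrableOn (fun z => g z * φ z) Omega := hg.integrable_mul hφ.continuous hc
  rw [eq_neg_iff_add_eq_zero, ← integral_add i1 i2]
  have i3 : IntegrableOn (fun z => v z * fderiv ℝ φ z (1, 0) + g z * φ z) Omega := i1.add i2
  unfold IntegrableOn at i3
  rw [volume_restrict_Omega] at i3 ⊢
  have i4 := i3.prod_left_ae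
  rw [integral_prod_symm _ i3]
  refine integral_eq_zero_of_ae ?_
  filter_upwards [i4, ae_restrict_mem measurableSet_Ioo] with y hy hy1
  have hzero : ∀ x, (x, y) ∉ Omega → φ (x, y) = 0 := fun x hx =>
    image_eq_zero_of_notMem_tsupport fun h => hx (hsupp h)
  have hF := integral_eq_of_hasDerivAt_off_countable_of_le
    (fun x => v (x, y) * φ (x, y)) (fun x => v (x, y) * fderiv ℝ φ (x, y) (1, 0)
      + g (x, y) * φ (x, y)) zero_le_one hs
    (ContinuousOn.mul (hv.comp (by fun_prop) fun x hx => ⟨hx, Ioo_subset_Icc_self hy1⟩)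
      (hφ.continuous.comp (by fun_prop : Continuous fun x : ℝ => (x, y))).continuousOn)
    (by
      intro x hx
      have h1 : HasDerivAt (fun x : ℝ => (x, y)) ((1 : ℝ), (0 : ℝ)) x :=
        (hasDerivAt_id x).prodMk (hasDerivAt_const x y)
      have h2 := ((hφ.differentiable (by simp)) (x, y)).hasFDerivAt.comp_hasDerivAt x h1
      have h3 := (hd x hx y hy1).mul h2
      rw [add_comm]
      exact h3)
    (by
      rw [intervalIntegrable_iff_integrableOn_Ioo_of_le zero_le_one]
      exact hy)
  rw [intervalIntegral.integral_of_le zero_le_one, ← integral_Ioc_eq_integral_Ioo.symm] at hF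
  have e : ∀ x, x = 0 ∨ x = 1 → φ (x, y) = 0 := by
    intro x hx
    apply hzero
    rintro ⟨h, -⟩
    rcases hx with rfl | rfl
    · exact lt_irrefl _ h.1
    · exact lt_irrefl _ h.2
  simp only [e 0 (Or.inl rfl), e 1 (Or.inr rfl), mul_zero, sub_zero] at hF
  exact hF

/-- `v` has a weak derivative in the direction `e` whose squared `L²` norm is at most `M`. -/
def PartialBound (e : ℝ × ℝ) (v : ℝ × ℝ → ℝ) (M : ℝ) : Prop :=
  ∃ g, MemL2 g ∧ IsWeakPartial e v g ∧ l2NormSq g ≤ M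

theorem UnitMesh.exists_cell {N : ℕ} {X : ℕ → ℝ} (hX : UnitMesh N X) (hN : 0 < N) {x : ℝ}
    (hx : x ∈ Icc (0 : ℝ) 1) : ∃ i < N, x ∈ Icc (X i) (X (i + 1)) := by
  have key : ∀ i < N, x ≤ X (i + 1) → ∃ j < N, x ∈ Icc (X j) (X (j + 1)) := by
    intro i
    induction i with
    | zero => intro hi h; exact ⟨0, hi, by rw [hX.zero]; exact hx.1, h⟩
    | succ i ih =>
      intro hi h
      rcases le_total x (X (i + 1)) with h1 | h1
      · exact ih (by omega) h1
      · exact ⟨i + 1, hi, h1, h⟩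
  refine key (N - 1) (by omega) ?_
  rw [Nat.sub_add_cancel hN, hX.one]
  exact hx.2

theorem UnitMesh.exists_open_cell {N : ℕ} {X : ℕ → ℝ} (hX : UnitMesh N X) (hN : 0 < N) {x : ℝ}
    (hx : x ∈ Ioo (0 : ℝ) 1 \ range X) : ∃ i < N, x ∈ Ioo (X i) (X (i + 1)) := by
  obtain ⟨i, hi, h⟩ := hX.exists_cell hN (Ioo_subset_Icc_self hx.1)
  refine ⟨i, hi, lt_of_le_of_ne h.1 fun h' => hx.2 ⟨i, h'⟩,
    lt_of_le_of_ne h.2 fun h' => hx.2 ⟨i + 1, h'.symm⟩⟩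

/-- Joint measurability of the $x$-derivative is available for a function continuous on the whole
plane; clamping the coordinates to $[0,1]$ provides one. -/
theorem exists_continuous_extension {v : ℝ × ℝ → ℝ} (hv : ContinuousOn v OmegaBar) :
    ∃ w : ℝ × ℝ → ℝ, Continuous w ∧ ∀ z ∈ OmegaBar, w z = v z := by
  refine ⟨fun z => v (projIcc 0 1 zero_le_one z.1, projIcc 0 1 zero_le_one z.2), ?_, ?_⟩
  · refine hv.comp_continuous (f := fun z : ℝ × ℝ =>
      ((projIcc 0 1 zero_le_one z.1 : ℝ), (projIcc 0 1 zero_le_one z.2 : ℝ))) ?_ fun z => ?_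
    · exact ((continuous_subtype_val.comp continuous_projIcc).comp continuous_fst).prodMk
        ((continuous_subtype_val.comp continuous_projIcc).comp continuous_snd)
    · exact ⟨(projIcc 0 1 zero_le_one z.1).2, (projIcc 0 1 zero_le_one z.2).2⟩
  · rintro ⟨x, y⟩ ⟨hx, hy⟩
    simp only [projIcc_of_mem zero_le_one hx, projIcc_of_mem zero_le_one hy]

/-- A continuous function that is differentiable in the first variable on the strips of a mesh,
with a bound for the derivative that depends on the first variable only. -/
theorem partialBound_fst {N : ℕ} {X : ℕ → ℝ} (hX : UnitMesh N X) (hN : 0 < N)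
    {v : ℝ × ℝ → ℝ} (hv : ContinuousOn v OmegaBar) {B : ℕ → ℝ → ℝ} {b : ℕ → ℝ}
    (hB : ∀ i < N, Continuous (B i)) (hb : ∀ i < N, ∫ x in X i..X (i + 1), B i x ≤ b i)
    (hd : ∀ i < N, ∀ x ∈ Ioo (X i) (X (i + 1)), ∀ y ∈ Ioo (0 : ℝ) 1,
      ∃ d, HasDerivAt (fun t => v (t, y)) d x ∧ d ^ 2 ≤ B i x) :
    PartialBound (1, 0) v (∑ i ∈ Finset.range N, b i) := by
  obtain ⟨w, hw, hwv⟩ := exists_continuous_extension hv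
  -- A measurable candidate for the weak derivative; its values on the mesh lines, a null set, do
  -- not matter.
  set g : ℝ × ℝ → ℝ := fun z => deriv (fun t => w (t, z.2)) z.1 with hg
  have hgm : Measurable g := by
    have h1 : Measurable fun p : ℝ × ℝ => deriv ((fun y t => w (t, y)) p.1) p.2 :=
      measurable_deriv_with_param (f := fun y t => w (t, y))
        (hw.comp (continuous_snd.prodMk continuous_fst))
    exact h1.comp measurable_swap
  have hderiv : ∀ x ∈ Ioo (0 : ℝ) 1, ∀ y ∈ Ioo (0 : ℝ) 1, ∀ d,
      HasDerivAt (fun t => v (t, y)) d x → g (x, y) = d := by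
    intro x hx y hy d h
    have : (fun t => w (t, y)) =ᶠ[nhds x] fun t => v (t, y) := by
      filter_upwards [isOpen_Ioo.mem_nhds hx] with t ht
      exact hwv _ (Omega_subset ⟨ht, hy⟩)
    exact (h.congr_of_eventuallyEq this).deriv
  -- At an abscissa off the mesh exactly one indicator survives, so this glues the cell bounds into
  -- one integrable majorant.
  set Bf : ℝ → ℝ := fun x => ∑ i ∈ Finset.range N,
    (Ioo (X i) (X (i + 1))).indicator (B i) x with hBf
  have hBi : ∀ i < N, IntegrableOn (B i) (Ioo (X i) (X (i + 1))) := fun i hi =>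
    ((hB i hi).integrableOn_Icc).mono_set Ioo_subset_Icc_self
  have hIooSub : ∀ i < N, Ioo (X i) (X (i + 1)) ⊆ Ioo (0 : ℝ) 1 := by
    intro i hi x hx
    have h0 := hX.cell_subset hi (left_mem_Icc.mpr (hX.lt i hi).le)
    have h1 := hX.cell_subset hi (right_mem_Icc.mpr (hX.lt i hi).le)
    exact ⟨h0.1.trans_lt hx.1, hx.2.trans_le h1.2⟩
  have hBind : ∀ i ∈ Finset.range N, Integrable ((Ioo (X i) (X (i + 1))).indicator (B i))
      (volume.restrict (Ioo 0 1)) := fun i hi =>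
    (((integrable_indicator_iff measurableSet_Ioo).mpr (hBi i (Finset.mem_range.mp hi))).restrict)
  have hBfi : Integrable Bf (volume.restrict (Ioo 0 1)) := integrable_finsetSum _ hBind
  have hBfint : ∫ x in Ioo 0 1, Bf x ≤ ∑ i ∈ Finset.range N, b i := by
    rw [hBf, integral_finsetSum _ hBind]
    refine Finset.sum_le_sum fun i hi => ?_
    have hi' := Finset.mem_range.mp hi
    rw [setIntegral_indicator measurableSet_Ioo, inter_eq_right.mpr (hIooSub i hi')]
    refine le_trans (le_of_eq ?_) (hb i hi')
    rw [intervalIntegral.integral_of_le (hX.lt i hi').le, integral_Ioc_eq_integral_Ioo]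
  have hcell : ∀ x ∈ Ioo (0 : ℝ) 1 \ range X, ∀ y ∈ Ioo (0 : ℝ) 1,
      HasDerivAt (fun t => v (t, y)) (g (x, y)) x ∧ g (x, y) ^ 2 ≤ Bf x := by
    intro x hx y hy
    obtain ⟨i, hi, hxi⟩ := hX.exists_open_cell hN hx
    obtain ⟨d, hd1, hd2⟩ := hd i hi x hxi y hy
    rw [hderiv x hx.1 y hy d hd1]
    refine ⟨hd1, hd2.trans ?_⟩
    have hother : ∀ j ∈ Finset.range N, j ≠ i →
        (Ioo (X j) (X (j + 1))).indicator (B j) x = 0 := by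
      intro j hj hji
      refine indicator_of_notMem (fun h => ?_) _
      rcases lt_or_gt_of_ne hji with h1 | h1
      · have := hX.monotone (show j + 1 ≤ i by omega) hi.le
        linarith [h.2, hxi.1]
      · have := hX.monotone (show i + 1 ≤ j by omega) (Finset.mem_range.mp hj).le
        linarith [h.1, hxi.2]
    rw [hBf]
    simp only
    rw [Finset.sum_eq_single i hother (fun h => absurd (Finset.mem_range.mpr hi) h),
      indicator_of_mem hxi]
  have hae : ∀ᵐ z ∂(volume.restrict Omega), g z ^ 2 ≤ Bf z.1 := by
    have h1 : ∀ᵐ x ∂(volume.restrict (Ioo (0 : ℝ) 1)), x ∉ range X :=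
      ae_restrict_of_ae ((countable_range X).ae_notMem volume)
    have h2 : ∀ᵐ z ∂(volume.restrict Omega), z.1 ∉ range X := by
      rw [volume_restrict_Omega]
      exact Measure.quasiMeasurePreserving_fst.ae h1
    filter_upwards [h2, ae_restrict_mem isOpen_Omega.measurableSet] with z hz hzO
    exact (hcell z.1 ⟨hzO.1, hz⟩ z.2 hzO.2).2
  have hBz : Integrable (fun z : ℝ × ℝ => Bf z.1) (volume.restrict Omega) := by
    rw [volume_restrict_Omega]
    exact hBfi.comp_fst _
  have hg2 : Integrable (fun z => g z ^ 2) (volume.restrict Omega) := by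
    refine hBz.mono' (hgm.pow_const 2).aestronglyMeasurable ?_
    filter_upwards [hae] with z hz
    rw [Real.norm_eq_abs, abs_of_nonneg (sq_nonneg _)]
    exact hz
  have hgL : MemL2 g := (memLp_two_iff_integrable_sq hgm.aestronglyMeasurable).mpr hg2
  refine ⟨g, hgL, isWeakPartial_of_hasDerivAt hv hgL (countable_range X)
    fun x hx y hy => (hcell x hx y hy).1, ?_⟩
  refine (integral_mono_ae hg2 hBz hae).trans ?_
  rw [volume_restrict_Omega, integral_fun_fst]
  simpa using hBfint

/-! ### Exchange of the variables and calculus of energy bounds -/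

theorem measurePreserving_swap_Omega :
    MeasurePreserving Prod.swap ((volume : Measure (ℝ × ℝ)).restrict Omega)
      (volume.restrict Omega) := by
  rw [volume_restrict_Omega]
  exact Measure.measurePreserving_swap

theorem integral_Omega_swap (f : ℝ × ℝ → ℝ) : ∫ z in Omega, f z.swap = ∫ z in Omega, f z :=
  measurePreserving_swap_Omega.integral_comp MeasurableEquiv.prodComm.measurableEmbedding f

/-- Reduces every estimate in $y$ to one in $x$: reflection in the diagonal preserves $\Omega$, its
measure and the test functions. -/
theorem PartialBound.of_swap {v : ℝ × ℝ → ℝ} {M : ℝ}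
    (h : PartialBound (1, 0) (fun z => v z.swap) M) : PartialBound (0, 1) v M := by
  obtain ⟨g, hg, hw, hM⟩ := h
  refine ⟨fun z => g z.swap, hg.comp_measurePreserving measurePreserving_swap_Omega, ?_, ?_⟩
  · intro φ hφ hc hs
    have hφ' : ContDiff ℝ ∞ fun z : ℝ × ℝ => φ z.swap :=
      hφ.comp (contDiff_snd.prodMk contDiff_fst)
    have hts : tsupport (fun z : ℝ × ℝ => φ z.swap) = Prod.swap ⁻¹' tsupport φ :=
      tsupport_comp_eq_preimage φ (Homeomorph.prodComm ℝ ℝ)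
    have h1 := hw (fun z => φ z.swap) hφ' (hc.comp_homeomorph (Homeomorph.prodComm ℝ ℝ)) (by
      rw [hts]
      intro z hz
      have := hs hz
      exact ⟨this.2, this.1⟩)
    have hder : ∀ z, fderiv ℝ (fun z : ℝ × ℝ => φ z.swap) z (1, 0) = fderiv ℝ φ z.swap (0, 1) := by
      intro z
      have h2 := ((hφ.differentiable (by simp)) z.swap).hasFDerivAt.comp z
        (ContinuousLinearEquiv.prodComm ℝ ℝ ℝ).toContinuousLinearMap.hasFDerivAt
      have h3 := h2.fderiv
      have h4 : fderiv ℝ (fun z : ℝ × ℝ => φ z.swap) z = _ := h3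
      rw [h4]
      rfl
    simp only [hder] at h1
    rw [integral_Omega_swap (fun z => v z * fderiv ℝ φ z (0, 1))] at h1
    rw [h1, ← integral_Omega_swap (fun z => g z.swap * φ z)]
    simp only [Prod.swap_swap]
  · refine le_trans (le_of_eq ?_) hM
    exact integral_Omega_swap fun z => g z ^ 2

theorem MemL2.integrable_sq {v : ℝ × ℝ → ℝ} (hv : MemL2 v) :
    Integrable (fun z => v z ^ 2) (volume.restrict Omega) :=
  (memLp_two_iff_integrable_sq hv.1).mp hv

theorem l2NormSq_add_le {v w : ℝ × ℝ → ℝ} (hv : MemL2 v) (hw : MemL2 w) :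
    l2NormSq (v + w) ≤ 2 * l2NormSq v + 2 * l2NormSq w := by
  unfold l2NormSq
  rw [← integral_const_mul, ← integral_const_mul, ← integral_add (hv.integrable_sq.const_mul 2)
    (hw.integrable_sq.const_mul 2)]
  refine integral_mono (MemL2.integrable_sq (hv.add hw))
    ((hv.integrable_sq.const_mul 2).add (hw.integrable_sq.const_mul 2)) fun z => ?_
  simp only [Pi.add_apply]
  nlinarith [sq_nonneg (v z - w z)]

theorem PartialBound.add {e : ℝ × ℝ} {v w : ℝ × ℝ → ℝ} {M M' : ℝ} (hv : MemL2 v) (hw : MemL2 w)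
    (h : PartialBound e v M) (h' : PartialBound e w M') :
    PartialBound e (v + w) (2 * M + 2 * M') := by
  obtain ⟨g, hg, hgw, hgM⟩ := h
  obtain ⟨g', hg', hgw', hgM'⟩ := h'
  refine ⟨g + g', hg.add hg', ?_, ?_⟩
  · intro φ hφ hc hs
    have c1 := continuous_fderiv_test hφ e
    have c2 := hasCompactSupport_fderiv_test hc e
    simp only [Pi.add_apply, add_mul]
    rw [integral_add (hv.integrable_mul c1 c2) (hw.integrable_mul c1 c2),
      integral_add (hg.integrable_mul hφ.continuous hc) (hg'.integrable_mul hφ.continuous hc),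
      hgw φ hφ hc hs, hgw' φ hφ hc hs]
    ring
  · have := l2NormSq_add_le hg hg'
    linarith

theorem PartialBound.congr {e : ℝ × ℝ} {v w : ℝ × ℝ → ℝ} {M : ℝ} (h : PartialBound e v M)
    (hvw : ∀ z ∈ Omega, w z = v z) : PartialBound e w M := by
  obtain ⟨g, hg, hgw, hgM⟩ := h
  refine ⟨g, hg, fun φ hφ hc hs => ?_, hgM⟩
  rw [← hgw φ hφ hc hs]
  refine setIntegral_congr_fun isOpen_Omega.measurableSet fun z hz => ?_
  simp only [hvw z hz]

theorem l2NormSq_congr {v w : ℝ × ℝ → ℝ} (hvw : ∀ z ∈ Omega, w z = v z) :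
    l2NormSq w = l2NormSq v := by
  refine setIntegral_congr_fun isOpen_Omega.measurableSet fun z hz => ?_
  simp only [hvw z hz]

theorem l2NormSq_le_of_abs_le {v : ℝ × ℝ → ℝ} {A : ℝ} (hA : ∀ z ∈ Omega, |v z| ≤ A)
    (hv : MemL2 v) : l2NormSq v ≤ A ^ 2 := by
  have h : l2NormSq v ≤ ∫ _z in Omega, A ^ 2 := by
    refine integral_mono_ae hv.integrable_sq (integrable_const _) ?_
    filter_upwards [ae_restrict_mem isOpen_Omega.measurableSet] with z hz
    exact sq_le_sq' (neg_le_of_abs_le (hA z hz)) (le_of_abs_le (hA z hz))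
  simpa using h

/-- `v ∈ H¹(Ω)` with the square of the energy norm at most `M`. -/
def EnergyBound (ε : ℝ) (v : ℝ × ℝ → ℝ) (M : ℝ) : Prop :=
  MemL2 v ∧ ∃ a b, PartialBound (1, 0) v a ∧ PartialBound (0, 1) v b ∧
    ε * (a + b) + l2NormSq v ≤ M

theorem EnergyBound.add {ε : ℝ} {v w : ℝ × ℝ → ℝ} {M M' : ℝ}
    (h : EnergyBound ε v M) (h' : EnergyBound ε w M') :
    EnergyBound ε (v + w) (2 * M + 2 * M') := by
  obtain ⟨hv, a, b, ha, hb, hM⟩ := h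
  obtain ⟨hw, a', b', ha', hb', hM'⟩ := h'
  refine ⟨hv.add hw, _, _, ha.add hv hw ha', hb.add hv hw hb', ?_⟩
  have := l2NormSq_add_le hv hw
  nlinarith

theorem EnergyBound.congr {ε : ℝ} {v w : ℝ × ℝ → ℝ} {M : ℝ} (h : EnergyBound ε v M)
    (hvw : ∀ z ∈ Omega, w z = v z) : EnergyBound ε w M := by
  obtain ⟨hv, a, b, ha, hb, hM⟩ := h
  refine ⟨?_, a, b, ha.congr hvw, hb.congr hvw, by rw [l2NormSq_congr hvw]; exact hM⟩
  refine (memLp_congr_ae ?_).mpr hv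
  filter_upwards [ae_restrict_mem isOpen_Omega.measurableSet] with z hz using hvw z hz

/-- Uniqueness of weak derivatives transfers the bound from the explicit derivative to the one
chosen in `weakPartial`. -/
theorem PartialBound.hasL2WeakPartial {e : ℝ × ℝ} {v : ℝ × ℝ → ℝ} {M : ℝ}
    (h : PartialBound e v M) : HasL2WeakPartial e v ∧ l2NormSq (weakPartial e v) ≤ M := by
  obtain ⟨g, hg, hgw, hgM⟩ := h
  refine ⟨⟨g, hg, hgw⟩, le_trans (le_of_eq (integral_congr_ae ?_)) hgM⟩
  filter_upwards [weakPartial_ae_eq hg hgw] with z hz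
  rw [hz]

theorem EnergyBound.energyNorm_le {ε : ℝ} (hε : 0 ≤ ε) {v : ℝ × ℝ → ℝ} {M : ℝ}
    (h : EnergyBound ε v M) : MemH1 v ∧ energyNorm ε v ≤ Real.sqrt M := by
  obtain ⟨hv, a, b, ha, hb, hM⟩ := h
  have ha' := ha.hasL2WeakPartial
  have hb' := hb.hasL2WeakPartial
  refine ⟨⟨hv, ha'.1, hb'.1⟩, Real.sqrt_le_sqrt (le_trans ?_ hM)⟩
  gcongr
  · exact ha'.2
  · exact hb'.2

/-! ## Interpolation error of a layer component -/

section

variable {k N : ℕ} {X Y : ℕ → ℝ} {ρ₁ ρ₂ : ℝ} {w₁ w₂ : ℝ → ℝ} {q₁ q₂ : ℕ → ℝ} {K C₀ : ℝ}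
  {F : ℕ → ℕ → ℝ → ℝ → ℝ} {v : ℝ × ℝ → ℝ}

theorem continuousOn_lagrangeInterp (hk : 1 ≤ k) (hX : UnitMesh N X) (hY : UnitMesh N Y)
    (v : ℝ × ℝ → ℝ) : ContinuousOn (lagrangeInterp k N X Y v) OmegaBar :=
  (continuousOn_tensorSpline hk hX hY _).congr fun z _ => lagrangeInterp_eq hk v z

theorem lagrangeInterp_swap (hk : 1 ≤ k) (v : ℝ × ℝ → ℝ) (z : ℝ × ℝ) :
    lagrangeInterp k N X Y v z.swap = lagrangeInterp k N Y X (fun z => v z.swap) z := by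
  rw [lagrangeInterp_eq hk, tensorSpline_swap, lagrangeInterp_eq hk]
  rfl

theorem lagrangeInterp_of_mem_Icc (hk : 1 ≤ k) (hX : UnitMesh N X) (hY : UnitMesh N Y) {i j : ℕ}
    (hi : i < N) (hj : j < N) {x y : ℝ} (hx : x ∈ Icc (X i) (X (i + 1)))
    (hy : y ∈ Icc (Y j) (Y (j + 1))) (hv : ∀ x y, v (x, y) = F 0 0 x y) :
    lagrangeInterp k N X Y v (x, y) = (cellTensor k X Y i j
      (fun m n => F 0 0 (gridNode k X m) (gridNode k Y n)) y).eval x := by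
  rw [lagrangeInterp_eq hk, tensorSpline_of_mem_Icc hk hX hY hi hj hx hy]
  simp only [hv]

theorem abs_interp_error_le (hk : 1 ≤ k) (hP : HasPartials (k + 1) F)
    (hF : ProductBound k F C₀ ρ₁ w₁ ρ₂ w₂) (hC₀ : 0 ≤ C₀)
    (h₁ : Profile k N X ρ₁ w₁ q₁ K) (h₂ : Profile k N Y ρ₂ w₂ q₂ K)
    (hX : UnitMesh N X) (hY : UnitMesh N Y) (hN : 0 < N) (hv : ∀ x y, v (x, y) = F 0 0 x y)
    {z : ℝ × ℝ} (hz : z ∈ OmegaBar) :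
    |(v - lagrangeInterp k N X Y v) z| ≤ (1 + lebesgueConst k) ^ 2 * C₀ * (K / N) ^ (k + 1) := by
  obtain ⟨x, y⟩ := z
  obtain ⟨i, hi, hx⟩ := hX.exists_cell hN hz.1
  obtain ⟨j, hj, hy⟩ := hY.exists_cell hN hz.2
  rw [Pi.sub_apply, lagrangeInterp_of_mem_Icc hk hX hY hi hj hx hy hv, hv]
  exact hF.interp_error hk hP hC₀ h₁ h₂ hX hY hi hj hx hy

theorem partialBound_interp_fst (hk : 1 ≤ k) (hP : HasPartials (k + 1) F)
    (hF : ProductBound k F C₀ ρ₁ w₁ ρ₂ w₂) (hC₀ : 0 ≤ C₀) (hK : 0 < K)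
    (h₁ : Profile k N X ρ₁ w₁ q₁ K) (h₂ : Profile k N Y ρ₂ w₂ q₂ K)
    (hX : UnitMesh N X) (hY : UnitMesh N Y) (hN : 0 < N) (hv : ∀ x y, v (x, y) = F 0 0 x y)
    (hvc : ContinuousOn v OmegaBar) :
    PartialBound (1, 0) (v - lagrangeInterp k N X Y v)
      (derivConst k C₀ K / N ^ (2 * k) * (ρ₁ + 1)) := by
  have hex := fun i (hi : i < N) =>
    hF.interp_deriv_error hk hP hC₀ hK h₁ h₂ hX hY hi
  choose! B hBc hBi hBd using hex
  have key := partialBound_fst hX hN (hvc.sub (continuousOn_lagrangeInterp hk hX hY v))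
    (B := B) hBc hBi (by
      intro i hi x hx y hy
      obtain ⟨j, hj, hyj⟩ := hY.exists_cell hN (Ioo_subset_Icc_self hy)
      have hxI := Ioo_subset_Icc_self hx
      refine ⟨_, ?_, hBd i hi j hj x hxI y hyj⟩
      have h01 : Icc (0 : ℝ) 1 ∈ nhds x :=
        Filter.mem_of_superset (isOpen_Ioo.mem_nhds hx)
          (Ioo_subset_Icc_self.trans (hX.cell_subset hi))
      have hd1 := (hP.dx 0 0 (by omega) x (hX.cell_subset hi hxI) y
        (Ioo_subset_Icc_self hy)).hasDerivAt h01
      refine (hd1.sub (Polynomial.hasDerivAt _ x)).congr_of_eventuallyEq ?_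
      filter_upwards [isOpen_Ioo.mem_nhds hx] with t ht
      rw [Pi.sub_apply, Pi.sub_apply,
        lagrangeInterp_of_mem_Icc hk hX hY hi hj (Ioo_subset_Icc_self ht) hyj hv, hv])
  -- There are $N$ columns and their widths add up to $1$, so $\sum_i(\rho_1/N+h_i)=\rho_1+1$.
  rw [← Finset.mul_sum, Finset.sum_add_distrib, hX.sum_length, Finset.sum_const, Finset.card_range,
    nsmul_eq_mul, mul_div_cancel₀ _ (by positivity)] at key
  exact key

theorem partialBound_interp_snd (hk : 1 ≤ k) (hP : HasPartials (k + 1) F)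
    (hF : ProductBound k F C₀ ρ₁ w₁ ρ₂ w₂) (hC₀ : 0 ≤ C₀) (hK : 0 < K)
    (h₁ : Profile k N X ρ₁ w₁ q₁ K) (h₂ : Profile k N Y ρ₂ w₂ q₂ K)
    (hX : UnitMesh N X) (hY : UnitMesh N Y) (hN : 0 < N) (hv : ∀ x y, v (x, y) = F 0 0 x y)
    (hvc : ContinuousOn v OmegaBar) :
    PartialBound (0, 1) (v - lagrangeInterp k N X Y v)
      (derivConst k C₀ K / N ^ (2 * k) * (ρ₂ + 1)) := by
  have key := partialBound_interp_fst (v := fun z => v z.swap) hk hP.swap hF.swap hC₀ hK h₂ h₁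
    hY hX hN (fun x y => hv y x) (hvc.comp continuous_swap.continuousOn fun z hz => ⟨hz.2, hz.1⟩)
  refine PartialBound.of_swap ?_
  convert key using 1
  funext z
  simp only [Pi.sub_apply, lagrangeInterp_swap hk]

/-- The constant in `energyBound_interp`. -/
noncomputable def interpConst (k : ℕ) (C₀ K : ℝ) : ℝ :=
  ((1 + lebesgueConst k) ^ 2 * C₀ * K ^ (k + 1)) ^ 2

theorem energyBound_interp {ε : ℝ} (hk : 1 ≤ k) (hP : HasPartials (k + 1) F)
    (hF : ProductBound k F C₀ ρ₁ w₁ ρ₂ w₂) (hC₀ : 0 ≤ C₀) (hK : 0 < K)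
    (h₁ : Profile k N X ρ₁ w₁ q₁ K) (h₂ : Profile k N Y ρ₂ w₂ q₂ K)
    (hX : UnitMesh N X) (hY : UnitMesh N Y) (hN : 0 < N) (hv : ∀ x y, v (x, y) = F 0 0 x y)
    (hvc : ContinuousOn v OmegaBar) :
    l2NormSq (v - lagrangeInterp k N X Y v) ≤ interpConst k C₀ K * ((N : ℝ) ^ (2 * (k + 1)))⁻¹ ∧
    EnergyBound ε (v - lagrangeInterp k N X Y v)
      (derivConst k C₀ K * (ε * (ρ₁ + ρ₂ + 2)) * ((N : ℝ) ^ (2 * k))⁻¹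
        + interpConst k C₀ K * ((N : ℝ) ^ (2 * (k + 1)))⁻¹) := by
  have hmem : MemL2 (v - lagrangeInterp k N X Y v) :=
    memL2_of_continuousOn (hvc.sub (continuousOn_lagrangeInterp hk hX hY v))
  have hl2 : l2NormSq (v - lagrangeInterp k N X Y v)
      ≤ interpConst k C₀ K * ((N : ℝ) ^ (2 * (k + 1)))⁻¹ := by
    refine (l2NormSq_le_of_abs_le (fun z hz => abs_interp_error_le hk hP hF hC₀ h₁ h₂ hX hY hN hv
      (Omega_subset hz)) hmem).trans (le_of_eq ?_)
    rw [interpConst, div_pow]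
    ring
  refine ⟨hl2, hmem, _, _, partialBound_interp_fst hk hP hF hC₀ hK h₁ h₂ hX hY hN hv hvc,
    partialBound_interp_snd hk hP hF hC₀ hK h₁ h₂ hX hY hN hv hvc, ?_⟩
  refine add_le_add (le_of_eq ?_) hl2
  ring

/-! ## Inverse estimates -/

/-- The bound $A_i$ may vary with the column, so that columns where the spline vanishes contribute
nothing. Integrating the squared inverse estimate $(A_i/h_i)^2$ over a column leaves $A_i^2/h_i$. -/
theorem partialBound_tensorSpline_fst (hk : 1 ≤ k) (hX : UnitMesh N X) (hY : UnitMesh N Y)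
    (hN : 0 < N) {c : ℕ → ℕ → ℝ} {A : ℕ → ℝ}
    (hc : ∀ i < N, ∀ m ∈ Finset.Icc (i * k) (i * k + k), ∀ j < N,
      ∀ n ∈ Finset.Icc (j * k) (j * k + k), |c m n| ≤ A i) :
    PartialBound (1, 0) (tensorSpline k N X Y c)
      (∑ i ∈ Finset.range N, lebesgueConst k ^ 4 * A i ^ 2 / (X (i + 1) - X i)) := by
  refine partialBound_fst hX hN (continuousOn_tensorSpline hk hX hY c)
    (B := fun i _ => (lebesgueConst k * (lebesgueConst k * A i) / (X (i + 1) - X i)) ^ 2)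
    (fun i _ => continuous_const) (fun i hi => ?_) fun i hi x hx y hy => ?_
  · have := sub_pos.mpr (hX.lt i hi)
    rw [intervalIntegral.integral_const, smul_eq_mul]
    refine le_of_eq ?_
    field_simp
  · obtain ⟨j, hj, hyj⟩ := hY.exists_cell hN (Ioo_subset_Icc_self hy)
    refine ⟨(cellTensor k X Y i j c y).derivative.eval x, ?_, ?_⟩
    · refine (Polynomial.hasDerivAt _ x).congr_of_eventuallyEq ?_
      filter_upwards [isOpen_Ioo.mem_nhds hx] with t ht
      exact tensorSpline_of_mem_Icc hk hX hY hi hj (Ioo_subset_Icc_self ht) hyj c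
    · have := (abs_eval_cellTensor_le hk (hX.lt i hi) (hY.lt j hj)
        (fun m hm n hn => hc i hi m hm j hj n hn) (Ioo_subset_Icc_self hx) hyj).2
      exact sq_le_sq' (neg_le_of_abs_le this) (le_of_abs_le this)

theorem abs_tensorSpline_le (hk : 1 ≤ k) (hX : UnitMesh N X) (hY : UnitMesh N Y)
    (hN : 0 < N) {c : ℕ → ℕ → ℝ} {A : ℝ} (hc : ∀ m n, |c m n| ≤ A) {z : ℝ × ℝ}
    (hz : z ∈ OmegaBar) : |tensorSpline k N X Y c z| ≤ lebesgueConst k ^ 2 * A := by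
  obtain ⟨x, y⟩ := z
  obtain ⟨i, hi, hx⟩ := hX.exists_cell hN hz.1
  obtain ⟨j, hj, hy⟩ := hY.exists_cell hN hz.2
  rw [tensorSpline_of_mem_Icc hk hX hY hi hj hx hy]
  refine (abs_eval_cellTensor_le hk (hX.lt i hi) (hY.lt j hj)
    (fun m _ n _ => hc m n) hx hy).1.trans (le_of_eq ?_)
  ring

/-- A piecewise polynomial with small nodal values that vanish away from two columns of cells. -/
theorem energyBound_tensorSpline {ε : ℝ} (hk : 1 ≤ k) (hX : UnitMesh N X)
    (hY : UnitMesh N Y) (hN : 0 < N) {c : ℕ → ℕ → ℝ} {A : ℝ} (hc : ∀ m n, |c m n| ≤ A) {i₀ : ℕ}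
    (hi₀ : i₀ + 1 < N)
    (hc0 : ∀ m, m ∉ Finset.Icc (i₀ * k + 1) (i₀ * k + k) → ∀ n, c m n = 0)
    (hx : 1 ≤ K * ((X (i₀ + 1) - X i₀) * ρ₁)) (hx' : 1 ≤ K * ((X (i₀ + 2) - X (i₀ + 1)) * ρ₁))
    (hy : ∀ j < N, 1 ≤ K * ((Y (j + 1) - Y j) * ρ₂ * N)) :
    l2NormSq (tensorSpline k N X Y c) ≤ lebesgueConst k ^ 4 * A ^ 2 ∧
    EnergyBound ε (tensorSpline k N X Y c)
      (lebesgueConst k ^ 4 * A ^ 2 * (2 * K * (ε * ρ₁) + K * (ε * ρ₂) * N ^ 2 + 1)) := by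
  have hΛ := lebesgueConst_pos hk
  have hA : 0 ≤ A := (abs_nonneg _).trans (hc 0 0)
  have hmem : MemL2 (tensorSpline k N X Y c) :=
    memL2_of_continuousOn (continuousOn_tensorSpline hk hX hY c)
  have hl2 : l2NormSq (tensorSpline k N X Y c) ≤ lebesgueConst k ^ 4 * A ^ 2 := by
    refine (l2NormSq_le_of_abs_le (fun z hz => abs_tensorSpline_le hk hX hY hN hc
      (Omega_subset hz)) hmem).trans (le_of_eq ?_)
    ring
  refine ⟨hl2, hmem, lebesgueConst k ^ 4 * A ^ 2 * (2 * K * ρ₁),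
    lebesgueConst k ^ 4 * A ^ 2 * (K * ρ₂ * N ^ 2), ?_, ?_, ?_⟩
  -- The last admitted node $i_0k+k$ is shared with cell $i_0+1$, while the first node of cell $i_0$
  -- is left out; hence exactly the columns $i_0$ and $i_0+1$ can be nonzero.
  · have h1 := partialBound_tensorSpline_fst hk hX hY hN (c := c)
      (A := fun i => if i = i₀ ∨ i = i₀ + 1 then A else 0) (by
        intro i hi m hm j hj n hn
        split_ifs with h
        · exact hc m n
        · rw [hc0 m ?_ n, abs_zero]
          rw [Finset.mem_Icc] at hm ⊢
          rintro ⟨h1, h2⟩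
          rw [not_or] at h
          rcases lt_or_gt_of_ne h.1 with h3 | h3
          · have := Nat.mul_le_mul_right k (show i + 1 ≤ i₀ by omega)
            rw [add_mul] at this
            omega
          · have := Nat.mul_le_mul_right k (show i₀ + 2 ≤ i by omega)
            rw [add_mul] at this
            omega)
    obtain ⟨g, hg, hgw, hgM⟩ := h1
    refine ⟨g, hg, hgw, hgM.trans ?_⟩
    have hsum : ∑ i ∈ Finset.range N, lebesgueConst k ^ 4 *
          (if i = i₀ ∨ i = i₀ + 1 then A else 0) ^ 2 / (X (i + 1) - X i)
        = ∑ i ∈ ({i₀, i₀ + 1} : Finset ℕ), lebesgueConst k ^ 4 * A ^ 2 / (X (i + 1) - X i) := by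
      refine (Finset.sum_subset_zero_on_sdiff ?_ (fun i hi => ?_) fun i hi => ?_).symm
      · intro i hi
        simp only [Finset.mem_insert, Finset.mem_singleton] at hi
        rw [Finset.mem_range]
        omega
      · simp only [Finset.mem_sdiff, Finset.mem_insert, Finset.mem_singleton] at hi
        rw [if_neg hi.2]
        simp
      · simp only [Finset.mem_insert, Finset.mem_singleton] at hi
        rw [if_pos hi]
    rw [hsum, Finset.sum_pair (by omega)]
    have hinv : ∀ h : ℝ, 0 < h → 1 ≤ K * (h * ρ₁) →
        lebesgueConst k ^ 4 * A ^ 2 / h ≤ lebesgueConst k ^ 4 * A ^ 2 * (K * ρ₁) := by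
      intro h hh h1
      rw [div_eq_mul_inv]
      gcongr
      rw [inv_le_iff_one_le_mul₀ hh]
      linarith
    have a1 := hinv _ (sub_pos.mpr (hX.lt i₀ (by omega))) hx
    have a2 := hinv _ (sub_pos.mpr (hX.lt (i₀ + 1) (by omega))) hx'
    linarith
  -- In $y$ all $N$ rows contribute, each with $h^{-1}\le K\rho_2N$, which produces the factor
  -- $N^2$.
  · refine PartialBound.of_swap ?_
    have h1 := partialBound_tensorSpline_fst hk hY hX hN (c := fun m n => c n m)
      (A := fun _ => A) (fun i hi m hm j hj n hn => hc n m)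
    obtain ⟨g, hg, hgw, hgM⟩ := h1
    simp only [tensorSpline_swap]
    refine ⟨g, hg, hgw, hgM.trans ?_⟩
    calc _ ≤ ∑ _i ∈ Finset.range N, lebesgueConst k ^ 4 * A ^ 2 * (K * ρ₂ * N) := by
          refine Finset.sum_le_sum fun i hi => ?_
          have hh := sub_pos.mpr (hY.lt i (Finset.mem_range.mp hi))
          have h1 := hy i (Finset.mem_range.mp hi)
          rw [div_eq_mul_inv]
          gcongr
          rw [inv_le_iff_one_le_mul₀ hh]
          linarith
      _ = _ := by
          rw [Finset.sum_const, Finset.card_range, nsmul_eq_mul]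
          ring
  · have : 0 ≤ lebesgueConst k ^ 4 * A ^ 2 := by positivity
    linarith

end

/-! ## The Bakhvalov-type mesh -/

/-- The Bakhvalov-type mesh with `4 n` cells for layers of widths `ρ₀⁻¹` at `0` and `ρ₁⁻¹`
at `1`. -/
noncomputable def bakhvalov (n : ℕ) (a ρ₀ ρ₁ : ℝ) (i : ℕ) : ℝ :=
  if i ≤ n then a / ρ₀ * meshGen ρ₀⁻¹ ((i : ℝ) / (4 * n : ℕ))
  else if i ≤ 3 * n then a / ρ₀ * Real.log ρ₀
    + 2 * ((i : ℝ) / (4 * n : ℕ) - 1 / 4) * (1 - a / ρ₀ * Real.log ρ₀ - a / ρ₁ * Real.log ρ₁)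
  else 1 - a / ρ₁ * meshGen ρ₁⁻¹ (1 - (i : ℝ) / (4 * n : ℕ))

theorem meshX_eq_bakhvalov (n : ℕ) (τ p μ₀ μ₁ : ℝ) :
    meshX (4 * n) τ p μ₀ μ₁ = bakhvalov n (τ / p) μ₀ μ₁ := by
  funext i
  have h1 : 4 * n / 4 = n := by omega
  have h2 : 3 * (4 * n) / 4 = 3 * n := by omega
  simp only [meshX, bakhvalov, sigmaX, h1, h2, div_div]

theorem meshY_eq_bakhvalov (n : ℕ) (τ δ ε : ℝ) :
    meshY (4 * n) τ δ ε = bakhvalov n (τ / δ) (1 / Real.sqrt ε) (1 / Real.sqrt ε) := by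
  funext i
  have h1 : 4 * n / 4 = n := by omega
  have h2 : 3 * (4 * n) / 4 = 3 * n := by omega
  have h3 : τ / δ / (1 / Real.sqrt ε) = τ / δ * Real.sqrt ε := by rw [div_div_eq_mul_div, div_one]
  have h4 : (1 / Real.sqrt ε)⁻¹ = Real.sqrt ε := by rw [one_div, inv_inv]
  simp only [meshY, bakhvalov, sigmaY, h1, h2, h3, h4]
  split_ifs
  · rfl
  · ring
  · rfl

/-- Conditions under which the mesh resolves the layers, and a constant `K` that is large
enough. -/
structure MeshData (n : ℕ) (a κ τ θ K₁ K ρ₀ ρ₁ : ℝ) : Prop where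
  two_le : 2 ≤ n
  a_pos : 0 < a
  κ_pos : 0 < κ
  mul_eq : κ * a = τ
  θ_pos : 0 < θ
  pos₀ : 0 < ρ₀
  pos₁ : 0 < ρ₁
  gap₀ : θ ≤ 1 - ρ₀⁻¹
  gap₁ : θ ≤ 1 - ρ₁⁻¹
  res₀ : ρ₀⁻¹ ≤ K₁ / (4 * n : ℕ)
  res₁ : ρ₁⁻¹ ≤ K₁ / (4 * n : ℕ)
  transition₀ : a / ρ₀ * Real.log ρ₀ ≤ 1 / 4
  transition₁ : a / ρ₁ * Real.log ρ₁ ≤ 1 / 4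
  K_ge₁ : 8 * a ≤ K
  K_ge₂ : K₁ + 8 ≤ K
  K_ge₃ : K₁ + 8 ≤ K * (4 * a * θ)
  K_ge₄ : 1 ≤ 2 * κ * K

section

variable {n : ℕ} {a κ τ θ K₁ K ρ₀ ρ₁ : ℝ}

theorem MeshData.swap (h : MeshData n a κ τ θ K₁ K ρ₀ ρ₁) : MeshData n a κ τ θ K₁ K ρ₁ ρ₀ :=
  { h with
    pos₀ := h.pos₁, pos₁ := h.pos₀, gap₀ := h.gap₁, gap₁ := h.gap₀, res₀ := h.res₁,
    res₁ := h.res₀, transition₀ := h.transition₁, transition₁ := h.transition₀ }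

/-- The values of the layer function `exp (-ρ t / a)` at the mesh points near `0`. -/
noncomputable def layerValue (n : ℕ) (ρ : ℝ) (i : ℕ) : ℝ := 1 - (1 - ρ⁻¹) * ((i : ℝ) / n)

theorem MeshData.n_pos (h : MeshData n a κ τ θ K₁ K ρ₀ ρ₁) : (0 : ℝ) < n := by
  have := h.two_le
  exact_mod_cast (by omega : 0 < n)

theorem MeshData.K₁_pos (h : MeshData n a κ τ θ K₁ K ρ₀ ρ₁) : 0 < K₁ := by
  have h1 := h.res₀
  have h2 := inv_pos.mpr h.pos₀
  have h3 : (0 : ℝ) < (4 * n : ℕ) := by have := h.n_pos; push_cast; linarith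
  by_contra hK
  have : K₁ / (4 * n : ℕ) ≤ 0 := div_nonpos_of_nonpos_of_nonneg (not_lt.mp hK) h3.le
  linarith

theorem MeshData.one_lt (h : MeshData n a κ τ θ K₁ K ρ₀ ρ₁) : 1 < ρ₀ := by
  have h1 := h.gap₀
  have h2 := h.θ_pos
  have h3 : ρ₀⁻¹ < 1 := by linarith
  exact (inv_lt_one₀ h.pos₀).mp h3

theorem MeshData.layerValue_ge (h : MeshData n a κ τ θ K₁ K ρ₀ ρ₁) {i : ℕ} (hi : i ≤ n) :
    ρ₀⁻¹ ≤ layerValue n ρ₀ i := by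
  have hn := h.n_pos
  have h1 : (i : ℝ) / n ≤ 1 := by rw [div_le_one hn]; exact_mod_cast hi
  have h2 := h.gap₀
  have h3 := h.θ_pos
  unfold layerValue
  nlinarith

theorem MeshData.layerValue_pos (h : MeshData n a κ τ θ K₁ K ρ₀ ρ₁) {i : ℕ} (hi : i ≤ n) :
    0 < layerValue n ρ₀ i :=
  (inv_pos.mpr h.pos₀).trans_le (h.layerValue_ge hi)

theorem MeshData.layerValue_le_one (h : MeshData n a κ τ θ K₁ K ρ₀ ρ₁) (i : ℕ) :
    layerValue n ρ₀ i ≤ 1 := by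
  have h2 := h.gap₀
  have h3 := h.θ_pos
  have : 0 ≤ (i : ℝ) / n := by positivity
  unfold layerValue
  nlinarith

theorem MeshData.layerValue_self (h : MeshData n a κ τ θ K₁ K ρ₀ ρ₁) :
    layerValue n ρ₀ n = ρ₀⁻¹ := by
  unfold layerValue
  rw [div_self h.n_pos.ne']
  ring

/-- The principle of the Bakhvalov mesh: this quantity drops by the same amount over every layer
cell. -/
theorem layerValue_sub (n : ℕ) (ρ : ℝ) (i : ℕ) :
    layerValue n ρ i - layerValue n ρ (i + 1) = (1 - ρ⁻¹) / n := by
  unfold layerValue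
  push_cast
  ring

theorem MeshData.left (h : MeshData n a κ τ θ K₁ K ρ₀ ρ₁) {i : ℕ} (hi : i ≤ n) :
    bakhvalov n a ρ₀ ρ₁ i = -(a / ρ₀ * Real.log (layerValue n ρ₀ i)) := by
  have hn := h.n_pos
  rw [bakhvalov, if_pos hi, meshGen, layerValue]
  have : 1 - 4 * (1 - ρ₀⁻¹) * ((i : ℝ) / (4 * n : ℕ)) = 1 - (1 - ρ₀⁻¹) * ((i : ℝ) / n) := by
    push_cast
    field_simp
  rw [this]
  ring

/-- Includes $i=n$, although the definition uses the layer branch there: both formulas give the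
transition point $(a/\rho_0)\ln\rho_0$. -/
theorem MeshData.middle (h : MeshData n a κ τ θ K₁ K ρ₀ ρ₁) {i : ℕ} (hi : n ≤ i)
    (hi' : i ≤ 3 * n) :
    bakhvalov n a ρ₀ ρ₁ i = a / ρ₀ * Real.log ρ₀
      + 2 * ((i : ℝ) / (4 * n : ℕ) - 1 / 4)
        * (1 - a / ρ₀ * Real.log ρ₀ - a / ρ₁ * Real.log ρ₁) := by
  rcases hi.eq_or_lt with rfl | hlt
  · have hn := h.n_pos
    rw [h.left le_rfl, h.layerValue_self, Real.log_inv]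
    have : (n : ℝ) / (4 * n : ℕ) = 1 / 4 := by push_cast; field_simp
    rw [this]
    ring
  · rw [bakhvalov, if_neg (by omega), if_pos hi']

/-- Carries all statements about the layer at $0$ over to the layer at $1$ by interchanging the
rates. The cases $i=n$ and $i=3n$ are separate because the branch conditions are not symmetric. -/
theorem MeshData.reflect (h : MeshData n a κ τ θ K₁ K ρ₀ ρ₁) {i : ℕ} (hi : i ≤ 4 * n) :
    bakhvalov n a ρ₀ ρ₁ i = 1 - bakhvalov n a ρ₁ ρ₀ (4 * n - i) := by
  have hn := h.n_pos
  have e : (((4 * n - i : ℕ) : ℝ)) / (4 * n : ℕ) = 1 - (i : ℝ) / (4 * n : ℕ) := by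
    rw [Nat.cast_sub hi]
    push_cast
    field_simp
  rcases le_total (3 * n) i with h3 | h3
  · rcases h3.eq_or_lt with rfl | hlt
    · rw [h.middle (by omega) le_rfl, h.swap.middle (by omega) (by omega), e]
      have : ((3 * n : ℕ) : ℝ) / (4 * n : ℕ) = 3 / 4 := by push_cast; field_simp
      rw [this]
      ring
    · rw [bakhvalov, if_neg (by omega), if_neg (by omega), bakhvalov, if_pos (by omega), e]
  · rcases le_total n i with h1 | h1
    · rw [h.middle h1 h3, h.swap.middle (by omega) (by omega), e]
      ring
    · rcases h1.eq_or_lt with rfl | hlt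
      · rw [h.middle le_rfl h3, h.swap.middle (by omega) (by omega), e]
        ring
      · rw [bakhvalov, if_pos h1, bakhvalov, if_neg (by omega), if_neg (by omega), e]
        ring_nf

/-- The length is $(a/\rho_0)\ln(Q_i/Q_{i+1})$, and $1-s^{-1}\le\ln s\le s-1$. -/
theorem MeshData.left_length (h : MeshData n a κ τ θ K₁ K ρ₀ ρ₁) {i : ℕ} (hi : i < n) :
    a / ρ₀ * ((1 - ρ₀⁻¹) / n / layerValue n ρ₀ i)
      ≤ bakhvalov n a ρ₀ ρ₁ (i + 1) - bakhvalov n a ρ₀ ρ₁ i ∧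
    bakhvalov n a ρ₀ ρ₁ (i + 1) - bakhvalov n a ρ₀ ρ₁ i
      ≤ a / ρ₀ * ((1 - ρ₀⁻¹) / n / layerValue n ρ₀ (i + 1)) := by
  have h0 := h.layerValue_pos hi.le
  have h1 := h.layerValue_pos (i := i + 1) hi
  have ha := div_pos h.a_pos h.pos₀
  have e : bakhvalov n a ρ₀ ρ₁ (i + 1) - bakhvalov n a ρ₀ ρ₁ i
      = a / ρ₀ * Real.log (layerValue n ρ₀ i / layerValue n ρ₀ (i + 1)) := by
    rw [h.left hi.le, h.left (i := i + 1) hi, Real.log_div h0.ne' h1.ne']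
    ring
  rw [e, ← layerValue_sub n ρ₀ i, sub_div, sub_div, div_self h0.ne', div_self h1.ne']
  constructor
  · gcongr
    have := Real.one_sub_inv_le_log_of_pos (div_pos h0 h1)
    rwa [inv_div] at this
  · gcongr
    exact Real.log_le_sub_one_of_pos (div_pos h0 h1)

/-- Both transition widths lie in $[0,\tfrac14]$, so the middle interval has length between
$\tfrac12$ and $1$ and is cut into $N/2$ equal cells. -/
theorem MeshData.middle_length (h : MeshData n a κ τ θ K₁ K ρ₀ ρ₁) {i : ℕ} (hi : n ≤ i)
    (hi' : i < 3 * n) :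
    1 / (4 * n : ℕ) ≤ bakhvalov n a ρ₀ ρ₁ (i + 1) - bakhvalov n a ρ₀ ρ₁ i ∧
    bakhvalov n a ρ₀ ρ₁ (i + 1) - bakhvalov n a ρ₀ ρ₁ i ≤ 2 / (4 * n : ℕ) := by
  have hn := h.n_pos
  have hN : (0 : ℝ) < (4 * n : ℕ) := by push_cast; linarith
  have e : bakhvalov n a ρ₀ ρ₁ (i + 1) - bakhvalov n a ρ₀ ρ₁ i
      = 2 * (1 - a / ρ₀ * Real.log ρ₀ - a / ρ₁ * Real.log ρ₁) / (4 * n : ℕ) := by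
    rw [h.middle hi hi'.le, h.middle (i := i + 1) (by omega) hi']
    push_cast
    ring
  have t0 := h.transition₀
  have t1 := h.transition₁
  have s0 : 0 ≤ a / ρ₀ * Real.log ρ₀ :=
    mul_nonneg (div_pos h.a_pos h.pos₀).le (Real.log_nonneg h.one_lt.le)
  have s1 : 0 ≤ a / ρ₁ * Real.log ρ₁ :=
    mul_nonneg (div_pos h.a_pos h.pos₁).le (Real.log_nonneg h.swap.one_lt.le)
  rw [e]
  constructor <;> gcongr <;> linarith

theorem MeshData.right_length (h : MeshData n a κ τ θ K₁ K ρ₀ ρ₁) {i : ℕ} (hi : i < 4 * n) :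
    bakhvalov n a ρ₀ ρ₁ (i + 1) - bakhvalov n a ρ₀ ρ₁ i
      = bakhvalov n a ρ₁ ρ₀ (4 * n - 1 - i + 1) - bakhvalov n a ρ₁ ρ₀ (4 * n - 1 - i) := by
  rw [h.reflect hi.le, h.reflect (i := i + 1) hi,
    show 4 * n - (i + 1) = 4 * n - 1 - i by omega, show 4 * n - i = 4 * n - 1 - i + 1 by omega]
  ring

theorem MeshData.length_left_pos (h : MeshData n a κ τ θ K₁ K ρ₀ ρ₁) {i : ℕ} (hi : i < n) :
    0 < bakhvalov n a ρ₀ ρ₁ (i + 1) - bakhvalov n a ρ₀ ρ₁ i := by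
  refine lt_of_lt_of_le ?_ (h.left_length hi).1
  have h1 : 0 < 1 - ρ₀⁻¹ := h.θ_pos.trans_le h.gap₀
  exact mul_pos (div_pos h.a_pos h.pos₀) (div_pos (div_pos h1 h.n_pos) (h.layerValue_pos hi.le))

theorem MeshData.unitMesh (h : MeshData n a κ τ θ K₁ K ρ₀ ρ₁) :
    UnitMesh (4 * n) (bakhvalov n a ρ₀ ρ₁) := by
  have z : ∀ {ρ₀ ρ₁ : ℝ}, MeshData n a κ τ θ K₁ K ρ₀ ρ₁ → bakhvalov n a ρ₀ ρ₁ 0 = 0 := by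
    intro ρ₀ ρ₁ h
    rw [h.left (Nat.zero_le n)]
    simp [layerValue]
  refine ⟨z h, ?_, fun i hi => ?_⟩
  · rw [h.reflect le_rfl, Nat.sub_self, z h.swap, sub_zero]
  · rw [← sub_pos]
    rcases lt_or_ge i n with h1 | h1
    · exact h.length_left_pos h1
    · rcases lt_or_ge i (3 * n) with h2 | h2
      · refine lt_of_lt_of_le ?_ (h.middle_length h1 h2).1
        have := h.n_pos
        push_cast
        positivity
      · rw [h.right_length hi]
        exact h.swap.length_left_pos (by omega)

theorem MeshData.length_left_le (h : MeshData n a κ τ θ K₁ K ρ₀ ρ₁) {i : ℕ} (hi : i < n) :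
    bakhvalov n a ρ₀ ρ₁ (i + 1) - bakhvalov n a ρ₀ ρ₁ i ≤ 4 * a / (4 * n : ℕ) := by
  have hn := h.n_pos
  have hρ := h.pos₀
  have ha := h.a_pos
  have h1 : 0 < 1 - ρ₀⁻¹ := h.θ_pos.trans_le h.gap₀
  have h2 : 1 - ρ₀⁻¹ ≤ 1 := by linarith [inv_pos.mpr hρ]
  refine (h.left_length hi).2.trans ?_
  calc a / ρ₀ * ((1 - ρ₀⁻¹) / n / layerValue n ρ₀ (i + 1))
      ≤ a / ρ₀ * (1 / n / ρ₀⁻¹) := by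
        have := h.layerValue_ge (i := i + 1) hi
        have := inv_pos.mpr hρ
        gcongr
    _ = _ := by push_cast; field_simp

theorem MeshData.length_le (h : MeshData n a κ τ θ K₁ K ρ₀ ρ₁) {i : ℕ} (hi : i < 4 * n) :
    bakhvalov n a ρ₀ ρ₁ (i + 1) - bakhvalov n a ρ₀ ρ₁ i ≤ K / (4 * n : ℕ) := by
  have ha := h.a_pos
  have h1 := h.K_ge₁
  have h2 := h.K_ge₂
  have h3 := h.K₁_pos
  rcases lt_or_ge i n with h4 | h4
  · exact (h.length_left_le h4).trans (by gcongr; linarith)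
  · rcases lt_or_ge i (3 * n) with h5 | h5
    · exact (h.middle_length h4 h5).2.trans (by gcongr; linarith)
    · rw [h.right_length hi]
      exact (h.swap.length_left_le (by omega)).trans (by gcongr; linarith)

theorem MeshData.K_pos (h : MeshData n a κ τ θ K₁ K ρ₀ ρ₁) : 0 < K := by
  linarith [h.K_ge₁, h.a_pos]

/-- Used with two values of $q$: with $(K_1+8)/N$ near the transition, where the last factor becomes
$1$, and with $1$ elsewhere, where it is of size $N$. -/
theorem MeshData.length_left_ge (h : MeshData n a κ τ θ K₁ K ρ₀ ρ₁) {i : ℕ} (hi : i < n) {q : ℝ}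
    (hq : layerValue n ρ₀ i ≤ q) :
    1 ≤ K * ((bakhvalov n a ρ₀ ρ₁ (i + 1) - bakhvalov n a ρ₀ ρ₁ i) * ρ₀)
        * (q * (4 * n : ℕ) / (K₁ + 8)) := by
  have hn := h.n_pos
  have hρ := h.pos₀
  have ha := h.a_pos
  have hK := h.K_pos
  have hK₁ := h.K₁_pos
  have hQ := h.layerValue_pos hi.le
  have hq0 := hQ.trans_le hq
  have h3 := h.K_ge₃
  have hθ := h.θ_pos
  calc 1 ≤ K * (4 * a * θ) / (K₁ + 8) := by rw [le_div_iff₀ (by linarith)]; linarith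
    _ = K * ((a / ρ₀ * (θ / n / q)) * ρ₀) * (q * (4 * n : ℕ) / (K₁ + 8)) := by
        push_cast; field_simp
    _ ≤ K * ((a / ρ₀ * ((1 - ρ₀⁻¹) / n / layerValue n ρ₀ i)) * ρ₀)
        * (q * (4 * n : ℕ) / (K₁ + 8)) := by
        have := h.gap₀
        have : 0 ≤ 1 - ρ₀⁻¹ := by linarith
        gcongr
    _ ≤ _ := by
        have := (h.left_length hi).1
        gcongr

/-- At most two drops, each at most $1/n=4/N$, separate the value from $\rho_0^{-1}\le K_1/N$. -/
theorem MeshData.layerValue_le (h : MeshData n a κ τ θ K₁ K ρ₀ ρ₁) {i : ℕ} (hi : i ≤ n)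
    (hi' : n ≤ i + 2) : layerValue n ρ₀ i ≤ (K₁ + 8) / (4 * n : ℕ) := by
  have hn := h.n_pos
  have hρ := inv_pos.mpr h.pos₀
  have h1 : layerValue n ρ₀ i = ρ₀⁻¹ + (1 - ρ₀⁻¹) * ((n - i : ℝ) / n) := by
    unfold layerValue
    field_simp
    ring
  have h2 : (n - i : ℝ) ≤ 2 := by
    have : (n : ℝ) ≤ i + 2 := by exact_mod_cast hi'
    linarith
  have h3 : (0 : ℝ) ≤ n - i := by
    have : (i : ℝ) ≤ n := by exact_mod_cast hi
    linarith
  rw [h1]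
  calc ρ₀⁻¹ + (1 - ρ₀⁻¹) * ((n - i : ℝ) / n) ≤ K₁ / (4 * n : ℕ) + 1 * (2 / n) := by
        have := h.res₀
        have : 1 - ρ₀⁻¹ ≤ 1 := by linarith
        gcongr
    _ = _ := by push_cast; field_simp; ring

/-- The length of the last two cells of the layer region. -/
theorem MeshData.transition_length_ge (h : MeshData n a κ τ θ K₁ K ρ₀ ρ₁) {i : ℕ} (hi : i < n)
    (hi' : n ≤ i + 2) :
    1 ≤ K * ((bakhvalov n a ρ₀ ρ₁ (i + 1) - bakhvalov n a ρ₀ ρ₁ i) * ρ₀) := by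
  have hn := h.n_pos
  have hK₁ := h.K₁_pos
  have h1 := h.length_left_ge hi (h.layerValue_le hi.le hi')
  have e : (K₁ + 8) / (4 * n : ℕ) * (4 * n : ℕ) / (K₁ + 8) = 1 := by push_cast; field_simp
  rwa [e, mul_one] at h1

theorem MeshData.length_ge_aux (h : MeshData n a κ τ θ K₁ K ρ₀ ρ₁) {i : ℕ} (hi : i < n) :
    1 ≤ K * ((bakhvalov n a ρ₀ ρ₁ (i + 1) - bakhvalov n a ρ₀ ρ₁ i) * ρ₀ * (4 * n : ℕ)) := by
  have hK₁ := h.K₁_pos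
  have hl := h.length_left_pos hi
  have hρ := h.pos₀
  have hK := h.K_pos
  refine (h.length_left_ge hi (h.layerValue_le_one i)).trans ?_
  calc K * ((bakhvalov n a ρ₀ ρ₁ (i + 1) - bakhvalov n a ρ₀ ρ₁ i) * ρ₀)
        * (1 * (4 * n : ℕ) / (K₁ + 8))
      ≤ K * ((bakhvalov n a ρ₀ ρ₁ (i + 1) - bakhvalov n a ρ₀ ρ₁ i) * ρ₀)
        * (1 * (4 * n : ℕ) / 1) := by gcongr; linarith
    _ = _ := by ring

/-- Equal rates, as on the $y$-mesh, make one lower bound valid on all cells; in the middle it holds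
because $h\ge1/N$ and $\rho>1$. -/
theorem MeshData.length_ge {ρ : ℝ} (h : MeshData n a κ τ θ K₁ K ρ ρ) {i : ℕ} (hi : i < 4 * n) :
    1 ≤ K * ((bakhvalov n a ρ ρ (i + 1) - bakhvalov n a ρ ρ i) * ρ * (4 * n : ℕ)) := by
  rcases lt_or_ge i n with h4 | h4
  · exact h.length_ge_aux h4
  · rcases lt_or_ge i (3 * n) with h5 | h5
    · have h1 := (h.middle_length h4 h5).1
      have hn := h.n_pos
      have hN : (0 : ℝ) < (4 * n : ℕ) := by push_cast; linarith
      rw [div_le_iff₀ hN] at h1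
      have h2 := h.one_lt
      have h3 : 1 ≤ K := by linarith [h.K_ge₂, h.K₁_pos]
      nlinarith [mul_le_mul h1 h2.le zero_le_one (by linarith)]
    · rw [h.right_length hi]
      exact h.length_ge_aux (by omega)

/-- Bounds for the layer function on the cells. -/
noncomputable def layerBound (n : ℕ) (ρ : ℝ) (i : ℕ) : ℝ :=
  if i < n then layerValue n ρ i else ρ⁻¹

theorem MeshData.exp_eq (h : MeshData n a κ τ θ K₁ K ρ₀ ρ₁) {i : ℕ} (hi : i ≤ n) :
    Real.exp (-(κ * ρ₀ * bakhvalov n a ρ₀ ρ₁ i)) = layerValue n ρ₀ i ^ τ := by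
  have hρ := h.pos₀
  rw [h.left hi, Real.rpow_def_of_pos (h.layerValue_pos hi), ← h.mul_eq]
  congr 1
  field_simp

/-- The choice $\tau\ge k+1$ makes the layer at most the $(k+1)$st power of its mesh value. Beyond
the transition point the value $\rho_0^{-1}$ at $x_n$ is used. -/
theorem MeshData.exp_le (h : MeshData n a κ τ θ K₁ K ρ₀ ρ₁) {k : ℕ} (hτ : (k : ℝ) + 1 ≤ τ) {i : ℕ}
    (hi : i < 4 * n) {t : ℝ} (ht : bakhvalov n a ρ₀ ρ₁ i ≤ t) :
    Real.exp (-(κ * ρ₀ * t)) ≤ layerBound n ρ₀ i ^ (k + 1) := by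
  have hρ := h.pos₀
  have hκ := h.κ_pos
  have key : ∀ j ≤ n, bakhvalov n a ρ₀ ρ₁ j ≤ t →
      Real.exp (-(κ * ρ₀ * t)) ≤ layerValue n ρ₀ j ^ (k + 1) := by
    intro j hj hjt
    calc Real.exp (-(κ * ρ₀ * t)) ≤ Real.exp (-(κ * ρ₀ * bakhvalov n a ρ₀ ρ₁ j)) := by gcongr
      _ = layerValue n ρ₀ j ^ τ := h.exp_eq hj
      _ ≤ layerValue n ρ₀ j ^ ((k : ℝ) + 1) :=
        Real.rpow_le_rpow_of_exponent_ge (h.layerValue_pos hj) (h.layerValue_le_one j) hτ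
      _ = _ := by
        rw [← Real.rpow_natCast]
        push_cast
        rfl
  unfold layerBound
  split_ifs with h1
  · exact key i h1.le ht
  · rw [← h.layerValue_self]
    exact key n le_rfl ((h.unitMesh.monotone (not_lt.mp h1) hi.le).trans ht)

/-- The bound does not involve $t-s$, which matters on the transition cell: it can be much longer
than $\rho^{-1}$. -/
theorem integral_exp_sq_le {κ ρ : ℝ} (hκ : 0 < κ) (hρ : 0 < ρ) (s t : ℝ) :
    ρ * ∫ x in s..t, Real.exp (-(κ * ρ * x)) ^ 2 ≤ Real.exp (-(κ * ρ * s)) ^ 2 / (2 * κ) := by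
  have hint : ∫ x in s..t, Real.exp (-(κ * ρ * x)) ^ 2
      = -(Real.exp (-(κ * ρ * t)) ^ 2 / (2 * κ * ρ))
        - -(Real.exp (-(κ * ρ * s)) ^ 2 / (2 * κ * ρ)) := by
    refine intervalIntegral.integral_eq_sub_of_hasDerivAt
      (f := fun x => -(Real.exp (-(κ * ρ * x)) ^ 2 / (2 * κ * ρ))) (fun x _ => ?_)
      ((by fun_prop : Continuous fun x => Real.exp (-(κ * ρ * x)) ^ 2).intervalIntegrable _ _)
    have h1 : HasDerivAt (fun x => -(κ * ρ * x)) (-(κ * ρ * 1)) x :=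
      ((hasDerivAt_id x).const_mul (κ * ρ)).neg
    refine HasDerivAt.congr_deriv (f := fun x => -(Real.exp (-(κ * ρ * x)) ^ 2 / (2 * κ * ρ)))
      ((h1.exp.pow 2).div_const (2 * κ * ρ)).neg ?_
    push_cast
    field_simp
  rw [hint]
  have h2 : 0 ≤ Real.exp (-(κ * ρ * t)) ^ 2 / (2 * κ) := by positivity
  have h3 : ρ * (-(Real.exp (-(κ * ρ * t)) ^ 2 / (2 * κ * ρ))
        - -(Real.exp (-(κ * ρ * s)) ^ 2 / (2 * κ * ρ)))
      = Real.exp (-(κ * ρ * s)) ^ 2 / (2 * κ) - Real.exp (-(κ * ρ * t)) ^ 2 / (2 * κ) := by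
    field_simp
    ring
  rw [h3]
  linarith

theorem MeshData.layerBound_nonneg (h : MeshData n a κ τ θ K₁ K ρ₀ ρ₁) (i : ℕ) :
    0 ≤ layerBound n ρ₀ i := by
  unfold layerBound
  split_ifs with h1
  · exact (h.layerValue_pos h1.le).le
  · exact (inv_pos.mpr h.pos₀).le

theorem MeshData.profile_left (h : MeshData n a κ τ θ K₁ K ρ₀ ρ₁) {k : ℕ}
    (hτ : (k : ℝ) + 1 ≤ τ) :
    Profile k (4 * n) (bakhvalov n a ρ₀ ρ₁) ρ₀ (fun t => Real.exp (-(κ * ρ₀ * t)))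
      (layerBound n ρ₀) K := by
  have hn := h.n_pos
  have hρ := h.pos₀
  have ha := h.a_pos
  have hκ := h.κ_pos
  have hK₁ := h.K₁_pos
  refine ⟨h.pos₀, fun i _ => h.layerBound_nonneg i, fun i _ => ?_, fun t => (Real.exp_pos _).le,
    by fun_prop, fun i hi t ht => h.exp_le hτ hi ht.1, fun i hi => ?_⟩
  · unfold layerBound
    split_ifs with h1
    · exact h.layerValue_le_one i
    · exact inv_le_one_of_one_le₀ h.one_lt.le
  · rcases lt_or_ge i n with h1 | h1
    · have hq : layerBound n ρ₀ i = layerValue n ρ₀ i := if_pos h1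
      rcases lt_or_ge (i + 1) n with h2 | h2
      · left
        have hQ := h.layerValue_pos (i := i + 1) h2.le
        have hQ0 := h.layerValue_pos h1.le
        have hgap : 0 < 1 - ρ₀⁻¹ := h.θ_pos.trans_le h.gap₀
        -- Since $i+2\le n$, the value at $i+2$ is still positive, so one drop is at most $Q_{i+1}$
        -- and $Q_i\le2Q_{i+1}$. This comparison can fail on the last layer cell.
        have hd : (1 - ρ₀⁻¹) / n ≤ layerValue n ρ₀ (i + 1) := by
          have e1 := layerValue_sub n ρ₀ (i + 1)
          have e2 := h.layerValue_pos (i := i + 1 + 1) h2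
          linarith
        have hQ2 : layerValue n ρ₀ i ≤ 2 * layerValue n ρ₀ (i + 1) := by
          have e1 := layerValue_sub n ρ₀ i
          linarith
        rw [hq]
        calc (bakhvalov n a ρ₀ ρ₁ (i + 1) - bakhvalov n a ρ₀ ρ₁ i) * ρ₀ * layerValue n ρ₀ i
            ≤ (a / ρ₀ * ((1 - ρ₀⁻¹) / n / layerValue n ρ₀ (i + 1))) * ρ₀
              * (2 * layerValue n ρ₀ (i + 1)) := by
              have := (h.left_length h1).2
              gcongr
          _ = 8 * a * (1 - ρ₀⁻¹) / (4 * n : ℕ) := by push_cast; field_simp; ring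
          _ ≤ K / (4 * n : ℕ) := by
              gcongr
              have := h.K_ge₁
              have := inv_pos.mpr hρ
              nlinarith
      -- Here $i=n-1$, the last layer cell.
      · right; left
        have hqK : layerBound n ρ₀ i ≤ K / (4 * n : ℕ) := by
          rw [hq]
          refine (h.layerValue_le h1.le (by omega)).trans ?_
          have := h.K_ge₂
          gcongr
        refine ⟨hqK, h.transition_length_ge h1 (by omega), ?_⟩
        refine (integral_exp_sq_le hκ hρ _ _).trans ?_
        have h3 := h.exp_le hτ hi le_rfl
        rw [div_le_iff₀ (by positivity)]
        calc Real.exp (-(κ * ρ₀ * bakhvalov n a ρ₀ ρ₁ i)) ^ 2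
            ≤ (layerBound n ρ₀ i ^ (k + 1)) ^ 2 := by gcongr
          _ = 1 * layerBound n ρ₀ i ^ (2 * (k + 1)) := by rw [one_mul, ← pow_mul]; ring_nf
          _ ≤ 2 * κ * K * layerBound n ρ₀ i ^ (2 * (k + 1)) := by
              have := h.K_ge₄
              have := h.layerBound_nonneg i
              gcongr
          _ = _ := by ring
    -- All cells right of $x_n$, including those of the opposite layer: $q=\rho_0^{-1}$, so
    -- $\rho_0q=1$.
    · right; right
      have hq : layerBound n ρ₀ i = ρ₀⁻¹ := if_neg (not_lt.mpr h1)
      rw [hq, mul_inv_cancel₀ hρ.ne']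
      have h2 := h.K_ge₂
      refine ⟨h.res₀.trans ?_, by linarith⟩
      gcongr
      linarith

theorem Profile.reflect {k N : ℕ} {X X' : ℕ → ℝ} {ρ K : ℝ} {w : ℝ → ℝ} {q : ℕ → ℝ}
    (h : Profile k N X ρ w q K) (hX : ∀ i ≤ N, X' i = 1 - X (N - i)) :
    Profile k N X' ρ (fun t => w (1 - t)) (fun i => q (N - 1 - i)) K := by
  have e0 : ∀ i < N, X' i = 1 - X (N - 1 - i + 1) := fun i hi => by
    rw [hX i hi.le, show N - i = N - 1 - i + 1 by omega]
  have e1 : ∀ i < N, X' (i + 1) = 1 - X (N - 1 - i) := fun i hi => by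
    rw [hX (i + 1) hi, show N - (i + 1) = N - 1 - i by omega]
  refine ⟨h.rate_pos, fun i _ => h.q_nonneg _ (by omega), fun i _ => h.q_le_one _ (by omega),
    fun t => h.w_nonneg _, h.w_cont.comp (by fun_prop), fun i hi t ht => ?_, fun i hi => ?_⟩
  · refine h.w_le _ (by omega) _ ?_
    rw [e0 i hi, e1 i hi] at ht
    constructor <;> linarith [ht.1, ht.2]
  · have hr := h.regime (N - 1 - i) (by omega)
    have el : X' (i + 1) - X' i = X (N - 1 - i + 1) - X (N - 1 - i) := by
      rw [e0 i hi, e1 i hi]; ring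
    have ei : ∫ x in X' i..X' (i + 1), w (1 - x) ^ 2
        = ∫ x in X (N - 1 - i)..X (N - 1 - i + 1), w x ^ 2 := by
      rw [intervalIntegral.integral_comp_sub_left (fun x => w x ^ 2) 1, e0 i hi, e1 i hi,
        sub_sub_cancel, sub_sub_cancel]
    unfold LayerRegime at hr ⊢
    rw [el, ei]
    exact hr

theorem MeshData.profile_right (h : MeshData n a κ τ θ K₁ K ρ₀ ρ₁) {k : ℕ}
    (hτ : (k : ℝ) + 1 ≤ τ) :
    Profile k (4 * n) (bakhvalov n a ρ₀ ρ₁) ρ₁ (fun t => Real.exp (-(κ * ρ₁ * (1 - t))))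
      (fun i => layerBound n ρ₁ (4 * n - 1 - i)) K :=
  (h.swap.profile_left hτ).reflect fun _ hi => h.reflect hi

/-- Lets the smooth part, and the non-layer direction of the one-dimensional layers, be treated as a
resolved layer of rate $1$. -/
theorem MeshData.profile_smooth (h : MeshData n a κ τ θ K₁ K ρ₀ ρ₁) (k : ℕ) :
    Profile k (4 * n) (bakhvalov n a ρ₀ ρ₁) 1 (fun _ => 1) (fun _ => 1) K := by
  refine ⟨one_pos, fun _ _ => zero_le_one, fun _ _ => le_rfl, fun _ => zero_le_one,
    continuous_const, fun _ _ _ _ => by simp, fun i hi => Or.inl ?_⟩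
  rw [mul_one, mul_one]
  exact h.length_le hi

end

/-! ## Partial derivatives on the closed square -/

theorem uniqueDiffOn_OmegaBar : UniqueDiffOn ℝ OmegaBar :=
  (uniqueDiffOn_Icc zero_lt_one).prod (uniqueDiffOn_Icc zero_lt_one)

/-- The derivative of `v` on the closed square in the direction `e`. -/
noncomputable def dirDeriv (e : ℝ × ℝ) (v : ℝ × ℝ → ℝ) (z : ℝ × ℝ) : ℝ :=
  fderivWithin ℝ v OmegaBar z e

theorem contDiffOn_dirDeriv (e : ℝ × ℝ) {v : ℝ × ℝ → ℝ} {m : ℕ}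
    (hv : ContDiffOn ℝ (m + 1 : ℕ) v OmegaBar) : ContDiffOn ℝ m (dirDeriv e v) OmegaBar :=
  (hv.fderivWithin uniqueDiffOn_OmegaBar (by norm_cast)).clm_apply contDiffOn_const

theorem dirDeriv_congr (e : ℝ × ℝ) {v w : ℝ × ℝ → ℝ} (h : EqOn v w OmegaBar) :
    EqOn (dirDeriv e v) (dirDeriv e w) OmegaBar := fun z hz => by
  rw [dirDeriv, dirDeriv, fderivWithin_congr h (h hz)]

theorem hasDerivWithinAt_fst {v : ℝ × ℝ → ℝ} (hv : DifferentiableOn ℝ v OmegaBar) {x y : ℝ}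
    (hx : x ∈ Icc (0 : ℝ) 1) (hy : y ∈ Icc (0 : ℝ) 1) :
    HasDerivWithinAt (fun t => v (t, y)) (dirDeriv (1, 0) v (x, y)) (Icc 0 1) x := by
  have h1 : HasDerivWithinAt (fun t : ℝ => (t, y)) ((1 : ℝ), (0 : ℝ)) (Icc 0 1) x :=
    ((hasDerivAt_id x).prodMk (hasDerivAt_const x y)).hasDerivWithinAt
  have hm : (x, y) ∈ OmegaBar := ⟨hx, hy⟩
  exact (hv (x, y) hm).hasFDerivWithinAt.comp_hasDerivWithinAt (f := fun t : ℝ => (t, y)) x h1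
    fun t ht => ⟨ht, hy⟩

theorem hasDerivWithinAt_snd {v : ℝ × ℝ → ℝ} (hv : DifferentiableOn ℝ v OmegaBar) {x y : ℝ}
    (hx : x ∈ Icc (0 : ℝ) 1) (hy : y ∈ Icc (0 : ℝ) 1) :
    HasDerivWithinAt (fun t => v (x, t)) (dirDeriv (0, 1) v (x, y)) (Icc 0 1) y := by
  have h1 : HasDerivWithinAt (fun t : ℝ => (x, t)) ((0 : ℝ), (1 : ℝ)) (Icc 0 1) y :=
    ((hasDerivAt_const y x).prodMk (hasDerivAt_id y)).hasDerivWithinAt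
  have hm : (x, y) ∈ OmegaBar := ⟨hx, hy⟩
  exact (hv (x, y) hm).hasFDerivWithinAt.comp_hasDerivWithinAt (f := fun t : ℝ => (x, t)) y h1
    fun t ht => ⟨hx, ht⟩

/-- Symmetry of the second derivative persists up to the boundary because each point of the closed
square is a limit of interior points. -/
theorem dirDeriv_comm (e e' : ℝ × ℝ) {v : ℝ × ℝ → ℝ} (hv : ContDiffOn ℝ 2 v OmegaBar) :
    EqOn (dirDeriv e (dirDeriv e' v)) (dirDeriv e' (dirDeriv e v)) OmegaBar := by
  intro z hz
  have hd : DifferentiableWithinAt ℝ (fderivWithin ℝ v OmegaBar) OmegaBar z :=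
    ((hv.fderivWithin uniqueDiffOn_OmegaBar (m := 1) (by norm_num)).differentiableOn
      one_ne_zero) z hz
  have key : ∀ e e' : ℝ × ℝ, dirDeriv e (dirDeriv e' v) z
      = fderivWithin ℝ (fderivWithin ℝ v OmegaBar) OmegaBar z e e' := by
    intro e e'
    have h1 := (hd.hasFDerivWithinAt.clm_apply (hasFDerivWithinAt_const e' z OmegaBar)).fderivWithin
      (uniqueDiffOn_OmegaBar z hz)
    unfold dirDeriv
    rw [h1]
    simp
  have hint : z ∈ closure (interior OmegaBar) := by
    have : interior OmegaBar = Ioo (0 : ℝ) 1 ×ˢ Ioo (0 : ℝ) 1 := by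
      rw [OmegaBar, interior_prod_eq, interior_Icc]
    rw [this, closure_prod_eq, closure_Ioo zero_ne_one]
    exact hz
  rw [key, key]
  exact (hv z hz).isSymmSndFDerivWithinAt (by simp) uniqueDiffOn_OmegaBar hint hz e e'

theorem contDiffOn_iterate_dirDeriv (e : ℝ × ℝ) (i : ℕ) : ∀ {v : ℝ × ℝ → ℝ} {m : ℕ},
    ContDiffOn ℝ (m + i : ℕ) v OmegaBar → ContDiffOn ℝ m ((dirDeriv e)^[i] v) OmegaBar := by
  induction i with
  | zero => intro v m hv; exact hv
  | succ i ih =>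
    intro v m hv
    rw [Function.iterate_succ_apply]
    exact ih (contDiffOn_dirDeriv e hv)

theorem iterate_dirDeriv_comm (e e' : ℝ × ℝ) (i : ℕ) : ∀ {v : ℝ × ℝ → ℝ},
    ContDiffOn ℝ (1 + i : ℕ) v OmegaBar →
    EqOn (dirDeriv e' ((dirDeriv e)^[i] v)) ((dirDeriv e)^[i] (dirDeriv e' v)) OmegaBar := by
  induction i with
  | zero => intro v _; exact fun _ _ => rfl
  | succ i ih =>
    intro v hv
    rw [Function.iterate_succ_apply', Function.iterate_succ_apply']
    have h2 : ContDiffOn ℝ 2 ((dirDeriv e)^[i] v) OmegaBar :=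
      contDiffOn_iterate_dirDeriv e i (m := 2) (by convert hv using 2; omega)
    exact (dirDeriv_comm e' e h2).trans
      (dirDeriv_congr e (ih (hv.of_le (by norm_cast; omega))))

theorem iteratedDerivWithin_eq_of_hasDerivWithinAt {n : ℕ} {G : ℕ → ℝ → ℝ}
    (hG : ∀ j < n, ∀ t ∈ Icc (0 : ℝ) 1, HasDerivWithinAt (G j) (G (j + 1) t) (Icc 0 1) t) :
    ∀ j ≤ n, ∀ t ∈ Icc (0 : ℝ) 1, iteratedDerivWithin j (G 0) (Icc 0 1) t = G j t := by
  intro j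
  induction j with
  | zero => intro _ t _; rw [iteratedDerivWithin_zero]
  | succ j ih =>
    intro hj t ht
    rw [iteratedDerivWithin_succ, derivWithin_congr (fun s hs => ih (by omega) s hs)
      (ih (by omega) t ht)]
    exact (hG j hj t ht).derivWithin (uniqueDiffOn_Icc zero_lt_one t ht)

/-- Passes from the iterated one-variable derivatives `partialD` to iterated directional Fréchet
derivatives, for which the order of differentiation can be exchanged. -/
theorem DerivBound.exists_partials {m : ℕ} {v : ℝ × ℝ → ℝ} {M : ℕ → ℕ → ℝ × ℝ → ℝ}
    (h : DerivBound m v M) : ∃ F : ℕ → ℕ → ℝ → ℝ → ℝ, (∀ x y, v (x, y) = F 0 0 x y) ∧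
      HasPartials m F ∧ ∀ i j, i + j ≤ m → ∀ x ∈ Icc (0 : ℝ) 1, ∀ y ∈ Icc (0 : ℝ) 1,
        |F i j x y| ≤ M i j (x, y) := by
  obtain ⟨hv, hM⟩ := h
  set F : ℕ → ℕ → ℝ → ℝ → ℝ := fun i j x y =>
    (dirDeriv (1, 0))^[i] ((dirDeriv (0, 1))^[j] v) (x, y) with hF
  have hsm : ∀ i j r, i + j + r ≤ m →
      ContDiffOn ℝ r ((dirDeriv (1, 0))^[i] ((dirDeriv (0, 1))^[j] v)) OmegaBar := by
    intro i j r hr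
    refine contDiffOn_iterate_dirDeriv _ _ (contDiffOn_iterate_dirDeriv _ _ ?_)
    exact hv.of_le (by norm_cast; omega)
  have hP : HasPartials m F := by
    refine ⟨fun i j hij x hx y hy => ?_, fun i j hij x hx y hy => ?_⟩
    · have := hasDerivWithinAt_fst ((hsm i j 1 (by omega)).differentiableOn (by simp)) hx hy
      rwa [← Function.iterate_succ_apply' (dirDeriv (1, 0)) i] at this
    · have h1 := hasDerivWithinAt_snd ((hsm i j 1 (by omega)).differentiableOn (by simp)) hx hy
      -- The new $y$-derivative stands outside $\partial_x^i$, but in $F_{i,j+1}$ it stands inside.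
      have h2 := iterate_dirDeriv_comm (1, 0) (0, 1) i (v := (dirDeriv (0, 1))^[j] v)
        (hsm 0 j (1 + i) (by omega)) (show (x, y) ∈ OmegaBar from ⟨hx, hy⟩)
      rw [h2, ← Function.iterate_succ_apply' (dirDeriv (0, 1)) j] at h1
      exact h1
  refine ⟨F, fun x y => rfl, hP, fun i j hij x hx y hy => ?_⟩
  have e : partialD i j v (x, y) = F i j x y := by
    have h1 : EqOn (fun x => iteratedDerivWithin j (fun y => v (x, y)) (Icc 0 1) y)
        (fun x => F 0 j x y) (Icc 0 1) := fun x hx =>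
      iteratedDerivWithin_eq_of_hasDerivWithinAt (n := m) (G := fun l t => F 0 l x t)
        (fun l hl t ht => hP.dy 0 l (by omega) x hx t ht) j (by omega) y hy
    rw [partialD, iteratedDerivWithin_congr h1 hx]
    exact iteratedDerivWithin_eq_of_hasDerivWithinAt (n := m - j) (G := fun l t => F l j t y)
      (fun l hl t ht => hP.dx l j (by omega) t ht y hy) i (by omega) x hx
  rw [← e]
  exact hM i j hij (x, y) ⟨hx, hy⟩

/-! ## Error bounds for the components -/

section

variable {k N : ℕ} {X Y : ℕ → ℝ} {ρ₁ ρ₂ : ℝ} {w₁ w₂ : ℝ → ℝ} {q₁ q₂ : ℕ → ℝ} {K C₀ : ℝ}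
  {v : ℝ × ℝ → ℝ} {ε L σ : ℝ}

theorem EnergyBound.mono {M M' : ℝ} (h : EnergyBound ε v M) (hM : M ≤ M') :
    EnergyBound ε v M' := by
  obtain ⟨hv, a, b, ha, hb, h1⟩ := h
  exact ⟨hv, a, b, ha, hb, h1.trans hM⟩

/-- The square of the right-hand side of the energy norm estimate, up to a factor. -/
noncomputable def rateSq (k N : ℕ) (σ : ℝ) : ℝ :=
  σ * ((N : ℝ) ^ (2 * k))⁻¹ + ((N : ℝ) ^ (2 * (k + 1)))⁻¹

theorem exists_cell_index (hk : 1 ≤ k) (hN : 0 < N) {m : ℕ} (hm : m ∈ Finset.range (N * k + 1)) :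
    ∃ i < N, m ∈ Finset.Icc (i * k) (i * k + k) := by
  rw [Finset.mem_range] at hm
  rcases (Nat.lt_succ_iff.mp hm).lt_or_eq with h | h
  · refine ⟨m / k, Nat.div_lt_of_lt_mul (by rwa [mul_comm]), ?_⟩
    have h1 := Nat.div_add_mod m k
    have h2 := Nat.mod_lt m hk
    rw [mul_comm] at h1
    rw [Finset.mem_Icc]
    omega
  · obtain ⟨l, rfl⟩ : ∃ l, N = l + 1 := ⟨N - 1, by omega⟩
    refine ⟨l, by omega, ?_⟩
    rw [Finset.mem_Icc, h, add_mul]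
    omega

/-- The decomposition of $u$ holds on the closed square only; that is enough because all nodes lie
in it. -/
theorem lagrangeInterp_congr (hk : 1 ≤ k) (hN : 0 < N) (hX : UnitMesh N X) (hY : UnitMesh N Y)
    {v w : ℝ × ℝ → ℝ} (h : ∀ z ∈ OmegaBar, v z = w z) (z : ℝ × ℝ) :
    lagrangeInterp k N X Y v z = lagrangeInterp k N X Y w z := by
  rw [lagrangeInterp_eq hk, lagrangeInterp_eq hk]
  refine Finset.sum_congr rfl fun m hm => Finset.sum_congr rfl fun n hn => ?_
  obtain ⟨i, hi, hmi⟩ := exists_cell_index hk hN hm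
  obtain ⟨j, hj, hnj⟩ := exists_cell_index hk hN hn
  have hz := h (gridNode k X m, gridNode k Y n)
    ⟨hX.cell_subset hi (gridNode_mem_Icc hk (hX.lt i hi).le hmi),
      hY.cell_subset hj (gridNode_mem_Icc hk (hY.lt j hj).le hnj)⟩
  simp only [hz]

theorem lagrangeInterp_add (hk : 1 ≤ k) (v w : ℝ × ℝ → ℝ) (z : ℝ × ℝ) :
    lagrangeInterp k N X Y (fun z => v z + w z) z
      = lagrangeInterp k N X Y v z + lagrangeInterp k N X Y w z := by
  simp only [lagrangeInterp_eq hk, tensorSpline, ← Finset.sum_add_distrib, add_mul]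

/-- The constant for the error of the Lagrange interpolant of a component. -/
noncomputable def compConst (k : ℕ) (C₀ K L : ℝ) : ℝ :=
  derivConst k C₀ K * (4 * L) + interpConst k C₀ K

theorem derivConst_nonneg (k : ℕ) (C₀ : ℝ) (hK : 0 ≤ K) : 0 ≤ derivConst k C₀ K := by
  unfold derivConst
  have : 0 ≤ K ^ (2 * k) := by positivity
  positivity

theorem interpConst_nonneg (k : ℕ) (C₀ K : ℝ) : 0 ≤ interpConst k C₀ K := sq_nonneg _

theorem DerivBound.exists_productBound {M : ℕ → ℕ → ℝ × ℝ → ℝ} (h : DerivBound (k + 1) v M)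
    (hM : ∀ i j z, M i j z = C₀ * ((ρ₁ ^ i * w₁ z.1) * (ρ₂ ^ j * w₂ z.2))) :
    ∃ F : ℕ → ℕ → ℝ → ℝ → ℝ, (∀ x y, v (x, y) = F 0 0 x y) ∧
      HasPartials (k + 1) F ∧ ProductBound k F C₀ ρ₁ w₁ ρ₂ w₂ := by
  obtain ⟨F, h1, h2, h3⟩ := h.exists_partials
  refine ⟨F, h1, h2, fun i j hij x hx y hy => ?_⟩
  have := h3 i j hij x hx y hy
  rwa [hM] at this

theorem component_interp (hk : 1 ≤ k) (hC₀ : 0 ≤ C₀) (hK : 0 < K) (hL : 0 ≤ L) (hσ : 0 ≤ σ)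
    (hX : UnitMesh N X) (hY : UnitMesh N Y) (hN : 0 < N)
    (h₁ : Profile k N X ρ₁ w₁ q₁ K) (h₂ : Profile k N Y ρ₂ w₂ q₂ K)
    (hε₁ : ε * ρ₁ ≤ L * σ) (hε₂ : ε * ρ₂ ≤ L * σ) (hε : ε ≤ L * σ)
    {M : ℕ → ℕ → ℝ × ℝ → ℝ} (h : DerivBound (k + 1) v M)
    (hM : ∀ i j z, M i j z = C₀ * ((ρ₁ ^ i * w₁ z.1) * (ρ₂ ^ j * w₂ z.2))) :
    l2NormSq (v - lagrangeInterp k N X Y v)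
      ≤ compConst k C₀ K L * ((N : ℝ) ^ (2 * (k + 1)))⁻¹ ∧
    EnergyBound ε (v - lagrangeInterp k N X Y v) (compConst k C₀ K L * rateSq k N σ) := by
  obtain ⟨F, hv, hP, hF⟩ := h.exists_productBound hM
  obtain ⟨h3, h4⟩ := energyBound_interp (ε := ε) hk hP hF hC₀ hK h₁ h₂ hX hY hN hv h.1.continuousOn
  have hd := derivConst_nonneg k C₀ hK.le
  have hi := interpConst_nonneg k C₀ K
  have hr : 0 ≤ ((N : ℝ) ^ (2 * (k + 1)))⁻¹ := by positivity
  have hr' : 0 ≤ ((N : ℝ) ^ (2 * k))⁻¹ := by positivity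
  have hdL : 0 ≤ derivConst k C₀ K * (4 * L) := by positivity
  refine ⟨h3.trans ?_, h4.mono ?_⟩
  · rw [compConst]
    gcongr
    linarith
  · rw [compConst, rateSq]
    calc derivConst k C₀ K * (ε * (ρ₁ + ρ₂ + 2)) * ((N : ℝ) ^ (2 * k))⁻¹
          + interpConst k C₀ K * ((N : ℝ) ^ (2 * (k + 1)))⁻¹
        ≤ derivConst k C₀ K * (4 * L * σ) * ((N : ℝ) ^ (2 * k))⁻¹
          + interpConst k C₀ K * ((N : ℝ) ^ (2 * (k + 1)))⁻¹ := by
          -- The four summands $\varepsilon\rho_1,\varepsilon\rho_2,\varepsilon,\varepsilon$ are at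
          -- most $L\sigma$ each.
          have : ε * (ρ₁ + ρ₂ + 2) ≤ 4 * L * σ := by linarith
          gcongr
      _ ≤ _ := by
          have a1 : 0 ≤ derivConst k C₀ K * (4 * L) * ((N : ℝ) ^ (2 * (k + 1)))⁻¹ := by positivity
          have a2 : 0 ≤ interpConst k C₀ K * (σ * ((N : ℝ) ^ (2 * k))⁻¹) := by positivity
          linarith

theorem abs_stripCoeff_le (hk : 1 ≤ k) (hC₀ : 0 ≤ C₀) (hN : 0 < N) (hX : UnitMesh N X)
    (hY : UnitMesh N Y) (h₁ : Profile k N X ρ₁ w₁ q₁ K) (h₂ : Profile k N Y ρ₂ w₂ q₂ K)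
    (hK : 0 < K) (hq : q₁ (3 * N / 4) ≤ K / N)
    {F : ℕ → ℕ → ℝ → ℝ → ℝ} (hv : ∀ x y, v (x, y) = F 0 0 x y)
    (hF : ProductBound k F C₀ ρ₁ w₁ ρ₂ w₂) (m n : ℕ) :
    |stripCoeff k N X Y v m n| ≤ C₀ * (K / N) ^ (k + 1) := by
  unfold stripCoeff
  split_ifs with h
  · have hi : 3 * N / 4 < N := by omega
    have hm : m ∈ Finset.Icc (3 * N / 4 * k) (3 * N / 4 * k + k) := by
      have := Finset.mem_Icc.mp h.1
      rw [Finset.mem_Icc]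
      omega
    obtain ⟨j, hj, hn⟩ := exists_cell_index (m := n) hk hN (by
      have := Finset.mem_Ico.mp h.2
      rw [Finset.mem_range]
      omega)
    rw [hv]
    refine (hF.cell_le hC₀ h₁ h₂ hX hY hi hj (by omega)
      (gridNode_mem_Icc hk (hX.lt _ hi).le hm) (gridNode_mem_Icc hk (hY.lt j hj).le hn)).trans ?_
    rw [pow_zero, pow_zero, one_mul, one_mul]
    have a1 := h₁.q_nonneg _ hi
    have a2 := pow_le_one₀ (n := k + 1) (h₂.q_nonneg j hj) (h₂.q_le_one j hj)
    refine mul_le_mul_of_nonneg_left ?_ hC₀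
    exact (mul_le_of_le_one_right (by positivity) a2).trans (pow_le_pow_left₀ a1 hq _)
  · rw [abs_zero]
    positivity

/-- The constant for the correction `P v - Θ v`. -/
noncomputable def stripConst (k : ℕ) (C₀ K L : ℝ) : ℝ :=
  lebesgueConst k ^ 4 * (C₀ * K ^ (k + 1)) ^ 2 * (3 * K * L + 1)

/-- The rate $\rho$ belongs to the $y$-mesh and need not be the rate $\rho_2$ of the component. For
$E_{11}$ the latter is $1$, yet the inverse estimate in $y$ still sees the fine cells of the
$y$-mesh. -/
theorem component_modInterp (hk : 1 ≤ k) (hC₀ : 0 ≤ C₀) (hK : 0 < K) (hL : 0 ≤ L) (hσ : 0 ≤ σ)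
    (hX : UnitMesh N X) (hY : UnitMesh N Y) (hN : 8 ≤ N)
    (h₁ : Profile k N X ρ₁ w₁ q₁ K) (h₂ : Profile k N Y ρ₂ w₂ q₂ K)
    {ρ : ℝ} (hερ : ε * ρ ≤ L * σ)
    (hε₁ : ε * ρ₁ ≤ L * σ) (hε₂ : ε * ρ₂ ≤ L * σ) (hε : ε ≤ L * σ)
    (hq : q₁ (3 * N / 4) ≤ K / N)
    (hx : 1 ≤ K * ((X (3 * N / 4 + 1) - X (3 * N / 4)) * ρ₁))
    (hx' : 1 ≤ K * ((X (3 * N / 4 + 2) - X (3 * N / 4 + 1)) * ρ₁))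
    (hy : ∀ j < N, 1 ≤ K * ((Y (j + 1) - Y j) * ρ * N))
    {M : ℕ → ℕ → ℝ × ℝ → ℝ} (h : DerivBound (k + 1) v M)
    (hM : ∀ i j z, M i j z = C₀ * ((ρ₁ ^ i * w₁ z.1) * (ρ₂ ^ j * w₂ z.2))) :
    MemL2 (modInterp k N X Y v - v) ∧
    l2NormSq (modInterp k N X Y v - v)
      ≤ (2 * compConst k C₀ K L + 2 * stripConst k C₀ K L) * ((N : ℝ) ^ (2 * (k + 1)))⁻¹ ∧
    EnergyBound ε (v - modInterp k N X Y v)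
      ((2 * compConst k C₀ K L + 2 * stripConst k C₀ K L) * rateSq k N σ) := by
  have hN0 : 0 < N := by omega
  have hNR : (0 : ℝ) < N := by exact_mod_cast hN0
  obtain ⟨F, hv, hP, hF⟩ := h.exists_productBound hM
  obtain ⟨e1, e2⟩ := component_interp hk hC₀ hK hL hσ hX hY hN0 h₁ h₂ hε₁ hε₂ hε h hM
  obtain ⟨s1, s2⟩ := energyBound_tensorSpline (ε := ε) hk hX hY hN0
    (abs_stripCoeff_le hk hC₀ hN0 hX hY h₁ h₂ hK hq hv hF) (i₀ := 3 * N / 4) (by omega)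
    (fun m hm n => if_neg fun h => hm h.1) hx hx' hy
  have hΛ := lebesgueConst_pos hk
  have hA : (C₀ * (K / N) ^ (k + 1)) ^ 2
      = (C₀ * K ^ (k + 1)) ^ 2 * ((N : ℝ) ^ (2 * (k + 1)))⁻¹ := by
    rw [div_pow]
    ring
  -- The $N^2$ of the inverse estimate in $y$ is paid for by the two extra orders in the squared
  -- nodal values.
  have hN2 : ((N : ℝ) ^ (2 * (k + 1)))⁻¹ * (N : ℝ) ^ 2 = ((N : ℝ) ^ (2 * k))⁻¹ := by
    rw [mul_add, pow_add]
    field_simp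
  have hN3 : ((N : ℝ) ^ (2 * (k + 1)))⁻¹ ≤ ((N : ℝ) ^ (2 * k))⁻¹ := by
    have : (1 : ℝ) ≤ N := by exact_mod_cast hN0
    refine inv_anti₀ (by positivity) (pow_le_pow_right₀ this (by omega))
  have hpos : 0 ≤ ((N : ℝ) ^ (2 * (k + 1)))⁻¹ := by positivity
  have hpos' : 0 ≤ ((N : ℝ) ^ (2 * k))⁻¹ := by positivity
  set B := lebesgueConst k ^ 4 * (C₀ * K ^ (k + 1)) ^ 2 with hB
  have hB0 : 0 ≤ B := by positivity
  rw [hA, ← mul_assoc, ← hB] at s1 s2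
  have hKL : 0 ≤ K * L := by positivity
  have s1' : l2NormSq (tensorSpline k N X Y (stripCoeff k N X Y v))
      ≤ stripConst k C₀ K L * ((N : ℝ) ^ (2 * (k + 1)))⁻¹ := by
    refine s1.trans ?_
    rw [stripConst, ← hB]
    gcongr
    exact le_mul_of_one_le_right hB0 (by nlinarith)
  have s2' : EnergyBound ε (tensorSpline k N X Y (stripCoeff k N X Y v))
      (stripConst k C₀ K L * rateSq k N σ) := by
    refine s2.mono ?_
    rw [stripConst, rateSq, ← hB]
    calc B * ((N : ℝ) ^ (2 * (k + 1)))⁻¹ * (2 * K * (ε * ρ₁) + K * (ε * ρ) * N ^ 2 + 1)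
        ≤ B * ((N : ℝ) ^ (2 * (k + 1)))⁻¹ * (2 * K * (L * σ) + K * (L * σ) * N ^ 2 + 1) := by
          gcongr
      _ = B * (2 * K * L * (σ * ((N : ℝ) ^ (2 * (k + 1)))⁻¹)
          + K * L * σ * (((N : ℝ) ^ (2 * (k + 1)))⁻¹ * (N : ℝ) ^ 2)
          + ((N : ℝ) ^ (2 * (k + 1)))⁻¹) := by ring
      _ ≤ B * (2 * K * L * (σ * ((N : ℝ) ^ (2 * k))⁻¹)
          + K * L * σ * ((N : ℝ) ^ (2 * k))⁻¹ + ((N : ℝ) ^ (2 * (k + 1)))⁻¹) := by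
          rw [hN2]
          gcongr
      _ ≤ _ := by
          rw [mul_assoc B]
          refine mul_le_mul_of_nonneg_left ?_ hB0
          have a1 : 0 ≤ K * L * ((N : ℝ) ^ (2 * (k + 1)))⁻¹ := by positivity
          have a2 : 0 ≤ σ * ((N : ℝ) ^ (2 * k))⁻¹ := by positivity
          linarith
  have efun : v - modInterp k N X Y v
      = (v - lagrangeInterp k N X Y v) + tensorSpline k N X Y (stripCoeff k N X Y v) := by
    funext z
    simp only [Pi.sub_apply, Pi.add_apply, modInterp_eq hk hN0]
    ring
  have eneg : modInterp k N X Y v - v = -(v - modInterp k N X Y v) := (neg_sub _ _).symm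
  have esum := e2.add s2'
  refine ⟨?_, ?_, ?_⟩
  · rw [eneg, efun]
    exact MemLp.neg esum.1
  · have : l2NormSq (modInterp k N X Y v - v) = l2NormSq (v - modInterp k N X Y v) := by
      refine integral_congr_ae (Filter.Eventually.of_forall fun z => ?_)
      simp only [Pi.sub_apply]
      ring
    rw [this, efun]
    refine (l2NormSq_add_le e2.1 s2'.1).trans ?_
    linarith
  · rw [efun]
    refine esum.mono (le_of_eq ?_)
    ring

/-- Eight additions, each replacing the accumulated factor $s$ by $2s+2$:
$1,4,10,22,46,94,190,382,766$. -/
theorem energyBound_sum {e₁ e₂ e₃ e₄ e₅ e₆ e₇ e₈ e₉ : ℝ × ℝ → ℝ} {M : ℝ}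
    (h₁ : EnergyBound ε e₁ M) (h₂ : EnergyBound ε e₂ M) (h₃ : EnergyBound ε e₃ M)
    (h₄ : EnergyBound ε e₄ M) (h₅ : EnergyBound ε e₅ M) (h₆ : EnergyBound ε e₆ M)
    (h₇ : EnergyBound ε e₇ M) (h₈ : EnergyBound ε e₈ M) (h₉ : EnergyBound ε e₉ M) :
    EnergyBound ε (e₁ + e₂ + e₃ + e₄ + e₅ + e₆ + e₇ + e₈ + e₉) (766 * M) := by
  have := (((((((h₁.add h₂).add h₃).add h₄).add h₅).add h₆).add h₇).add h₈).add h₉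
  exact this.mono (le_of_eq (by ring))

end

/-! ## The parameters -/

/-- All requirements on $K$ are lower bounds, so a single $K$ can serve both the $x$-mesh and the
$y$-mesh. -/
theorem exists_meshConst {a κ θ K₁ : ℝ} (ha : 0 < a) (hκ : 0 < κ) (hθ : 0 < θ) :
    ∃ K₀ : ℝ, ∀ K, K₀ ≤ K → 8 * a ≤ K ∧ K₁ + 8 ≤ K ∧ K₁ + 8 ≤ K * (4 * a * θ) ∧ 1 ≤ 2 * κ * K := by
  refine ⟨max (max (8 * a) (K₁ + 8)) (max ((K₁ + 8) / (4 * a * θ)) (1 / (2 * κ))), fun K hK => ?_⟩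
  simp only [max_le_iff] at hK
  obtain ⟨⟨h1, h2⟩, h3, h4⟩ := hK
  refine ⟨h1, h2, ?_, ?_⟩
  · rwa [div_le_iff₀ (by positivity)] at h3
  · rw [div_le_iff₀ (by positivity)] at h4
    linarith

/-- From $\sqrt{A^2+4\varepsilon_1\beta}\le A+2\sqrt{\varepsilon_1\beta}$ with $A=\varepsilon_2b_*$,
which cancels in $\mu_0$. In $\mu_1$ the corresponding term is doubled instead, and this is the
origin of $\varepsilon_2$ in the final bound. -/
theorem mu0_bounds {ε₁ ε₂ bs β : ℝ} (hε₁ : 0 < ε₁) (hε₂ : 0 ≤ ε₂) (hbs : 0 ≤ bs) (hβ : 0 < β) :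
    0 < mu0 ε₁ ε₂ bs β ∧ ε₁ * mu0 ε₁ ε₂ bs β ≤ Real.sqrt β * Real.sqrt ε₁ := by
  have h0 : 0 ≤ ε₂ * bs := mul_nonneg hε₂ hbs
  have h1 : ε₂ * bs < Real.sqrt (ε₂ ^ 2 * bs ^ 2 + 4 * ε₁ * β) := by
    rw [Real.lt_sqrt h0, mul_pow]
    linarith [mul_pos hε₁ hβ]
  constructor
  · exact div_pos (by linarith) (by linarith)
  · have h2 : Real.sqrt (ε₂ ^ 2 * bs ^ 2 + 4 * ε₁ * β)
        ≤ ε₂ * bs + 2 * (Real.sqrt β * Real.sqrt ε₁) := by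
      refine Real.sqrt_le_iff.mpr ⟨by positivity, ?_⟩
      have e1 := Real.sq_sqrt hβ.le
      have e2 := Real.sq_sqrt hε₁.le
      have e3 : 0 ≤ 4 * (ε₂ * bs) * (Real.sqrt β * Real.sqrt ε₁) := by positivity
      calc ε₂ ^ 2 * bs ^ 2 + 4 * ε₁ * β
          = (ε₂ * bs) ^ 2 + 4 * (Real.sqrt β ^ 2 * Real.sqrt ε₁ ^ 2) := by rw [e1, e2]; ring
        _ ≤ _ := by nlinarith
    unfold mu0
    rw [mul_div_assoc', div_le_iff₀ (by linarith)]
    nlinarith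

theorem mu1_bounds {ε₁ ε₂ lam β : ℝ} (hε₁ : 0 < ε₁) (hε₂ : 0 ≤ ε₂) (hlam : 0 < lam) (hβ : 0 < β) :
    0 < mu1 ε₁ ε₂ lam β ∧
      ε₁ * mu1 ε₁ ε₂ lam β ≤ lam * ε₂ + Real.sqrt β * Real.sqrt ε₁ := by
  have h0 : 0 ≤ ε₂ * lam := mul_nonneg hε₂ hlam.le
  have h1 : 0 < Real.sqrt (ε₂ ^ 2 * lam ^ 2 + 4 * ε₁ * β) :=
    Real.sqrt_pos.mpr (by positivity)
  constructor
  · exact div_pos (by linarith) (by linarith)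
  · have h2 : Real.sqrt (ε₂ ^ 2 * lam ^ 2 + 4 * ε₁ * β)
        ≤ ε₂ * lam + 2 * (Real.sqrt β * Real.sqrt ε₁) := by
      refine Real.sqrt_le_iff.mpr ⟨by positivity, ?_⟩
      have e1 := Real.sq_sqrt hβ.le
      have e2 := Real.sq_sqrt hε₁.le
      have e3 : 0 ≤ 4 * (ε₂ * lam) * (Real.sqrt β * Real.sqrt ε₁) := by positivity
      calc ε₂ ^ 2 * lam ^ 2 + 4 * ε₁ * β
          = (ε₂ * lam) ^ 2 + 4 * (Real.sqrt β ^ 2 * Real.sqrt ε₁ ^ 2) := by rw [e1, e2]; ring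
        _ ≤ _ := by nlinarith
    unfold mu1
    rw [mul_div_assoc', div_le_iff₀ (by linarith)]
    nlinarith

theorem Coefficients.bStar_nonneg {b c : ℝ → ℝ} {lam β : ℝ} (h : Coefficients b c lam β) :
    0 ≤ bStar b := by
  have h0 : (0 : ℝ) ∈ Icc (0 : ℝ) 1 := ⟨le_rfl, zero_le_one⟩
  have h1 : BddAbove (b '' Icc 0 1) := (isCompact_Icc.image_of_continuousOn
    h.b_smooth.continuousOn).bddAbove
  exact (h.lam_pos.le.trans (h.b_ge 0 h0)).trans (le_csSup h1 ⟨0, h0, rfl⟩)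

theorem rpow_neg_half {ε : ℝ} (hε : 0 < ε) (j : ℕ) :
    ε ^ (-(j : ℝ) / 2) = (1 / Real.sqrt ε) ^ j := by
  rw [Real.sqrt_eq_rpow, one_div, ← Real.rpow_neg hε.le, ← Real.rpow_natCast, ← Real.rpow_mul hε.le]
  congr 1
  ring

theorem sqrt_rateSq_le (k N : ℕ) {σ : ℝ} (hσ : 0 ≤ σ) :
    Real.sqrt (rateSq k N σ) ≤ Real.sqrt σ * ((N : ℝ) ^ k)⁻¹ + ((N : ℝ) ^ (k + 1))⁻¹ := by
  refine Real.sqrt_le_iff.mpr ⟨by positivity, ?_⟩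
  have e : rateSq k N σ = (Real.sqrt σ * ((N : ℝ) ^ k)⁻¹) ^ 2 + (((N : ℝ) ^ (k + 1))⁻¹) ^ 2 := by
    rw [mul_pow, Real.sq_sqrt hσ, rateSq]
    ring
  rw [e]
  have : 0 ≤ Real.sqrt σ * ((N : ℝ) ^ k)⁻¹ * ((N : ℝ) ^ (k + 1))⁻¹ := by positivity
  nlinarith

/-- Cells $3n$ and $3n+1$ are the mirror images of the last two layer cells $n-1$ and $n-2$; they
carry the correction $Pv-\Theta v$. -/
theorem MeshData.transition_right {n : ℕ} {a κ τ θ K₁ K ρ₀ ρ₁ : ℝ}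
    (h : MeshData n a κ τ θ K₁ K ρ₀ ρ₁) {i : ℕ} (hi : 3 * n ≤ i) (hi' : i < 3 * n + 2) :
    1 ≤ K * ((bakhvalov n a ρ₀ ρ₁ (i + 1) - bakhvalov n a ρ₀ ρ₁ i) * ρ₁) := by
  have := h.two_le
  rw [h.right_length (by omega)]
  exact h.swap.transition_length_ge (by omega) (by omega)

theorem MeshData.layerBound_transition_le {n : ℕ} {a κ τ θ K₁ K ρ₀ ρ₁ : ℝ}
    (h : MeshData n a κ τ θ K₁ K ρ₀ ρ₁) :
    layerBound n ρ₀ (n - 1) ≤ K / (4 * n : ℕ) := by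
  have h2 := h.two_le
  rw [layerBound, if_pos (by omega)]
  refine (h.layerValue_le (by omega) (by omega)).trans ?_
  have := h.K_ge₂
  gcongr

/-- The interpolation errors for a decomposed function, on meshes that resolve the layers. -/
theorem LayerDecomposition.error_bounds {k n : ℕ} (hk : 1 ≤ k)
    {ε₁ μ₀ μ₁ p δ τ θ K₁ K C₀ L σ : ℝ} {u : ℝ × ℝ → ℝ}
    (D : LayerDecomposition k ε₁ μ₀ μ₁ p δ C₀ u) (hε : 0 < ε₁)
    (hx : MeshData n (τ / p) p τ θ K₁ K μ₀ μ₁)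
    (hy : MeshData n (τ / δ) δ τ θ K₁ K (1 / Real.sqrt ε₁) (1 / Real.sqrt ε₁))
    (hτ : (k : ℝ) + 1 ≤ τ) (hL : 0 ≤ L) (hσ : 0 ≤ σ) (hε1 : ε₁ ≤ L * σ)
    (hεμ₀ : ε₁ * μ₀ ≤ L * σ) (hεμ₁ : ε₁ * μ₁ ≤ L * σ)
    (hεy : ε₁ * (1 / Real.sqrt ε₁) ≤ L * σ)
    {X Y : ℕ → ℝ} (hX : X = bakhvalov n (τ / p) μ₀ μ₁)
    (hY : Y = bakhvalov n (τ / δ) (1 / Real.sqrt ε₁) (1 / Real.sqrt ε₁)) {c : ℝ}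
    (hc : c = 2 * compConst k C₀ K L + 2 * stripConst k C₀ K L) :
    (∀ E ∈ ({D.E11, D.E32, D.E33} : Set (ℝ × ℝ → ℝ)),
      MemL2 (modInterp k (4 * n) X Y E - E) ∧
      l2NormSq (modInterp k (4 * n) X Y E - E)
        ≤ c * (((4 * n : ℕ) : ℝ) ^ (2 * (k + 1)))⁻¹) ∧
    EnergyBound ε₁ (u - lagrangeInterp k (4 * n) X Y u) (766 * (c * rateSq k (4 * n) σ)) ∧
    EnergyBound ε₁ (u - layerInterp k (4 * n) X Y D) (766 * (c * rateSq k (4 * n) σ)) := by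
  -- The sign of $C_0$ is read off from the bound for $S$ at a corner.
  have hC₀ : 0 ≤ C₀ := (abs_nonneg _).trans
    (D.bound_S.2 0 0 (Nat.zero_le _) (0, 0) ⟨⟨le_rfl, zero_le_one⟩, ⟨le_rfl, zero_le_one⟩⟩)
  have hK := hx.K_pos
  have hn2 := hx.two_le
  have hN : 0 < 4 * n := by omega
  have hXm : UnitMesh (4 * n) X := hX ▸ hx.unitMesh
  have hYm : UnitMesh (4 * n) Y := hY ▸ hy.unitMesh
  have xS := hx.profile_smooth k
  have x0 := hx.profile_left hτ
  have x1 := hx.profile_right hτ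
  have yS := hy.profile_smooth k
  have y0 := hy.profile_left hτ
  have y1 := hy.profile_right hτ
  rw [← hX] at xS x0 x1
  rw [← hY] at yS y0 y1
  have hε1' : ε₁ * 1 ≤ L * σ := by rwa [mul_one]
  have hyl : ∀ t, δ * t / Real.sqrt ε₁ = δ * (1 / Real.sqrt ε₁) * t := fun t => by ring
  have hcomp : ∀ {v : ℝ × ℝ → ℝ}, EnergyBound ε₁ v (compConst k C₀ K L * rateSq k (4 * n) σ) →
      EnergyBound ε₁ v (c * rateSq k (4 * n) σ) := by
    intro v hv
    refine hv.mono ?_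
    have h1 : 0 ≤ rateSq k (4 * n) σ := by unfold rateSq; positivity
    have h2 : 0 ≤ compConst k C₀ K L := by
      unfold compConst
      have := derivConst_nonneg k C₀ hK.le
      have := interpConst_nonneg k C₀ K
      positivity
    have h3 : 0 ≤ stripConst k C₀ K L := by unfold stripConst; positivity
    rw [hc]
    gcongr
    linarith
  have hmul : 3 * (4 * n) / 4 = 3 * n := by omega
  have hq : layerBound n μ₁ (4 * n - 1 - 3 * (4 * n) / 4) ≤ K / (4 * n : ℕ) := by
    rw [hmul, show 4 * n - 1 - 3 * n = n - 1 by omega]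
    exact hx.swap.layerBound_transition_le
  have hl1 : 1 ≤ K * ((X (3 * (4 * n) / 4 + 1) - X (3 * (4 * n) / 4)) * μ₁) := by
    rw [hmul, hX]
    exact hx.transition_right le_rfl (by omega)
  have hl2 : 1 ≤ K * ((X (3 * (4 * n) / 4 + 2) - X (3 * (4 * n) / 4 + 1)) * μ₁) := by
    rw [hmul, hX]
    exact hx.transition_right (i := 3 * n + 1) (by omega) (by omega)
  have hly : ∀ j < 4 * n, 1 ≤ K * ((Y (j + 1) - Y j) * (1 / Real.sqrt ε₁) * (4 * n : ℕ)) := by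
    intro j hj
    rw [hY]
    exact hy.length_ge hj
  -- Each component pairs one $x$-profile (smooth, left, right) with one $y$-profile of the same
  -- kind.
  have bS := (component_interp (ε := ε₁) hk hC₀ hK hL hσ hXm hYm hN xS yS hε1' hε1' hε1 D.bound_S
    (by intro i j z; simp only [one_pow, mul_one])).2
  have b10 := (component_interp (ε := ε₁) hk hC₀ hK hL hσ hXm hYm hN x0 yS hεμ₀ hε1' hε1 D.bound_E10
    (by intro i j z; simp only [one_pow, mul_one]; ring)).2
  have b11 := (component_interp (ε := ε₁) hk hC₀ hK hL hσ hXm hYm hN x1 yS hεμ₁ hε1' hε1 D.bound_E11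
    (by intro i j z; simp only [one_pow, mul_one]; ring)).2
  have b20 := (component_interp (ε := ε₁) hk hC₀ hK hL hσ hXm hYm hN xS y0 hε1' hεy hε1 D.bound_E20
    (by intro i j z; simp only [one_pow, one_mul, hyl, rpow_neg_half hε]; ring)).2
  have b21 := (component_interp (ε := ε₁) hk hC₀ hK hL hσ hXm hYm hN xS y1 hε1' hεy hε1 D.bound_E21
    (by intro i j z; simp only [one_pow, one_mul, hyl, rpow_neg_half hε]; ring)).2
  have b31 := (component_interp (ε := ε₁) hk hC₀ hK hL hσ hXm hYm hN x0 y0 hεμ₀ hεy hε1 D.bound_E31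
    (by intro i j z; simp only [hyl, rpow_neg_half hε]; ring)).2
  have b32 := (component_interp (ε := ε₁) hk hC₀ hK hL hσ hXm hYm hN x1 y0 hεμ₁ hεy hε1 D.bound_E32
    (by intro i j z; simp only [hyl, rpow_neg_half hε]; ring)).2
  have b33 := (component_interp (ε := ε₁) hk hC₀ hK hL hσ hXm hYm hN x1 y1 hεμ₁ hεy hε1 D.bound_E33
    (by intro i j z; simp only [hyl, rpow_neg_half hε]; ring)).2
  have b34 := (component_interp (ε := ε₁) hk hC₀ hK hL hσ hXm hYm hN x0 y1 hεμ₀ hεy hε1 D.bound_E34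
    (by intro i j z; simp only [hyl, rpow_neg_half hε]; ring)).2
  -- The $y$-profile of $E_{11}$ is smooth, but `hεy` and `hly` still supply the mesh rate
  -- $1/\sqrt{\varepsilon_1}$.
  obtain ⟨m11, l11, e11⟩ := component_modInterp (ε := ε₁) hk hC₀ hK hL hσ hXm hYm (by omega) x1 yS
    hεy hεμ₁ hε1' hε1 hq hl1 hl2 hly D.bound_E11
    (by intro i j z; simp only [one_pow, mul_one]; ring)
  obtain ⟨m32, l32, e32⟩ := component_modInterp (ε := ε₁) hk hC₀ hK hL hσ hXm hYm (by omega) x1 y0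
    hεy hεμ₁ hεy hε1 hq hl1 hl2 hly D.bound_E32
    (by intro i j z; simp only [hyl, rpow_neg_half hε]; ring)
  obtain ⟨m33, l33, e33⟩ := component_modInterp (ε := ε₁) hk hC₀ hK hL hσ hXm hYm (by omega) x1 y1
    hεy hεμ₁ hεy hε1 hq hl1 hl2 hly D.bound_E33
    (by intro i j z; simp only [hyl, rpow_neg_half hε]; ring)
  rw [← hc] at l11 l32 l33 e11 e32 e33
  refine ⟨?_, ?_, ?_⟩
  · rintro E (rfl | rfl | rfl)
    · exact ⟨m11, l11⟩
    · exact ⟨m32, l32⟩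
    · exact ⟨m33, l33⟩
  · refine (energyBound_sum (hcomp bS) (hcomp b10) (hcomp b11) (hcomp b20) (hcomp b21)
      (hcomp b31) (hcomp b32) (hcomp b33) (hcomp b34)).congr fun z hz => ?_
    simp only [Pi.sub_apply, Pi.add_apply]
    rw [lagrangeInterp_congr hk hN hXm hYm D.sum_eq, D.sum_eq z (Omega_subset hz)]
    simp only [lagrangeInterp_add hk]
    ring
  · refine (energyBound_sum (hcomp bS) (hcomp b10) e11 (hcomp b20) (hcomp b21)
      (hcomp b31) e32 e33 (hcomp b34)).congr fun z hz => ?_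
    simp only [Pi.sub_apply, Pi.add_apply, layerInterp]
    rw [D.sum_eq z (Omega_subset hz)]
    ring

end TwoParam

/-! ### Choice of the constants and conclusion -/

theorem mainTheorem2
    (k : ℕ) (hk : 1 ≤ k)
    (b c : ℝ → ℝ) (lam β γ : ℝ) (hbc : TwoParam.Coefficients b c lam β) (hγ : 0 < γ)
    (p k₀ δ τ : ℝ) (hp : p ∈ Set.Ioo (0 : ℝ) 1) (hk₀ : k₀ ∈ Set.Ioo (0 : ℝ) (1 / 2))
    (hδ : 0 < δ) (hδp : δ ^ 2 ≤ (1 - p) * β / 2) (hτ : (k : ℝ) + 1 ≤ τ)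
    -- `ε₀ < 1` makes the standing assumption `ε₁, ε₂ ≪ 1` quantitative
    (ε₀ : ℝ) (hε₀ : ε₀ ∈ Set.Ioo (0 : ℝ) 1) (C₀ : ℝ) :
    ∃ C : ℝ, 0 < C ∧
      ∀ (ε₁ ε₂ : ℝ) (N : ℕ) (f u : ℝ × ℝ → ℝ),
        0 < ε₁ → ε₁ ≤ ε₀ → 0 < ε₂ → ε₂ ≤ ε₀ →
        (∀ x ∈ Set.Icc (0 : ℝ) 1, γ ≤ c x - 1 / 2 * ε₂ * derivWithin b (Set.Icc 0 1) x) →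
        (∀ x ∈ Set.Icc (0 : ℝ) 1, 2 * |derivWithin b (Set.Icc 0 1) x| * ε₂ ≤ k₀ * (1 - p) * β) →
        TwoParam.RightHandSide f →
        TwoParam.IsSolution ε₁ ε₂ b c f u →
        8 ≤ N → 4 ∣ N →
        ∀ μ₀ μ₁ : ℝ,
          μ₀ = TwoParam.mu0 ε₁ ε₂ (TwoParam.bStar b) β →
          μ₁ = TwoParam.mu1 ε₁ ε₂ lam β →
          μ₁⁻¹ ≤ μ₀⁻¹ → μ₀⁻¹ ≤ (N : ℝ)⁻¹ →
          TwoParam.sigmaX τ p μ₀ ≤ 1 / 4 → TwoParam.sigmaX τ p μ₁ ≤ 1 / 4 →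
          TwoParam.sigmaY τ δ ε₁ ≤ 1 / 4 →
          ∀ D : TwoParam.LayerDecomposition k ε₁ μ₀ μ₁ p δ C₀ u,
          ∀ x y : ℕ → ℝ,
            x = TwoParam.meshX N τ p μ₀ μ₁ →
            y = TwoParam.meshY N τ δ ε₁ →
            (TwoParam.MemL2 (TwoParam.modInterp k N x y D.E11 - D.E11) ∧
              TwoParam.MemL2 (TwoParam.modInterp k N x y D.E32 - D.E32) ∧
              TwoParam.MemL2 (TwoParam.modInterp k N x y D.E33 - D.E33) ∧
              TwoParam.l2Norm (TwoParam.modInterp k N x y D.E11 - D.E11)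
                + TwoParam.l2Norm (TwoParam.modInterp k N x y D.E32 - D.E32)
                + TwoParam.l2Norm (TwoParam.modInterp k N x y D.E33 - D.E33)
                ≤ C * ((N : ℝ) ^ (k + 1))⁻¹) ∧
            (TwoParam.MemH1 (u - TwoParam.lagrangeInterp k N x y u) ∧
              TwoParam.MemH1 (u - TwoParam.layerInterp k N x y D) ∧
              TwoParam.energyNorm ε₁ (u - TwoParam.lagrangeInterp k N x y u)
                + TwoParam.energyNorm ε₁ (u - TwoParam.layerInterp k N x y D)
                ≤ C * (Real.sqrt (Real.sqrt ε₁ + ε₂) * ((N : ℝ) ^ k)⁻¹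
                  + ((N : ℝ) ^ (k + 1))⁻¹)) := by
  have hp0 := hp.1
  have hβ := hbc.β_pos
  have hlam := hbc.lam_pos
  have hτ0 : 0 < τ := by linarith [(Nat.cast_nonneg k : (0 : ℝ) ≤ k)]
  have hsε₀ : Real.sqrt ε₀ < 1 := by
    rw [Real.sqrt_lt' one_pos, one_pow]
    exact hε₀.2
  -- A uniform lower bound for $1-\rho^{-1}$: $\mu_i^{-1}\le N^{-1}\le\frac12$ in $x$, and
  -- $\sqrt{\varepsilon_1}\le\sqrt{\varepsilon_0}<1$ in $y$.
  set θ : ℝ := min (1 / 2) (1 - Real.sqrt ε₀) with hθdef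
  have hθ : 0 < θ := lt_min (by norm_num) (by linarith)
  set K₁ : ℝ := 1 + Real.sqrt β with hK₁def
  have hsβ := Real.sqrt_nonneg β
  have hax : 0 < τ / p := div_pos hτ0 hp0
  have hay : 0 < τ / δ := div_pos hτ0 hδ
  obtain ⟨Kx, hKx⟩ := TwoParam.exists_meshConst (K₁ := K₁) hax hp0 hθ
  obtain ⟨Ky, hKy⟩ := TwoParam.exists_meshConst (K₁ := K₁) hay hδ hθ
  set K := max Kx Ky with hKdef
  obtain ⟨x1, x2, x3, x4⟩ := hKx K (le_max_left _ _)
  obtain ⟨y1, y2, y3, y4⟩ := hKy K (le_max_right _ _)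
  set L : ℝ := 1 + lam + Real.sqrt β with hLdef
  have hL : 0 ≤ L := by positivity
  set c := 2 * TwoParam.compConst k C₀ K L + 2 * TwoParam.stripConst k C₀ K L with hc
  -- Three $L^2$ norms cost $\sqrt c$ each and two energy norms $\sqrt{766c}$ each; the summand $1$
  -- ensures positivity.
  refine ⟨3 * Real.sqrt c + 2 * Real.sqrt (766 * c) + 1, by positivity, ?_⟩
  intro ε₁ ε₂ N f u hε₁ hε₁0 hε₂ hε₂0 _ _ _ _ hN8 hN4 μ₀ μ₁ hμ₀ hμ₁ hμ hμN hs0 hs1 hsy D x y hx hy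
  obtain ⟨n, rfl⟩ := hN4
  have hs : 0 < Real.sqrt ε₁ := Real.sqrt_pos.mpr hε₁
  have hss : Real.sqrt ε₁ * Real.sqrt ε₁ = ε₁ := Real.mul_self_sqrt hε₁.le
  have hs1' : Real.sqrt ε₁ ≤ Real.sqrt ε₀ := Real.sqrt_le_sqrt hε₁0
  have hNpos : (0 : ℝ) < (4 * n : ℕ) := by exact_mod_cast (by omega : 0 < 4 * n)
  have hN8' : (8 : ℝ) ≤ (4 * n : ℕ) := by exact_mod_cast hN8
  obtain ⟨hμ₀pos, hεμ₀⟩ := TwoParam.mu0_bounds hε₁ hε₂.le hbc.bStar_nonneg hβ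
  obtain ⟨hμ₁pos, hεμ₁⟩ := TwoParam.mu1_bounds hε₁ hε₂.le hlam hβ
  rw [← hμ₀] at hμ₀pos hεμ₀
  rw [← hμ₁] at hμ₁pos hεμ₁
  have hNinv : ((4 * n : ℕ) : ℝ)⁻¹ ≤ 1 / 2 := by
    rw [inv_le_comm₀ hNpos (by norm_num)]
    linarith
  have hres : ((4 * n : ℕ) : ℝ)⁻¹ ≤ K₁ / (4 * n : ℕ) := by
    rw [inv_eq_one_div]
    gcongr
    linarith
  have hθ2 : θ ≤ 1 / 2 := min_le_left _ _
  have hθs : θ ≤ 1 - Real.sqrt ε₀ := min_le_right _ _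
  have hyinv : (1 / Real.sqrt ε₁)⁻¹ = Real.sqrt ε₁ := by rw [one_div, inv_inv]
  -- No relation between $\varepsilon_1$ and $N$ is assumed directly: $N\le\mu_0$ and
  -- $\sqrt{\varepsilon_1}\,\mu_0\le\sqrt\beta$ give $\sqrt{\varepsilon_1}N\le\sqrt\beta\le K_1$.
  have hresy : Real.sqrt ε₁ ≤ K₁ / (4 * n : ℕ) := by
    rw [le_div_iff₀ hNpos]
    have h1 : ((4 * n : ℕ) : ℝ) ≤ μ₀ := (inv_le_inv₀ hμ₀pos hNpos).mp hμN
    have h2 : Real.sqrt ε₁ * (Real.sqrt ε₁ * μ₀) ≤ Real.sqrt ε₁ * Real.sqrt β := by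
      rw [← mul_assoc, hss]
      linarith
    have h3 := le_of_mul_le_mul_left h2 hs
    have h4 := mul_le_mul_of_nonneg_left h1 hs.le
    linarith
  have hMx : TwoParam.MeshData n (τ / p) p τ θ K₁ K μ₀ μ₁ :=
    { two_le := by omega
      a_pos := hax
      κ_pos := hp0
      mul_eq := mul_div_cancel₀ _ hp0.ne'
      θ_pos := hθ
      pos₀ := hμ₀pos
      pos₁ := hμ₁pos
      gap₀ := by linarith
      gap₁ := by linarith
      res₀ := hμN.trans hres
      res₁ := (hμ.trans hμN).trans hres
      transition₀ := by rwa [div_div]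
      transition₁ := by rwa [div_div]
      K_ge₁ := x1
      K_ge₂ := x2
      K_ge₃ := x3
      K_ge₄ := x4 }
  have hsy' : τ / δ / (1 / Real.sqrt ε₁) * Real.log (1 / Real.sqrt ε₁) ≤ 1 / 4 := by
    rwa [div_div_eq_mul_div, div_one]
  have hMy : TwoParam.MeshData n (τ / δ) δ τ θ K₁ K (1 / Real.sqrt ε₁) (1 / Real.sqrt ε₁) :=
    { two_le := by omega
      a_pos := hay
      κ_pos := hδ
      mul_eq := mul_div_cancel₀ _ hδ.ne'
      θ_pos := hθ
      pos₀ := by positivity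
      pos₁ := by positivity
      gap₀ := by rw [hyinv]; linarith
      gap₁ := by rw [hyinv]; linarith
      res₀ := by rw [hyinv]; exact hresy
      res₁ := by rw [hyinv]; exact hresy
      transition₀ := hsy'
      transition₁ := hsy'
      K_ge₁ := y1
      K_ge₂ := y2
      K_ge₃ := y3
      K_ge₄ := y4 }
  set σ := Real.sqrt ε₁ + ε₂ with hσdef
  have hσ : 0 ≤ σ := by positivity
  have hεs : ε₁ ≤ Real.sqrt ε₁ := by
    have h1 : Real.sqrt ε₁ * Real.sqrt ε₁ ≤ Real.sqrt ε₁ * 1 :=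
      mul_le_mul_of_nonneg_left (by linarith) hs.le
    linarith
  have hLs : Real.sqrt ε₁ ≤ L * σ := by
    have h1 : 0 ≤ (lam + Real.sqrt β) * σ + ε₂ := by positivity
    have e : L * σ = Real.sqrt ε₁ + ((lam + Real.sqrt β) * σ + ε₂) := by
      rw [hLdef, hσdef]; ring
    linarith
  have hLμ : lam * ε₂ + Real.sqrt β * Real.sqrt ε₁ ≤ L * σ := by
    have : 0 ≤ σ + lam * Real.sqrt ε₁ + Real.sqrt β * ε₂ := by positivity
    have e : L * σ = lam * ε₂ + Real.sqrt β * Real.sqrt ε₁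
        + (σ + lam * Real.sqrt ε₁ + Real.sqrt β * ε₂) := by rw [hLdef, hσdef]; ring
    linarith
  have hεy : ε₁ * (1 / Real.sqrt ε₁) ≤ L * σ := by
    have : ε₁ * (1 / Real.sqrt ε₁) = Real.sqrt ε₁ := by
      rw [mul_one_div, Real.div_sqrt]
    rw [this]
    exact hLs
  obtain ⟨hmod, hB1, hB2⟩ := D.error_bounds hk hε₁ hMx hMy hτ hL hσ (hεs.trans hLs)
    (hεμ₀.trans (le_trans (le_add_of_nonneg_left (by positivity)) hLμ)) (hεμ₁.trans hLμ) hεy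
    (hx.trans (TwoParam.meshX_eq_bakhvalov n τ p μ₀ μ₁))
    (hy.trans (TwoParam.meshY_eq_bakhvalov n τ δ ε₁)) hc
  obtain ⟨m11, l11⟩ := hmod D.E11 (by simp)
  obtain ⟨m32, l32⟩ := hmod D.E32 (by simp)
  obtain ⟨m33, l33⟩ := hmod D.E33 (by simp)
  obtain ⟨h1, n1⟩ := hB1.energyNorm_le hε₁.le
  obtain ⟨h2, n2⟩ := hB2.energyNorm_le hε₁.le
  have hc0 := Real.sqrt_nonneg c
  have hc1 := Real.sqrt_nonneg (766 * c)
  have hr0 : 0 ≤ (((4 * n : ℕ) : ℝ) ^ (k + 1))⁻¹ := by positivity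
  refine ⟨⟨m11, m32, m33, ?_⟩, h1, h2, ?_⟩
  · have key : ∀ v, TwoParam.l2NormSq v ≤ c * (((4 * n : ℕ) : ℝ) ^ (2 * (k + 1)))⁻¹ →
        TwoParam.l2Norm v ≤ Real.sqrt c * (((4 * n : ℕ) : ℝ) ^ (k + 1))⁻¹ := by
      intro v hv
      refine (Real.sqrt_le_sqrt hv).trans (le_of_eq ?_)
      have : (((4 * n : ℕ) : ℝ) ^ (2 * (k + 1)))⁻¹ = ((((4 * n : ℕ) : ℝ) ^ (k + 1))⁻¹) ^ 2 := by
        rw [inv_pow, ← pow_mul, mul_comm 2]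
      rw [this, Real.sqrt_mul' _ (sq_nonneg _), Real.sqrt_sq hr0]
    have := key _ l11
    have := key _ l32
    have := key _ l33
    have : 0 ≤ (2 * Real.sqrt (766 * c) + 1) * (((4 * n : ℕ) : ℝ) ^ (k + 1))⁻¹ := by positivity
    linarith
  · have hT := TwoParam.sqrt_rateSq_le k (4 * n) hσ
    have hT0 : 0 ≤ TwoParam.rateSq k (4 * n) σ := by unfold TwoParam.rateSq; positivity
    have e : Real.sqrt (766 * (c * TwoParam.rateSq k (4 * n) σ))
        ≤ Real.sqrt (766 * c) * (Real.sqrt σ * (((4 * n : ℕ) : ℝ) ^ k)⁻¹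
          + (((4 * n : ℕ) : ℝ) ^ (k + 1))⁻¹) := by
      rw [← mul_assoc, Real.sqrt_mul' _ hT0]
      gcongr
    have : 0 ≤ (3 * Real.sqrt c + 1) * (Real.sqrt σ * (((4 * n : ℕ) : ℝ) ^ k)⁻¹
          + (((4 * n : ℕ) : ℝ) ^ (k + 1))⁻¹) := by positivity
    linarith
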